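/- Real numbers are given by sequences of rationals $(q_n)$ with $|q_n-q_{n+i}|<2^{-n}$ for all $n,i$, and $=_{\mathbb R}$, $<_{\mathbb R}$ are the usual relations between such representations. (1) Kohlenbach's base theory $\mathsf{RCA}_0^\omega$ of higher-order reverse mathematics (ordered semi-ring axioms for type $0$, the combinators $K$ and $S$, the recursor $\mathbf R_0$, extensionality, quantifier-free induction and $\mathsf{QF\text{-}AC}^{1,0}$) proves the following. Let $f:\mathbb R\to\mathbb R$ be a third-order function (an object of type $1\to1$ that maps reals to reals and equal reals to equal reals) which is $\varepsilon$-$\delta$-continuous on $(0,1)$ and satisfies $\lim_{x\to0^+}f(x)=0$. Then there is a third-order function $\tilde f:\mathbb R\to\mathbb R$ such that $\tilde f(x)=_{\mathbb R}f(x)$ for all $x\in(0,1)$, $\tilde f(0)=_{\mathbb R}0$, and $\tilde f$ is $\varepsilon$-$\delta$-continuous on $[0,1)$ (i.e. its restriction to $[0,1)$ is continuous). (2) In contrast, the following are equivalent over $\mathsf{RCA}_0$: (a) $\mathsf{ACA}_0$, i.e. the scheme of arithmetical comprehension; (b) for every RM-code $\Phi$ (a second-order code of a continuous partial function $f$ from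 $\mathbb R$ to $\mathbb R$, i.e. a set of tuples $(n,a,r,b,s)$ with rational $a,b$ and positive rational $r,s$ satisfying Simpson's conditions) such that $f$ is defined on $(0,1)$ and $\lim_{x\to0^+}f(x)=0$, there is an RM-code $\Psi$ of a continuous partial function $\tilde f$ that is defined on $[0,1)$, with $\tilde f(x)=_{\mathbb R}f(x)$ for all $x\in(0,1)$ and $\tilde f(0)=_{\mathbb R}0$. Here a theory proves a sentence iff the sentence holds in every model of the theory (for $\mathsf{RCA}_0^\omega$: every, possibly non-full, type structure; for $\mathsf{RCA}_0$: every, possibly nonstandard, two-sorted structure of numbers and sets). -/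

import Mathlib

universe u v

namespace ReverseMath

/-! ## Arithmetic in a (possibly nonstandard) structure of natural numbers -/

/-- The operations `0, 1, +, *, <` on the number sort of a structure for (second- or higher-order)
arithmetic, together with the graph `IsTwoPow n e` of the function `e = 2 ^ n` of that structure.
No laws are imposed here. -/
class NumOps (N : Type u) extends Zero N, One N, Add N, Mul N, LT N where
  IsTwoPow : N → N → Prop

section Numbers

variable {N : Type u} [NumOps N]

/-- The pairing function `(i, j) ↦ (i + j) ^ 2 + i`. -/
def pair (i j : N) : N := (i + j) * (i + j) + i

/-- A signed quotient `(pos - neg) / den` of natural numbers; it is a rational number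
if `0 < den`. -/
@[ext]
structure RatRep (N : Type u) where
  pos : N
  neg : N
  den : N

namespace RatRep

/-- The natural number that codes a signed quotient. -/
def code (a : RatRep N) : N := pair (pair a.pos a.neg) a.den

instance : Zero (RatRep N) := ⟨⟨0, 0, 1⟩⟩

instance : One (RatRep N) := ⟨⟨1, 0, 1⟩⟩

instance : Add (RatRep N) :=
  ⟨fun a b => ⟨a.pos * b.den + b.pos * a.den, a.neg * b.den + b.neg * a.den, a.den * b.den⟩⟩

/-- `(p - s) / d < (p' - s') / d'` iff `p * d' + s' * d < p' * d + s * d'`. -/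
instance : LT (RatRep N) :=
  ⟨fun a b => a.pos * b.den + b.neg * a.den < b.pos * a.den + a.neg * b.den⟩

instance : LE (RatRep N) := ⟨fun a b => ¬ b < a⟩

/-- `|a - b| < c` for rationals. -/
def DistLt (a b c : RatRep N) : Prop := a < b + c ∧ b < a + c

/-- `|a - b| ≤ c` for rationals. -/
def DistLe (a b c : RatRep N) : Prop := a ≤ b + c ∧ b ≤ a + c

end RatRep

/-! ## Real numbers as fast converging Cauchy sequences of rationals

A sequence of rationals is given by its graph: `x n a` says that the `n`-th term of `x` is `a`.
In the applications below the graph always comes from an object of the structure. -/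

/-- The graph of a sequence of signed quotients. -/
abbrev RatSeq (N : Type u) := N → RatRep N → Prop

namespace RatSeq

/-- The constant sequence of a rational. -/
def const (c : RatRep N) : RatSeq N := fun _ a => a = c

/-- `x` is a real number: a sequence of rationals `(q_n)` such that `|q_n - q_{n+i}| < 2 ^ (-n)`
for all `n`, `i`. -/
def IsReal (x : RatSeq N) : Prop :=
  (∀ n, ∃! a, x n a) ∧ (∀ n a, x n a → 0 < a.den) ∧
    ∀ n i e a b, NumOps.IsTwoPow n e → x n a → x (n + i) b → a.DistLt b ⟨1, 0, e⟩

/-- `x < y` for reals: `q_n + 2 ^ (-n+1) < r_n` for some `n`. -/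
def Lt (x y : RatSeq N) : Prop :=
  ∃ n e a b, NumOps.IsTwoPow n e ∧ x n a ∧ y n b ∧ a + ⟨1 + 1, 0, e⟩ < b

/-- `x ≤ y` for reals. -/
def Le (x y : RatSeq N) : Prop := ¬ y.Lt x

/-- `|x - y| < c` for reals `x`, `y` and a rational `c`: `|q_n - r_n| + 2 ^ (-n+1) < c`
for some `n`. -/
def DistLt (x y : RatSeq N) (c : RatRep N) : Prop :=
  ∃ n e a b, NumOps.IsTwoPow n e ∧ x n a ∧ y n b ∧
    a + ⟨1 + 1, 0, e⟩ < b + c ∧ b + ⟨1 + 1, 0, e⟩ < a + c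

/-- `|x - y| ≤ c` for reals `x`, `y` and a rational `c`: `|q_n - r_n| ≤ c + 2 ^ (-n+1)`
for all `n`. -/
def DistLe (x y : RatSeq N) (c : RatRep N) : Prop :=
  ∀ n e a b, NumOps.IsTwoPow n e → x n a → y n b → a.DistLe b (c + ⟨1 + 1, 0, e⟩)

/-- `x = y` for reals: `|q_n - r_n| ≤ 2 ^ (-n+1)` for all `n`. -/
def Eqv (x y : RatSeq N) : Prop :=
  ∀ n e a b, NumOps.IsTwoPow n e → x n a → y n b → a.DistLe b ⟨1 + 1, 0, e⟩

/-- `x` is a real in `(0, 1)`. -/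
def InIoo (x : RatSeq N) : Prop := x.IsReal ∧ (const 0).Lt x ∧ x.Lt (const 1)

/-- `x` is a real in `[0, 1)`. -/
def InIco (x : RatSeq N) : Prop := x.IsReal ∧ (const 0).Le x ∧ x.Lt (const 1)

end RatSeq

end Numbers

/-! ## Higher-order arithmetic -/

/-- The finite types: `nat` is the type `0`, `arr σ τ` is the type `σ → τ`. -/
inductive FinType where
  | nat : FinType
  | arr : FinType → FinType → FinType
  deriving DecidableEq

/-- The type `1 = 0 → 0`. -/
abbrev FinType.fn : FinType := .arr .nat .nat

/-- The constants of the language of higher-order arithmetic. The relations `=` and `<` at type `0`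
are the atomic formulas of `QFFormula`. -/
inductive Const : FinType → Type where
  | zero : Const .nat
  | one : Const .nat
  | add : Const (.arr .nat (.arr .nat .nat))
  | mul : Const (.arr .nat (.arr .nat .nat))
  | K (ρ τ : FinType) : Const (.arr ρ (.arr τ ρ))
  | S (ρ σ τ : FinType) :
      Const (.arr (.arr ρ (.arr σ τ)) (.arr (.arr ρ σ) (.arr ρ τ)))
  | R (σ : FinType) : Const (.arr (.arr .nat (.arr σ σ)) (.arr σ (.arr .nat σ)))

/-- The terms; for every finite type `σ` there are variables `var σ i`, `i = 0, 1, 2, …`. -/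
inductive Term : FinType → Type where
  | var (σ : FinType) (i : ℕ) : Term σ
  | const {σ : FinType} (c : Const σ) : Term σ
  | app {σ τ : FinType} (t : Term (.arr σ τ)) (s : Term σ) : Term τ

/-- The quantifier-free formulas. Variables of all finite types may occur; the atomic formulas
are the equalities and inequalities of type `0`. -/
inductive QFFormula where
  | eq (t s : Term .nat) : QFFormula
  | lt (t s : Term .nat) : QFFormula
  | not (A : QFFormula) : QFFormula
  | and (A B : QFFormula) : QFFormula

/-- A structure for the language of higher-order arithmetic (a Henkin structure: the elements of
`carrier (arr σ τ)` need not be all functions). -/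
structure OmegaStructure where
  carrier : FinType → Type u
  app : {σ τ : FinType} → carrier (.arr σ τ) → carrier σ → carrier τ
  const : {σ : FinType} → Const σ → carrier σ
  lt : carrier .nat → carrier .nat → Prop

namespace OmegaStructure

variable (M : OmegaStructure.{u})

/-- The objects of type `0`. -/
abbrev Num : Type u := M.carrier .nat

/-- The objects of type `1`. -/
abbrev Fn : Type u := M.carrier .fn

/-- `2 ^ n`, by primitive recursion: `R₀ f 1 n` with `f = K (S (+) (S K K))`, so that
`f k m = m + m`. -/
def twoPow (n : M.Num) : M.Num :=
  M.app (M.app (M.app (M.const (.R .nat))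
    (M.app (M.const (.K .fn .nat))
      (M.app (M.app (M.const (.S .nat .nat .nat)) (M.const .add))
        (M.app (M.app (M.const (.S .nat .fn .nat)) (M.const (.K .nat .fn)))
          (M.const (.K .nat .nat)))))) (M.const .one)) n

instance : NumOps M.Num where
  zero := M.const .zero
  one := M.const .one
  add a b := M.app (M.app (M.const .add) a) b
  mul a b := M.app (M.app (M.const .mul) a) b
  lt a b := M.lt a b
  IsTwoPow n e := e = M.twoPow n

/-- Equality at a finite type, defined from equality at type `0`. -/
def ExtEq : {σ : FinType} → M.carrier σ → M.carrier σ → Prop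
  | .nat, x, y => x = y
  | .arr σ _, x, y => ∀ z : M.carrier σ, ExtEq (M.app x z) (M.app y z)

/-- An assignment of objects to the variables. -/
abbrev Valuation : Type u := (p : FinType × ℕ) → M.carrier p.1

variable {M}

/-- The valuation that agrees with `v` except that the variable `var σ i` gets the value `a`. -/
def Valuation.set (v : M.Valuation) (σ : FinType) (i : ℕ) (a : M.carrier σ) : M.Valuation :=
  Function.update v (σ, i) a

/-- The value of a term. -/
def eval (v : M.Valuation) : {σ : FinType} → Term σ → M.carrier σ
  | _, .var σ i => v (σ, i)
  | _, .const c => M.const c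
  | _, .app t s => M.app (eval v t) (eval v s)

/-- Satisfaction of quantifier-free formulas. -/
def Holds (v : M.Valuation) : QFFormula → Prop
  | .eq t s => eval v t = eval v s
  | .lt t s => M.lt (eval v t) (eval v s)
  | .not A => ¬ Holds v A
  | .and A B => Holds v A ∧ Holds v B

variable (M)

/-- The axioms of a discretely ordered commutative semiring, for the objects of type `0`. -/
structure BasicAxioms : Prop where
  add_assoc : ∀ a b c : M.Num, a + b + c = a + (b + c)
  add_comm : ∀ a b : M.Num, a + b = b + a
  add_zero : ∀ a : M.Num, a + 0 = a
  mul_assoc : ∀ a b c : M.Num, a * b * c = a * (b * c)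
  mul_comm : ∀ a b : M.Num, a * b = b * a
  mul_one : ∀ a : M.Num, a * 1 = a
  mul_zero : ∀ a : M.Num, a * 0 = 0
  mul_add : ∀ a b c : M.Num, a * (b + c) = a * b + a * c
  lt_irrefl : ∀ a : M.Num, ¬ a < a
  lt_trans : ∀ a b c : M.Num, a < b → b < c → a < c
  lt_trichotomy : ∀ a b : M.Num, a < b ∨ a = b ∨ b < a
  add_lt_add : ∀ a b c : M.Num, a < b → a + c < b + c
  mul_lt_mul : ∀ a b c : M.Num, a < b → 0 < c → a * c < b * c
  exists_add : ∀ a b : M.Num, a < b → ∃ c, a + c = b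
  not_lt_zero : ∀ a : M.Num, ¬ a < 0
  zero_lt_one : (0 : M.Num) < 1
  discrete : ∀ a : M.Num, 0 < a → a = 1 ∨ 1 < a

/-- `M` is a model of Kohlenbach's base theory `RCA₀^ω`. The recursor constant is axiomatized at
type `0` only. -/
structure ModelsRCAω : Prop where
  basic : M.BasicAxioms
  K_eq : ∀ (ρ τ : FinType) (x : M.carrier ρ) (y : M.carrier τ),
    M.ExtEq (M.app (M.app (M.const (.K ρ τ)) x) y) x
  S_eq : ∀ (ρ σ τ : FinType) (x : M.carrier (.arr ρ (.arr σ τ))) (y : M.carrier (.arr ρ σ))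
    (z : M.carrier ρ),
    M.ExtEq (M.app (M.app (M.app (M.const (.S ρ σ τ)) x) y) z) (M.app (M.app x z) (M.app y z))
  R_zero : ∀ (f : M.carrier (.arr .nat .fn)) (m : M.Num),
    M.app (M.app (M.app (M.const (.R .nat)) f) m) (0 : M.Num) = m
  R_succ : ∀ (f : M.carrier (.arr .nat .fn)) (m n : M.Num),
    M.app (M.app (M.app (M.const (.R .nat)) f) m) (n + 1 : M.Num) =
      M.app (M.app f n) (M.app (M.app (M.app (M.const (.R .nat)) f) m) n)
  /-- The axiom of extensionality. -/
  ext : ∀ (ρ τ : FinType) (x y : M.carrier ρ) (φ : M.carrier (.arr ρ τ)),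
    M.ExtEq x y → M.ExtEq (M.app φ x) (M.app φ y)
  /-- Induction for quantifier-free formulas (with parameters, given by `v`). -/
  qf_induction : ∀ (A : QFFormula) (v : M.Valuation) (i : ℕ),
    Holds (v.set .nat i (0 : M.Num)) A →
    (∀ n : M.Num, Holds (v.set .nat i n) A → Holds (v.set .nat i (n + 1 : M.Num)) A) →
    ∀ n : M.Num, Holds (v.set .nat i n) A
  /-- `QF-AC^{1,0}`, the quantifier-free axiom of choice (with parameters, given by `v`). -/
  qf_ac : ∀ (A : QFFormula) (v : M.Valuation) (i j : ℕ),
    (∀ x : M.Fn, ∃ y : M.Num, Holds ((v.set .fn i x).set .nat j y) A) →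
    ∃ Y : M.carrier (.arr .fn .nat),
      ∀ x : M.Fn, Holds ((v.set .fn i x).set .nat j (M.app Y x)) A

variable {M}

/-- The sequence of rationals coded by an object of type `1`. -/
def seq (x : M.Fn) : RatSeq M.Num := fun n a => 0 < a.den ∧ M.app x n = a.code

/-- `f : ℝ → ℝ`: the object `f` of type `1 → 1` maps reals to reals, and equal reals
to equal reals. -/
def IsRealFun (f : M.carrier (.arr .fn .fn)) : Prop :=
  (∀ x : M.Fn, (seq x).IsReal → (seq (M.app f x)).IsReal) ∧
    ∀ x y : M.Fn, (seq x).IsReal → (seq y).IsReal → (seq x).Eqv (seq y) →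
      (seq (M.app f x)).Eqv (seq (M.app f y))

/-- Epsilon-delta continuity of `f` on a set `D` of reals. -/
def ContinuousOnReals (f : M.carrier (.arr .fn .fn)) (D : RatSeq M.Num → Prop) : Prop :=
  ∀ x : M.Fn, D (seq x) → ∀ k : M.Num, ∃ m : M.Num, ∀ y : M.Fn, D (seq y) →
    (seq x).DistLt (seq y) ⟨1, 0, M.twoPow m⟩ →
      (seq (M.app f x)).DistLt (seq (M.app f y)) ⟨1, 0, M.twoPow k⟩

/-- `f(x)` tends to `0` as `x` tends to `0` from the right. -/
def TendsToZeroAtZeroRight (f : M.carrier (.arr .fn .fn)) : Prop :=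
  ∀ k : M.Num, ∃ m : M.Num, ∀ x : M.Fn, (seq x).IsReal → (RatSeq.const 0).Lt (seq x) →
    (seq x).Lt (RatSeq.const ⟨1, 0, M.twoPow m⟩) →
      (seq (M.app f x)).DistLt (RatSeq.const 0) ⟨1, 0, M.twoPow k⟩

variable (M)

/-- The one-point-extension theorem for third-order functions, in the structure `M`. -/
def OnePointExtension : Prop :=
  ∀ f : M.carrier (.arr .fn .fn), IsRealFun f →
    ContinuousOnReals f RatSeq.InIoo → TendsToZeroAtZeroRight f →
    ∃ g : M.carrier (.arr .fn .fn), IsRealFun g ∧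
      (∀ x : M.Fn, (seq x).InIoo → (seq (M.app g x)).Eqv (seq (M.app f x))) ∧
      (∀ x : M.Fn, (seq x).IsReal → (seq x).Eqv (RatSeq.const 0) →
        (seq (M.app g x)).Eqv (RatSeq.const 0)) ∧
      ContinuousOnReals g RatSeq.InIco

end OmegaStructure

/-! ## Second-order arithmetic -/

/-- A structure for the language of second-order arithmetic, with a sort of numbers and a sort
of sets of numbers. -/
structure L2Structure where
  Num : Type u
  Sets : Type v
  zero : Num
  one : Num
  add : Num → Num → Num
  mul : Num → Num → Num
  lt : Num → Num → Prop
  mem : Num → Sets → Prop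

/-- The numerical terms; the number variables are `var 0, var 1, …`. -/
inductive NumTerm where
  | var (i : ℕ) : NumTerm
  | zero : NumTerm
  | one : NumTerm
  | add (t s : NumTerm) : NumTerm
  | mul (t s : NumTerm) : NumTerm

/-- The arithmetical formulas: no set quantifiers, but set variables `0, 1, …` may occur free.
`ball i t A` is the bounded quantification `∀ x_i < t, A`, where the variable `x_i` in `t` is not
in the scope of the quantifier. -/
inductive ArithFormula where
  | eq (t s : NumTerm) : ArithFormula
  | lt (t s : NumTerm) : ArithFormula
  | mem (t : NumTerm) (j : ℕ) : ArithFormula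
  | not (A : ArithFormula) : ArithFormula
  | and (A B : ArithFormula) : ArithFormula
  | ball (i : ℕ) (t : NumTerm) (A : ArithFormula) : ArithFormula
  | all (i : ℕ) (A : ArithFormula) : ArithFormula

/-- The bounded quantifier (`Σ⁰₀`) formulas. -/
def ArithFormula.IsBounded : ArithFormula → Prop
  | .eq _ _ => True
  | .lt _ _ => True
  | .mem _ _ => True
  | .not A => A.IsBounded
  | .and A B => A.IsBounded ∧ B.IsBounded
  | .ball _ _ A => A.IsBounded
  | .all _ _ => False

namespace L2Structure

variable (M : L2Structure.{u, v})

/-- `X` is the graph of the function `n ↦ 2 ^ n`, as a set of pairs. -/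
def IsTwoPowGraph (X : M.Sets) : Prop :=
  let p (i j : M.Num) : M.Num := M.add (M.mul (M.add i j) (M.add i j)) i
  (∀ e, M.mem (p M.zero e) X ↔ e = M.one) ∧
    ∀ n e, M.mem (p (M.add n M.one) e) X ↔ ∃ d, M.mem (p n d) X ∧ e = M.add d d

/-- In `IsTwoPow`, the number `e` is `2 ^ n`: the pair `(n, e)` belongs to a set that is the graph
of the function defined by primitive recursion. -/
instance : NumOps M.Num where
  zero := M.zero
  one := M.one
  add := M.add
  mul := M.mul
  lt := M.lt
  IsTwoPow n e :=
    ∃ X : M.Sets, M.IsTwoPowGraph X ∧ M.mem (M.add (M.mul (M.add n e) (M.add n e)) n) X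

variable {M}

/-- The value of a numerical term. -/
def eval (v : ℕ → M.Num) : NumTerm → M.Num
  | .var i => v i
  | .zero => 0
  | .one => 1
  | .add t s => eval v t + eval v s
  | .mul t s => eval v t * eval v s

/-- Satisfaction of arithmetical formulas; `v` and `V` give the values of the number and of the set
variables. -/
def Holds (V : ℕ → M.Sets) : (ℕ → M.Num) → ArithFormula → Prop
  | v, .eq t s => eval v t = eval v s
  | v, .lt t s => eval v t < eval v s
  | v, .mem t j => M.mem (eval v t) (V j)
  | v, .not A => ¬ Holds V v A
  | v, .and A B => Holds V v A ∧ Holds V v B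
  | v, .ball i t A => ∀ a : M.Num, a < eval v t → Holds V (Function.update v i a) A
  | v, .all i A => ∀ a : M.Num, Holds V (Function.update v i a) A

variable (M)

/-- `M` is a model of `RCA₀`. -/
structure ModelsRCA : Prop where
  sets_nonempty : Nonempty M.Sets
  succ_ne_zero : ∀ n : M.Num, n + 1 ≠ 0
  succ_inj : ∀ m n : M.Num, m + 1 = n + 1 → m = n
  add_zero : ∀ m : M.Num, m + 0 = m
  add_succ : ∀ m n : M.Num, m + (n + 1) = (m + n) + 1
  mul_zero : ∀ m : M.Num, m * 0 = 0
  mul_succ : ∀ m n : M.Num, m * (n + 1) = m * n + m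
  not_lt_zero : ∀ m : M.Num, ¬ m < 0
  lt_succ : ∀ m n : M.Num, m < n + 1 ↔ m < n ∨ m = n
  /-- Induction for the `Σ⁰₁` formulas `∃ x_j, A`, in the variable `x_i`. -/
  sigma_induction : ∀ (A : ArithFormula), A.IsBounded → ∀ (V : ℕ → M.Sets) (v : ℕ → M.Num)
    (i j : ℕ),
    let φ (n : M.Num) : Prop :=
      ∃ a : M.Num, Holds V (Function.update (Function.update v i n) j a) A
    φ 0 → (∀ n, φ n → φ (n + 1)) → ∀ n, φ n
  /-- `Δ⁰₁` comprehension, for `∃ x_j, A` and `∀ x_k, B`, in the variable `x_i`. -/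
  delta_comprehension : ∀ (A B : ArithFormula), A.IsBounded → B.IsBounded →
    ∀ (V : ℕ → M.Sets) (v : ℕ → M.Num) (i j k : ℕ),
    let φ (n : M.Num) : Prop :=
      ∃ a : M.Num, Holds V (Function.update (Function.update v i n) j a) A
    let ψ (n : M.Num) : Prop :=
      ∀ a : M.Num, Holds V (Function.update (Function.update v i n) k a) B
    (∀ n, φ n ↔ ψ n) → ∃ X : M.Sets, ∀ n, M.mem n X ↔ φ n

/-- Arithmetical comprehension; `ACA₀` is `RCA₀` with this scheme. -/
def ACA : Prop :=
  ∀ (A : ArithFormula) (V : ℕ → M.Sets) (v : ℕ → M.Num) (i : ℕ),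
    ∃ X : M.Sets, ∀ n : M.Num, M.mem n X ↔ Holds V (Function.update v i n) A

variable {M}

/-- The sequence of rationals coded by a set, as a set of pairs. -/
def seq (X : M.Sets) : RatSeq M.Num := fun n a => 0 < a.den ∧ M.mem (pair n a.code) X

/-- `(a, r) Φ (b, s)`: for some `n` the tuple `(n, a, r, b, s)` belongs to `Φ`, where `a` and `b`
are rationals and `r` and `s` are positive rationals. -/
def Rel (Φ : M.Sets) (a r b s : RatRep M.Num) : Prop :=
  (0 < a.den ∧ 0 < r.den ∧ 0 < b.den ∧ 0 < s.den) ∧ (0 < r ∧ 0 < s) ∧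
    ∃ n : M.Num, M.mem (pair n (pair a.code (pair r.code (pair b.code s.code)))) Φ

/-- `Φ` is an RM-code for a continuous partial function from `ℝ` to `ℝ`. Intuitively,
`(a, r) Φ (b, s)` says that the open ball of radius `r` about `a` is mapped into the closed ball of
radius `s` about `b`. -/
structure IsContinuousCode (Φ : M.Sets) : Prop where
  consistent : ∀ a r b s b' s' : RatRep M.Num,
    Rel Φ a r b s → Rel Φ a r b' s' → b.DistLe b' (s + s')
  shrink : ∀ a r b s a' r' : RatRep M.Num, Rel Φ a r b s →
    0 < a'.den → 0 < r'.den → 0 < r' → a + r' < a' + r → a' + r' < a + r → Rel Φ a' r' b s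
  enlarge : ∀ a r b s b' s' : RatRep M.Num, Rel Φ a r b s →
    0 < b'.den → 0 < s'.den → b + s < b' + s' → b' + s < b + s' → Rel Φ a r b' s'

/-- The real `x` belongs to the domain of the function coded by `Φ`. -/
def InDomain (Φ : M.Sets) (x : RatSeq M.Num) : Prop :=
  ∀ ε : RatRep M.Num, 0 < ε.den → 0 < ε → ∃ a r b s : RatRep M.Num,
    Rel Φ a r b s ∧ x.DistLt (RatSeq.const a) r ∧ s < ε

/-- The function coded by `Φ` is defined at the real `x` and has the real `y` as its value. -/
def IsValue (Φ : M.Sets) (x y : RatSeq M.Num) : Prop :=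
  InDomain Φ x ∧ y.IsReal ∧ ∀ a r b s : RatRep M.Num, Rel Φ a r b s →
    x.DistLt (RatSeq.const a) r → y.DistLe (RatSeq.const b) s

/-- `f(x)` tends to `0` as `x` tends to `0` from the right, where `f` is coded by `Φ`. -/
def TendsToZeroAtZeroRight (Φ : M.Sets) : Prop :=
  ∀ k e : M.Num, NumOps.IsTwoPow k e → ∃ m d : M.Num, NumOps.IsTwoPow m d ∧
    ∀ x y : M.Sets, (seq x).IsReal → (RatSeq.const 0).Lt (seq x) →
      (seq x).Lt (RatSeq.const ⟨1, 0, d⟩) → IsValue Φ (seq x) (seq y) →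
        (seq y).DistLt (RatSeq.const 0) ⟨1, 0, e⟩

variable (M)

/-- The one-point-extension theorem for RM-codes, in the structure `M`. -/
def OnePointExtension : Prop :=
  ∀ Φ : M.Sets, IsContinuousCode Φ → (∀ x : M.Sets, (seq x).InIoo → InDomain Φ (seq x)) →
    TendsToZeroAtZeroRight Φ →
    ∃ Ψ : M.Sets, IsContinuousCode Ψ ∧
      (∀ x : M.Sets, (seq x).InIco → InDomain Ψ (seq x)) ∧
      (∀ x : M.Sets, (seq x).InIoo → ∃ y : M.Sets,
        IsValue Φ (seq x) (seq y) ∧ IsValue Ψ (seq x) (seq y)) ∧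
      (∀ x : M.Sets, (seq x).IsReal → (seq x).Eqv (RatSeq.const 0) →
        IsValue Ψ (seq x) (RatSeq.const 0))

end L2Structure

end ReverseMath

namespace ReverseMath

/-! The third-order half rests on excluded middle. If f(0) = 0, then f is its own extension. If f(0)
≠ 0, the jump of f at 0 decides for every real x whether x > 0: clamp x to a short interval [0,
2^(-m-1)] and read a single rational approximation of the value of f there, which is small if x > 0
and large if x ≤ 0. Hence the function equal to f for x > 0 and to 0 elsewhere is an object of the
model (`exists_extension_of_not_eqv`). The argument is not uniform in f and uses no comprehension
beyond `QF-AC^{1,0}`.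

A code, in contrast, has to carry explicit information about the behaviour near 0. Given
arithmetical comprehension, let Ψ consist of all tuples that are compatible with Φ on the positive
part of the ball and with the value 0 if the ball reaches below 0. This is an arithmetical
condition, and a small ball about 0 qualifies because f tends to 0 (`ACA.onePointExtension`).

For the reversal, let T be a set of pairs (n, w) with at most one w for each n, and let f be the
supremum over T of bumps of height 1/(n+2) with peak at 1/(m+1), where m codes (n, w). Only finitely
many bumps matter away from 0, so f has a code. By bounded Σ⁰₁ comprehension the witnesses of all n
< l have a common bound, so f tends to 0 at 0, but without a computable rate. A code that is defined
at 0 supplies a rate: a tuple whose ball contains 0 and whose s is below a quarter of the height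
1/(n+2) excludes all peaks of that height from the ball, and so bounds w by the code of the tuple
(`le_of_restricts`). Thus {n | ∃ w, (n, w) ∈ T} is Δ⁰₁. Σ⁰₁ comprehension then absorbs the
quantifiers of an arithmetical formula one by one (`SigmaComp.aca`).

Models may be nonstandard, so everything is done over the number sort N of the model. Real numbers
are compared through the ordered field of fractions `Frac N`, in which their relations become
inequalities that hold eventually along `atTop`. Objects of a type structure are built from
combinators (`Rep`, `Dec`). For second-order structures, instance search on `Tm` and `Dfn` produces
the formulas to which induction and comprehension apply. -/

/-- The laws of a discretely ordered commutative semiring. -/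
class OrderedArith (N : Type u) [NumOps N] : Prop where
  add_assoc : ∀ a b c : N, a + b + c = a + (b + c)
  add_comm : ∀ a b : N, a + b = b + a
  add_zero : ∀ a : N, a + 0 = a
  mul_assoc : ∀ a b c : N, a * b * c = a * (b * c)
  mul_comm : ∀ a b : N, a * b = b * a
  mul_one : ∀ a : N, a * 1 = a
  mul_zero : ∀ a : N, a * 0 = 0
  mul_add : ∀ a b c : N, a * (b + c) = a * b + a * c
  lt_irrefl : ∀ a : N, ¬ a < a
  lt_trans : ∀ a b c : N, a < b → b < c → a < c
  lt_trichotomy : ∀ a b : N, a < b ∨ a = b ∨ b < a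
  add_lt_add : ∀ a b c : N, a < b → a + c < b + c
  mul_lt_mul : ∀ a b c : N, a < b → 0 < c → a * c < b * c
  exists_add : ∀ a b : N, a < b → ∃ c, a + c = b
  not_lt_zero : ∀ a : N, ¬ a < 0
  zero_lt_one : (0 : N) < 1
  discrete : ∀ a : N, 0 < a → a = 1 ∨ 1 < a

/-- The laws of a discretely ordered semiring, together with the basic properties of `2 ^ n`. -/
class ArithLaws (N : Type u) [NumOps N] : Prop extends OrderedArith N where
  twoPow_zero : ∀ e : N, NumOps.IsTwoPow 0 e ↔ e = 1
  twoPow_succ : ∀ n e : N, NumOps.IsTwoPow (n + 1) e ↔ ∃ d, NumOps.IsTwoPow n d ∧ e = d + d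
  twoPow_existsUnique : ∀ n : N, ∃! e, NumOps.IsTwoPow n e
  lt_twoPow : ∀ n e : N, NumOps.IsTwoPow n e → n < e
  twoPow_strictMono : ∀ m n d e : N, m < n → NumOps.IsTwoPow m d → NumOps.IsTwoPow n e → d < e

/-! ### Semiring and order structure of the number sort -/

section Numbers

variable {N : Type u} [NumOps N] [OrderedArith N]

instance : CommSemiring N where
  add_assoc := OrderedArith.add_assoc
  add_comm := OrderedArith.add_comm
  add_zero := OrderedArith.add_zero
  zero_add a := by rw [OrderedArith.add_comm, OrderedArith.add_zero]
  mul_assoc := OrderedArith.mul_assoc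
  mul_comm := OrderedArith.mul_comm
  mul_one := OrderedArith.mul_one
  one_mul a := by rw [OrderedArith.mul_comm, OrderedArith.mul_one]
  mul_zero := OrderedArith.mul_zero
  zero_mul a := by rw [OrderedArith.mul_comm, OrderedArith.mul_zero]
  left_distrib := OrderedArith.mul_add
  right_distrib a b c := by
    rw [OrderedArith.mul_comm, OrderedArith.mul_add, OrderedArith.mul_comm c a, OrderedArith.mul_comm c b]
  nsmul := nsmulRec
  npow n a := npowRec n a

open OrderedArith in
open Classical in
noncomputable instance : LinearOrder N where
  le a b := a < b ∨ a = b
  le_refl a := Or.inr rfl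
  le_trans a b c := by
    rintro (h | rfl) (h' | rfl)
    · exact Or.inl (lt_trans _ _ _ h h')
    · exact Or.inl h
    · exact Or.inl h'
    · exact Or.inr rfl
  lt_iff_le_not_ge a b := by
    constructor
    · refine fun h => ⟨Or.inl h, ?_⟩
      rintro (h' | rfl)
      · exact lt_irrefl _ (lt_trans _ _ _ h h')
      · exact lt_irrefl _ h
    · rintro ⟨h | rfl, h'⟩
      · exact h
      · exact absurd (Or.inr rfl) h'
  le_antisymm a b := by
    rintro (h | rfl) (h' | h')
    · exact absurd (lt_trans _ _ _ h h') (lt_irrefl _)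
    · exact h'.symm
    · rfl
    · rfl
  le_total a b := by
    rcases lt_trichotomy a b with h | h | h
    · exact Or.inl (Or.inl h)
    · exact Or.inl (Or.inr h)
    · exact Or.inr (Or.inl h)
  toDecidableLE := Classical.decRel _

instance : Nontrivial N := ⟨0, 1, (OrderedArith.zero_lt_one (N := N)).ne⟩

instance : IsStrictOrderedRing N where
  add_le_add_left a b h c := by
    rcases h.lt_or_eq with h | rfl
    · exact (OrderedArith.add_lt_add a b c h).le
    · exact le_rfl
  le_of_add_le_add_left a b c h := by
    by_contra! h'
    have := OrderedArith.add_lt_add c b a h'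
    rw [add_comm c, add_comm b] at this
    exact absurd h this.not_ge
  zero_le_one := (OrderedArith.zero_lt_one (N := N)).le
  mul_lt_mul_of_pos_left a ha b c h := by
    have := OrderedArith.mul_lt_mul b c a h ha
    rwa [mul_comm a b, mul_comm a c]
  mul_lt_mul_of_pos_right a ha b c h := OrderedArith.mul_lt_mul b c a h ha

instance : CanonicallyOrderedAdd N where
  exists_add_of_le {a b} h := by
    rcases h.lt_or_eq with h | rfl
    · obtain ⟨c, hc⟩ := OrderedArith.exists_add a b h
      exact ⟨c, hc.symm⟩
    · exact ⟨0, (add_zero _).symm⟩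
  le_add_self a b := by
    have h : (0 : N) ≤ b := not_lt.1 (OrderedArith.not_lt_zero b)
    simpa using add_le_add_left h a
  le_self_add a b := by
    have h : (0 : N) ≤ b := not_lt.1 (OrderedArith.not_lt_zero b)
    simpa using add_le_add_right h a

/-- Discreteness enters here: if a exceeds b, the difference is positive and hence at least 1. -/
theorem lt_add_one_iff {a b : N} : a < b + 1 ↔ a ≤ b := by
  constructor
  · intro h
    by_contra! h'
    obtain ⟨c, rfl⟩ := exists_add_of_le h'.le
    have hc : 0 < c := by
      rw [pos_iff_ne_zero]; rintro rfl; simp at h'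
    rcases OrderedArith.discrete c hc with rfl | h1
    · exact absurd h (lt_irrefl _)
    · exact absurd (h.trans (by gcongr)) (lt_irrefl _)
  · intro h
    exact h.trans_lt (lt_add_of_pos_right _ zero_lt_one)

theorem add_one_le_iff {a b : N} : a + 1 ≤ b ↔ a < b := by
  rw [← not_lt, lt_add_one_iff, not_le]

/-! ### Pairing -/

theorem le_pair_left (i j : N) : i ≤ pair i j := le_add_self

theorem le_mul_self (i : N) : i ≤ i * i := by
  rcases eq_zero_or_pos i with rfl | h
  · simp
  · exact le_mul_of_one_le_left (zero_le) (by rw [← zero_add (1 : N), add_one_le_iff]; exact h)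

theorem le_pair_right (i j : N) : j ≤ pair i j :=
  (le_add_self : j ≤ i + j).trans ((le_mul_self _).trans le_self_add)

/-- In the reversal, the product of the denominators of a center and a radius has to be bounded by
the code of their tuple; the quadratic pairing function makes this possible. -/
theorem mul_le_pair (i j : N) : i * j ≤ pair i j := by
  unfold pair
  calc i * j ≤ i * j + (i * i + i * j + j * j + i) := le_self_add
    _ = (i + j) * (i + j) + i := by ring

/-- Pairs are ordered by their sums first: with s = i + j, the code s² + i is below (s + 1)².
Injectivity of `pair` follows. -/
theorem pair_lt_of_add_lt {i j k l : N} (h : i + j < k + l) : pair i j < pair k l := by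
  unfold pair
  have h1 := add_one_le_iff.2 h
  calc (i + j) * (i + j) + i ≤ (i + j) * (i + j) + (i + j) := by gcongr; exact le_self_add
    _ < (i + j) * (i + j) + (i + j) + (i + j + 1) :=
        lt_add_of_pos_right _ (lt_of_lt_of_le zero_lt_one le_add_self)
    _ = (i + j + 1) * (i + j + 1) := by ring
    _ ≤ (k + l) * (k + l) := by gcongr
    _ ≤ _ := le_self_add

theorem pair_inj {i j k l : N} : pair i j = pair k l ↔ i = k ∧ j = l := by
  refine ⟨fun h => ?_, by rintro ⟨rfl, rfl⟩; rfl⟩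
  rcases lt_trichotomy (i + j) (k + l) with h1 | h1 | h1
  · exact absurd h (pair_lt_of_add_lt h1).ne
  · unfold pair at h
    rw [h1] at h
    have h2 := add_left_cancel h
    subst h2
    exact ⟨rfl, add_left_cancel h1⟩
  · exact absurd h (pair_lt_of_add_lt h1).ne'

theorem RatRep.code_inj {a b : RatRep N} : a.code = b.code ↔ a = b := by
  rw [RatRep.ext_iff, RatRep.code, RatRep.code, pair_inj, pair_inj, and_assoc]

/-! ### The ordered field of fractions -/

variable (N) in
/-- The signed quotients with positive denominator. -/
abbrev ProperRep : Type u := {a : RatRep N // 0 < a.den}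


namespace ProperRep

theorem exists_sub (a b : N) (h : a < b) : ∃ c, 0 < c ∧ b = a + c := by
  obtain ⟨c, rfl⟩ := exists_add_of_le h.le
  exact ⟨c, by rw [pos_iff_ne_zero]; rintro rfl; simp at h, rfl⟩

instance setoid : Setoid (ProperRep N) where
  r a b := a.1.pos * b.1.den + b.1.neg * a.1.den = b.1.pos * a.1.den + a.1.neg * b.1.den
  iseqv :=
    { refl := fun a => by ring
      symm := fun {a b} h => by grind
      trans := fun {a b c} h h' => by
        -- Transitivity holds after multiplication by the middle denominator, which is positive and
        -- cancels.
        refine mul_left_cancel₀ b.2.ne' ?_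
        grind }

theorem equiv_iff {a b : ProperRep N} : a ≈ b ↔
    a.1.pos * b.1.den + b.1.neg * a.1.den = b.1.pos * a.1.den + a.1.neg * b.1.den := Iff.rfl

/-- The sum. -/
def add (a b : ProperRep N) : ProperRep N := ⟨a.1 + b.1, mul_pos a.2 b.2⟩

/-- The product. -/
def mul (a b : ProperRep N) : ProperRep N :=
  ⟨⟨a.1.pos * b.1.pos + a.1.neg * b.1.neg, a.1.pos * b.1.neg + a.1.neg * b.1.pos,
    a.1.den * b.1.den⟩, mul_pos a.2 b.2⟩

/-- The negative. -/
def neg (a : ProperRep N) : ProperRep N := ⟨⟨a.1.neg, a.1.pos, a.1.den⟩, a.2⟩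

theorem add_equiv {a b c d : ProperRep N} (h : a ≈ c) (h' : b ≈ d) : add a b ≈ add c d := by
  rw [equiv_iff] at *
  simp only [add]
  change (_ * _ + _ * _) * (_ * _) + (_ * _ + _ * _) * (_ * _) =
    (_ * _ + _ * _) * (_ * _) + (_ * _ + _ * _) * (_ * _)
  grind

theorem mul_equiv {a b c d : ProperRep N} (h : a ≈ c) (h' : b ≈ d) : mul a b ≈ mul c d := by
  rw [equiv_iff] at *
  simp only [mul]
  grind

theorem neg_equiv {a b : ProperRep N} (h : a ≈ b) : neg a ≈ neg b := by
  rw [equiv_iff] at *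
  simp only [neg]
  grind

/-- The sign of the numerator decides which slot of the inverse receives the old denominator; the
new denominator is the absolute value of the old numerator. -/
theorem exists_inv (a : ProperRep N) (h : a.1.pos ≠ a.1.neg) :
    ∃ b : ProperRep N, mul a b ≈ ⟨1, zero_lt_one⟩ := by
  rcases lt_or_gt_of_ne h with h | h
  · obtain ⟨c, hc, h'⟩ := exists_sub _ _ h
    refine ⟨⟨⟨0, a.1.den, c⟩, hc⟩, ?_⟩
    rw [equiv_iff]
    change (_ * 0 + _ * _) * 1 + 0 * (_ * _) = 1 * (_ * _) + (_ * _ + _ * 0) * 1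
    grind
  · obtain ⟨c, hc, h'⟩ := exists_sub _ _ h
    refine ⟨⟨⟨a.1.den, 0, c⟩, hc⟩, ?_⟩
    rw [equiv_iff]
    change (_ * _ + _ * 0) * 1 + 0 * (_ * _) = 1 * (_ * _) + (_ * 0 + _ * _) * 1
    grind

end ProperRep

variable (N) in
/-- The ordered field of fractions of `N`. -/
def Frac : Type u := Quotient (ProperRep.setoid (N := N))

namespace Frac

open ProperRep

/-- The class of a signed quotient. -/
def mk (a : ProperRep N) : Frac N := Quotient.mk _ a

theorem ind {P : Frac N → Prop} (h : ∀ a, P (mk a)) (x : Frac N) : P x := Quotient.inductionOn x h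

theorem mk_eq {a b : ProperRep N} : mk a = mk b ↔ a ≈ b := Quotient.eq

instance : Zero (Frac N) := ⟨mk ⟨0, zero_lt_one⟩⟩
instance : One (Frac N) := ⟨mk ⟨1, zero_lt_one⟩⟩
instance : Add (Frac N) := ⟨Quotient.map₂ add fun _ _ h _ _ h' => add_equiv h h'⟩
instance : Mul (Frac N) := ⟨Quotient.map₂ mul fun _ _ h _ _ h' => mul_equiv h h'⟩
instance : Neg (Frac N) := ⟨Quotient.map neg fun _ _ h => neg_equiv h⟩

theorem mk_add (a b : ProperRep N) : mk a + mk b = mk (add a b) := rfl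
theorem mk_mul (a b : ProperRep N) : mk a * mk b = mk (mul a b) := rfl
theorem mk_neg (a : ProperRep N) : -mk a = mk (neg a) := rfl
theorem zero_def : (0 : Frac N) = mk ⟨⟨0, 0, 1⟩, zero_lt_one⟩ := rfl
theorem one_def : (1 : Frac N) = mk ⟨⟨1, 0, 1⟩, zero_lt_one⟩ := rfl

theorem add_def (a b : ProperRep N) : add a b =
    ⟨⟨a.1.pos * b.1.den + b.1.pos * a.1.den, a.1.neg * b.1.den + b.1.neg * a.1.den,
      a.1.den * b.1.den⟩, mul_pos a.2 b.2⟩ := rfl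

instance : CommRing (Frac N) where
  add_assoc := by
    refine ind fun a => ind fun b => ind fun c => ?_
    simp only [mk_add, mk_eq, equiv_iff, add_def]; ring
  add_comm := by
    refine ind fun a => ind fun b => ?_
    simp only [mk_add, mk_eq, equiv_iff, add_def]; ring
  zero_add := by
    refine ind fun a => ?_
    simp only [zero_def, mk_add, mk_eq, equiv_iff, add_def]; ring
  add_zero := by
    refine ind fun a => ?_
    simp only [zero_def, mk_add, mk_eq, equiv_iff, add_def]; ring
  neg_add_cancel := by
    refine ind fun a => ?_
    simp only [zero_def, mk_add, mk_neg, mk_eq, equiv_iff, add_def, neg]; ring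
  mul_assoc := by
    refine ind fun a => ind fun b => ind fun c => ?_
    simp only [mk_mul, mk_eq, equiv_iff, mul]; ring
  mul_comm := by
    refine ind fun a => ind fun b => ?_
    simp only [mk_mul, mk_eq, equiv_iff, mul]; ring
  one_mul := by
    refine ind fun a => ?_
    simp only [one_def, mk_mul, mk_eq, equiv_iff, mul]; ring
  mul_one := by
    refine ind fun a => ?_
    simp only [one_def, mk_mul, mk_eq, equiv_iff, mul]; ring
  zero_mul := by
    refine ind fun a => ?_
    simp only [zero_def, mk_mul, mk_eq, equiv_iff, mul]; ring
  mul_zero := by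
    refine ind fun a => ?_
    simp only [zero_def, mk_mul, mk_eq, equiv_iff, mul]; ring
  left_distrib := by
    refine ind fun a => ind fun b => ind fun c => ?_
    simp only [mk_mul, mk_add, mk_eq, equiv_iff, mul, add_def]; ring
  right_distrib := by
    refine ind fun a => ind fun b => ind fun c => ?_
    simp only [mk_mul, mk_add, mk_eq, equiv_iff, mul, add_def]; ring
  nsmul := nsmulRec
  zsmul := zsmulRec

theorem exists_mul_eq_one (x : Frac N) (h : x ≠ 0) : ∃ y, x * y = 1 := by
  induction x using ind with | h a
  obtain ⟨b, hb⟩ := exists_inv a (by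
    rintro h'
    refine h ?_
    rw [zero_def, mk_eq, equiv_iff, h']
    ring)
  exact ⟨mk b, by rw [mk_mul]; exact mk_eq.2 hb⟩

/-- `mk a ≤ mk b`. -/
def le (x y : Frac N) : Prop :=
  Quotient.liftOn₂ x y (fun a b => a.1.pos * b.1.den + b.1.neg * a.1.den ≤
      b.1.pos * a.1.den + a.1.neg * b.1.den) (by
    have key : ∀ a b c d : ProperRep N, a ≈ c → b ≈ d →
        a.1.pos * b.1.den + b.1.neg * a.1.den ≤ b.1.pos * a.1.den + a.1.neg * b.1.den →
        c.1.pos * d.1.den + d.1.neg * c.1.den ≤ d.1.pos * c.1.den + c.1.neg * d.1.den := by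
      intro a b c d h h' h1
      rw [equiv_iff] at h h'
      obtain ⟨e, he⟩ := exists_add_of_le h1
      -- The slack e of the given inequality, times the denominators of c and d, is the slack of the
      -- wanted one times those of a and b.
      refine le_of_mul_le_mul_left (le_iff_exists_add.2 ⟨c.1.den * d.1.den * e, ?_⟩)
        (mul_pos a.2 b.2)
      grind
    intro a b c d h h'
    exact propext ⟨key a b c d h h', key c d a b (Setoid.symm h) (Setoid.symm h')⟩)

instance : LE (Frac N) := ⟨le⟩

theorem mk_le {a b : ProperRep N} : mk a ≤ mk b ↔
    a.1.pos * b.1.den + b.1.neg * a.1.den ≤ b.1.pos * a.1.den + a.1.neg * b.1.den := Iff.rfl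

open Classical in
noncomputable instance : LinearOrder (Frac N) where
  le_refl := ind fun a => by rw [mk_le]
  le_trans := by
    refine ind fun a => ind fun b => ind fun c => ?_
    simp only [mk_le]
    intro h h'
    obtain ⟨e, he⟩ := exists_add_of_le h
    obtain ⟨e', he'⟩ := exists_add_of_le h'
    refine le_of_mul_le_mul_left (le_iff_exists_add.2 ⟨e * c.1.den + e' * a.1.den, ?_⟩) b.2
    grind
  le_antisymm := by
    refine ind fun a => ind fun b => ?_
    simp only [mk_le, mk_eq, equiv_iff]
    exact fun h h' => le_antisymm h h'
  le_total := by
    refine ind fun a => ind fun b => ?_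
    simp only [mk_le]
    exact le_total _ _
  toDecidableLE := Classical.decRel _

instance : Nontrivial (Frac N) := ⟨0, 1, by
  rw [zero_def, one_def, Ne, mk_eq, equiv_iff]; simp⟩

instance : IsStrictOrderedRing (Frac N) := by
  have hadd : ∀ x y z : Frac N, x ≤ y → x + z ≤ y + z := by
    refine ind fun a => ind fun b => ind fun c => ?_
    simp only [mk_le, mk_add, add_def]
    intro h
    obtain ⟨e, he⟩ := exists_add_of_le h
    refine le_iff_exists_add.2 ⟨e * (c.1.den * c.1.den), ?_⟩
    grind
  have : IsOrderedAddMonoid (Frac N) := { add_le_add_left := fun a b h c => hadd a b c h }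
  have : ZeroLEOneClass (Frac N) := ⟨by
    rw [zero_def, one_def, mk_le]; simp⟩
  refine IsStrictOrderedRing.of_mul_pos ?_
  refine ind fun a => ind fun b => ?_
  simp only [← not_le]
  simp only [zero_def, mk_mul, mk_le, mul, not_le, zero_mul, mul_one, zero_add, add_zero]
  intro h h'
  obtain ⟨c, hc, h1⟩ := exists_sub _ _ h
  obtain ⟨d, hd, h2⟩ := exists_sub _ _ h'
  rw [h1, h2]
  calc _ < _ + c * d := lt_add_of_pos_right _ (mul_pos hc hd)
    _ = _ := by ring

noncomputable instance : Field (Frac N) where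
  inv x := open Classical in if h : x = 0 then 0 else (exists_mul_eq_one x h).choose
  mul_inv_cancel x h := by
    simp only [dif_neg h]; exact (exists_mul_eq_one x h).choose_spec
  inv_zero := by simp
  nnqsmul := _
  nnqsmul_def := fun _ _ => rfl
  qsmul := _
  qsmul_def := fun _ _ => rfl

end Frac
end Numbers
end ReverseMath

/-! ### Values of rationals and reals in the field of fractions -/

namespace ReverseMath

section Reals

variable {N : Type u} [NumOps N] [ArithLaws N]

namespace Frac

/-- The embedding of `N` in its field of fractions. -/
def cast : N →+* Frac N where
  toFun n := mk ⟨⟨n, 0, 1⟩, zero_lt_one⟩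
  map_one' := rfl
  map_zero' := rfl
  map_mul' a b := by
    simp only [mk_mul, mk_eq, ProperRep.equiv_iff, ProperRep.mul]; ring
  map_add' a b := by
    simp only [mk_add, mk_eq, ProperRep.equiv_iff, add_def]; ring

theorem cast_le {a b : N} : cast a ≤ cast b ↔ a ≤ b := by
  simp only [cast, RingHom.coe_mk, MonoidHom.coe_mk, OneHom.coe_mk, mk_le]; simp

theorem cast_lt {a b : N} : cast a < cast b ↔ a < b := by
  rw [← not_le, cast_le, not_le]

theorem cast_pos {a : N} : 0 < cast a ↔ 0 < a := by
  rw [← cast_lt, map_zero]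

theorem cast_nonneg (a : N) : 0 ≤ cast a := by
  rw [← map_zero cast, cast_le]; exact zero_le

theorem mk_eq_div (a : ProperRep N) :
    mk a = (cast a.1.pos - cast a.1.neg) / cast a.1.den := by
  rw [eq_div_iff (Frac.cast_pos.2 a.2).ne']
  simp only [cast, RingHom.coe_mk, MonoidHom.coe_mk, OneHom.coe_mk, sub_eq_add_neg, mk_mul, mk_neg,
    mk_add, mk_eq, ProperRep.equiv_iff, add_def, ProperRep.mul, ProperRep.neg]
  ring

end Frac

open Frac

/-- The value of a signed quotient. -/
noncomputable def RatRep.val (a : RatRep N) : Frac N := (cast a.pos - cast a.neg) / cast a.den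

namespace RatRep

theorem exists_val_eq (x : Frac N) : ∃ a : RatRep N, 0 < a.den ∧ a.val = x := by
  induction x using Frac.ind with | h a
  exact ⟨a.1, a.2, (mk_eq_div a).symm⟩

theorem val_lt {a b : RatRep N} (ha : 0 < a.den) (hb : 0 < b.den) : a.val < b.val ↔ a < b := by
  rw [val, val, div_lt_div_iff₀ (Frac.cast_pos.2 ha) (Frac.cast_pos.2 hb)]
  change _ ↔ a.pos * b.den + b.neg * a.den < b.pos * a.den + a.neg * b.den
  rw [← cast_lt]
  simp only [map_add, map_mul]
  constructor <;> intro h <;> linarith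

theorem val_le {a b : RatRep N} (ha : 0 < a.den) (hb : 0 < b.den) : a.val ≤ b.val ↔ a ≤ b := by
  rw [← not_lt, val_lt hb ha]; rfl

theorem add_den_pos {a b : RatRep N} (ha : 0 < a.den) (hb : 0 < b.den) : 0 < (a + b).den :=
  mul_pos ha hb

theorem val_add {a b : RatRep N} (ha : 0 < a.den) (hb : 0 < b.den) :
    (a + b).val = a.val + b.val := by
  have h1 := (Frac.cast_pos.2 ha).ne'
  have h2 := (Frac.cast_pos.2 hb).ne'
  change (cast (a.pos * b.den + b.pos * a.den) - cast (a.neg * b.den + b.neg * a.den)) /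
    cast (a.den * b.den) = _
  simp only [val, map_add, map_mul]
  field_simp
  ring

@[simp] theorem val_zero : (0 : RatRep N).val = 0 := by
  change (cast 0 - cast 0) / cast 1 = (0 : Frac N); simp

@[simp] theorem val_one : (1 : RatRep N).val = 1 := by
  change (cast 1 - cast 0) / cast 1 = (1 : Frac N); simp

theorem zero_den_pos : 0 < (0 : RatRep N).den := (zero_lt_one : (0 : N) < 1)

theorem one_den_pos : 0 < (1 : RatRep N).den := (zero_lt_one : (0 : N) < 1)

theorem val_pos {a : RatRep N} (ha : 0 < a.den) : 0 < a.val ↔ 0 < a := by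
  rw [← val_lt zero_den_pos ha, val_zero]

theorem val_unit (e : N) : (⟨1, 0, e⟩ : RatRep N).val = (cast e)⁻¹ := by
  simp [val]

theorem val_two (e : N) : (⟨1 + 1, 0, e⟩ : RatRep N).val = 2 * (cast e)⁻¹ := by
  change (Frac.cast (1 + 1) - Frac.cast 0) / Frac.cast e = _
  rw [map_add, map_one, map_zero, sub_zero, div_eq_mul_inv, one_add_one_eq_two]

theorem distLt_iff {a b c : RatRep N} (ha : 0 < a.den) (hb : 0 < b.den) (hc : 0 < c.den) :
    a.DistLt b c ↔ |a.val - b.val| < c.val := by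
  rw [DistLt, ← val_lt ha (add_den_pos hb hc), ← val_lt hb (add_den_pos ha hc), val_add hb hc,
    val_add ha hc, abs_lt]
  constructor <;> rintro ⟨h, h'⟩ <;> constructor <;> linarith

theorem distLe_iff {a b c : RatRep N} (ha : 0 < a.den) (hb : 0 < b.den) (hc : 0 < c.den) :
    a.DistLe b c ↔ |a.val - b.val| ≤ c.val := by
  rw [DistLe, ← val_le ha (add_den_pos hb hc), ← val_le hb (add_den_pos ha hc), val_add hb hc,
    val_add ha hc, abs_le]
  constructor <;> rintro ⟨h, h'⟩ <;> constructor <;> linarith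

end RatRep

/-! ### Powers of two -/

/-- The power `2 ^ n`. -/
noncomputable def exp2 (n : N) : N := (ArithLaws.twoPow_existsUnique n).choose

theorem isTwoPow_iff {n e : N} : NumOps.IsTwoPow n e ↔ e = exp2 n := by
  have h := (ArithLaws.twoPow_existsUnique n).choose_spec
  exact ⟨h.2 e, by rintro rfl; exact h.1⟩

theorem isTwoPow_exp2 (n : N) : NumOps.IsTwoPow n (exp2 n) := isTwoPow_iff.2 rfl

theorem lt_exp2 (n : N) : n < exp2 n := ArithLaws.lt_twoPow _ _ (isTwoPow_exp2 n)

theorem exp2_pos (n : N) : 0 < exp2 n := lt_of_le_of_lt zero_le (lt_exp2 n)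

theorem exp2_succ (n : N) : exp2 (n + 1) = exp2 n + exp2 n :=
  (isTwoPow_iff.1 ((ArithLaws.twoPow_succ _ _).2 ⟨_, isTwoPow_exp2 n, rfl⟩)).symm

theorem exp2_mono {m n : N} (h : m ≤ n) : exp2 m ≤ exp2 n := by
  rcases h.lt_or_eq with h | rfl
  · exact (ArithLaws.twoPow_strictMono _ _ _ _ h (isTwoPow_exp2 m) (isTwoPow_exp2 n)).le
  · exact le_rfl

/-- The fraction `2 ^ (-n)`. -/
noncomputable def tol (n : N) : Frac N := (cast (exp2 n))⁻¹

theorem tol_pos (n : N) : 0 < tol n := inv_pos.2 (Frac.cast_pos.2 (exp2_pos n))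

theorem tol_succ (n : N) : tol (n + 1) = tol n / 2 := by
  rw [tol, exp2_succ, map_add, tol, ← two_mul, mul_inv]; ring

theorem tol_anti {m n : N} (h : m ≤ n) : tol n ≤ tol m :=
  inv_anti₀ (Frac.cast_pos.2 (exp2_pos m)) (Frac.cast_le.2 (exp2_mono h))

/-- Denominators are at least 1, so a fraction is at most its positive numerator. `Frac N` is thus
archimedean relative to N, though perhaps not relative to the standard numbers; together with n <
2^n this makes `tol` tend to 0 along `atTop`. -/
theorem exists_cast_gt (x : Frac N) : ∃ n : N, x < cast n := by
  obtain ⟨a, ha, rfl⟩ := RatRep.exists_val_eq x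
  refine ⟨a.pos + 1, ?_⟩
  rw [RatRep.val, div_lt_iff₀ (Frac.cast_pos.2 ha), map_add, map_one]
  have h1 : (1 : Frac N) ≤ cast a.den := by
    rw [← map_one Frac.cast, Frac.cast_le, ← zero_add (1 : N), add_one_le_iff]; exact ha
  have h2 := cast_nonneg a.pos
  have h3 := cast_nonneg a.neg
  nlinarith

theorem exists_tol_lt {δ : Frac N} (h : 0 < δ) : ∃ n : N, tol n < δ := by
  obtain ⟨n, hn⟩ := exists_cast_gt δ⁻¹
  exact ⟨n, inv_lt_of_inv_lt₀ h (hn.trans (Frac.cast_lt.2 (lt_exp2 n)))⟩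

open Filter

theorem eventually_tol_lt {δ : Frac N} (h : 0 < δ) : ∀ᶠ n : N in atTop, tol n < δ := by
  obtain ⟨n, hn⟩ := exists_tol_lt h
  filter_upwards [eventually_ge_atTop n] with m hm
  exact (tol_anti hm).trans_lt hn

/-! ### Real numbers -/

namespace RatSeq

/-- The value of the `n`-th term. -/
noncomputable def val (x : RatSeq N) (n : N) : Frac N :=
  open Classical in if h : ∃ a, x n a then h.choose.val else 0

variable {x y z : RatSeq N} {c : RatRep N}

namespace IsReal

theorem val_eq (hx : x.IsReal) {n : N} {a : RatRep N} (h : x n a) : x.val n = a.val := by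
  have h' : ∃ a, x n a := ⟨a, h⟩
  rw [val, dif_pos h', (hx.1 n).unique h'.choose_spec h]

theorem exists_term (hx : x.IsReal) (n : N) : ∃ a, x n a ∧ 0 < a.den ∧ a.val = x.val n := by
  obtain ⟨a, ha, -⟩ := hx.1 n
  exact ⟨a, ha, hx.2.1 n a ha, (hx.val_eq ha).symm⟩

theorem abs_sub_lt (hx : x.IsReal) {m n : N} (h : m ≤ n) : |x.val m - x.val n| < tol m := by
  obtain ⟨k, rfl⟩ := exists_add_of_le h
  obtain ⟨a, ha, ha', ha''⟩ := hx.exists_term m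
  obtain ⟨b, hb, hb', hb''⟩ := hx.exists_term (m + k)
  have := hx.2.2 m k _ a b (isTwoPow_exp2 m) ha hb
  rwa [RatRep.distLt_iff ha' hb' (exp2_pos m), RatRep.val_unit, ha'', hb''] at this

theorem eventually_abs_sub_lt (hx : x.IsReal) (m : N) :
    ∀ᶠ n in atTop, |x.val m - x.val n| < tol m := by
  filter_upwards [eventually_ge_atTop m] with n hn using hx.abs_sub_lt hn

end IsReal

theorem isReal_iff : x.IsReal ↔ (∀ n, ∃! a, x n a) ∧ (∀ n a, x n a → 0 < a.den) ∧
    ∀ m n a b, m ≤ n → x m a → x n b → |a.val - b.val| < tol m := by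
  refine and_congr_right fun h1 => and_congr_right fun h2 => ⟨fun h m n a b hmn ha hb => ?_,
    fun h n i e a b he ha hb => ?_⟩
  · obtain ⟨k, rfl⟩ := exists_add_of_le hmn
    have := h m k _ a b (isTwoPow_exp2 m) ha hb
    rwa [RatRep.distLt_iff (h2 _ _ ha) (h2 _ _ hb) (exp2_pos m), RatRep.val_unit] at this
  · obtain rfl := isTwoPow_iff.1 he
    rw [RatRep.distLt_iff (h2 _ _ ha) (h2 _ _ hb) (exp2_pos n), RatRep.val_unit]
    exact h _ _ _ _ le_self_add ha hb

theorem isReal_const (hc : 0 < c.den) : (const c).IsReal := by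
  refine isReal_iff.2 ⟨fun n => ⟨c, rfl, fun _ h => h⟩, ?_, ?_⟩
  · rintro n a rfl; exact hc
  · rintro m n a b - rfl rfl; simpa using tol_pos m

@[simp] theorem val_const (n : N) : (const c).val n = c.val := by
  have h : ∃ a, const c n a := ⟨c, rfl⟩
  rw [val, dif_pos h]
  exact congrArg _ h.choose_spec

theorem lt_iff_exists (hx : x.IsReal) (hy : y.IsReal) :
    x.Lt y ↔ ∃ n, x.val n + 2 * tol n < y.val n := by
  constructor
  · rintro ⟨n, e, a, b, he, ha, hb, h⟩
    obtain rfl := isTwoPow_iff.1 he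
    have h2 : 0 < (⟨1 + 1, 0, exp2 n⟩ : RatRep N).den := exp2_pos n
    rw [← RatRep.val_lt (RatRep.add_den_pos (hx.2.1 _ _ ha) h2) (hy.2.1 _ _ hb),
      RatRep.val_add (hx.2.1 _ _ ha) h2, RatRep.val_two, ← hx.val_eq ha, ← hy.val_eq hb] at h
    exact ⟨n, h⟩
  · rintro ⟨n, h⟩
    obtain ⟨a, ha, ha', ha''⟩ := hx.exists_term n
    obtain ⟨b, hb, hb', hb''⟩ := hy.exists_term n
    have h2 : 0 < (⟨1 + 1, 0, exp2 n⟩ : RatRep N).den := exp2_pos n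
    refine ⟨n, _, a, b, isTwoPow_exp2 n, ha, hb, ?_⟩
    rw [← RatRep.val_lt (RatRep.add_den_pos ha' h2) hb', RatRep.val_add ha' h2, RatRep.val_two,
      ha'', hb'']
    exact h

/-- A gap beyond 2 · 2^(-n) at one index n survives with a fixed margin at all later indices;
conversely, a fixed margin exceeds 2 · 2^(-n) for large n. The eventual form no longer mentions
rates of convergence, so later estimates reduce to linear arithmetic at a common large index. The
other relations between reals are treated in the same way. -/
theorem lt_iff (hx : x.IsReal) (hy : y.IsReal) :
    x.Lt y ↔ ∃ δ > 0, ∀ᶠ n in atTop, x.val n + δ ≤ y.val n := by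
  rw [lt_iff_exists hx hy]
  constructor
  · rintro ⟨n, h⟩
    refine ⟨y.val n - (x.val n + 2 * tol n), by linarith, ?_⟩
    filter_upwards [hx.eventually_abs_sub_lt n, hy.eventually_abs_sub_lt n] with m h1 h2
    rw [abs_lt] at h1 h2
    linarith
  · rintro ⟨δ, hδ, h⟩
    obtain ⟨n, h1, h2⟩ := (h.and (eventually_tol_lt (half_pos hδ))).exists
    exact ⟨n, by linarith⟩

theorem le_iff (hx : x.IsReal) (hy : y.IsReal) :
    x.Le y ↔ ∀ δ > 0, ∀ᶠ n in atTop, x.val n ≤ y.val n + δ := by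
  rw [Le, lt_iff_exists hy hx]
  constructor
  · intro h δ hδ
    filter_upwards [eventually_tol_lt (half_pos hδ)] with n hn
    by_contra! h'
    exact h ⟨n, by linarith⟩
  · rintro h ⟨n, hn⟩
    obtain ⟨m, h1, h2, h3⟩ := ((h _ (sub_pos.2 hn)).and
      ((hx.eventually_abs_sub_lt n).and (hy.eventually_abs_sub_lt n))).exists
    rw [abs_lt] at h2 h3
    linarith

theorem distLt_iff_exists (hx : x.IsReal) (hy : y.IsReal) (hc : 0 < c.den) :
    x.DistLt y c ↔ ∃ n, |x.val n - y.val n| + 2 * tol n < c.val := by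
  constructor
  · rintro ⟨n, e, a, b, he, ha, hb, h, h'⟩
    obtain rfl := isTwoPow_iff.1 he
    have h2 : 0 < (⟨1 + 1, 0, exp2 n⟩ : RatRep N).den := exp2_pos n
    have ha' := hx.2.1 _ _ ha
    have hb' := hy.2.1 _ _ hb
    rw [← RatRep.val_lt (RatRep.add_den_pos ha' h2) (RatRep.add_den_pos hb' hc),
      RatRep.val_add ha' h2, RatRep.val_add hb' hc, RatRep.val_two, ← hx.val_eq ha,
      ← hy.val_eq hb] at h
    rw [← RatRep.val_lt (RatRep.add_den_pos hb' h2) (RatRep.add_den_pos ha' hc),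
      RatRep.val_add hb' h2, RatRep.val_add ha' hc, RatRep.val_two, ← hx.val_eq ha,
      ← hy.val_eq hb] at h'
    refine ⟨n, ?_⟩
    rw [← lt_sub_iff_add_lt, abs_lt]
    constructor <;> unfold tol <;> linarith
  · rintro ⟨n, h⟩
    obtain ⟨a, ha, ha', ha''⟩ := hx.exists_term n
    obtain ⟨b, hb, hb', hb''⟩ := hy.exists_term n
    have h2 : 0 < (⟨1 + 1, 0, exp2 n⟩ : RatRep N).den := exp2_pos n
    rw [← lt_sub_iff_add_lt, abs_lt] at h
    unfold tol at h
    refine ⟨n, _, a, b, isTwoPow_exp2 n, ha, hb, ?_, ?_⟩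
    · rw [← RatRep.val_lt (RatRep.add_den_pos ha' h2) (RatRep.add_den_pos hb' hc),
        RatRep.val_add ha' h2, RatRep.val_add hb' hc, RatRep.val_two, ha'', hb'']
      linarith
    · rw [← RatRep.val_lt (RatRep.add_den_pos hb' h2) (RatRep.add_den_pos ha' hc),
        RatRep.val_add hb' h2, RatRep.val_add ha' hc, RatRep.val_two, ha'', hb'']
      linarith

theorem distLt_iff (hx : x.IsReal) (hy : y.IsReal) (hc : 0 < c.den) :
    x.DistLt y c ↔ ∃ δ > 0, ∀ᶠ n in atTop, |x.val n - y.val n| + δ ≤ c.val := by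
  rw [distLt_iff_exists hx hy hc]
  constructor
  · rintro ⟨n, h⟩
    refine ⟨c.val - (|x.val n - y.val n| + 2 * tol n), by linarith, ?_⟩
    filter_upwards [hx.eventually_abs_sub_lt n, hy.eventually_abs_sub_lt n] with m h1 h2
    have : |x.val m - y.val m| ≤ |x.val n - y.val n| + 2 * tol n := by
      rw [abs_lt] at h1 h2
      rw [abs_le]
      constructor <;> linarith [neg_abs_le (x.val n - y.val n), le_abs_self (x.val n - y.val n)]
    linarith
  · rintro ⟨δ, hδ, h⟩
    obtain ⟨n, h1, h2⟩ := (h.and (eventually_tol_lt (half_pos hδ))).exists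
    exact ⟨n, by linarith⟩

theorem distLe_iff (hx : x.IsReal) (hy : y.IsReal) (hc : 0 < c.den) :
    x.DistLe y c ↔ ∀ δ > 0, ∀ᶠ n in atTop, |x.val n - y.val n| ≤ c.val + δ := by
  have key : x.DistLe y c ↔ ∀ n, |x.val n - y.val n| ≤ c.val + 2 * tol n := by
    constructor
    · intro h n
      obtain ⟨a, ha, ha', ha''⟩ := hx.exists_term n
      obtain ⟨b, hb, hb', hb''⟩ := hy.exists_term n
      have h2 : 0 < (⟨1 + 1, 0, exp2 n⟩ : RatRep N).den := exp2_pos n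
      have := h n _ a b (isTwoPow_exp2 n) ha hb
      rwa [RatRep.distLe_iff ha' hb' (RatRep.add_den_pos hc h2), RatRep.val_add hc h2,
        RatRep.val_two, ha'', hb''] at this
    · rintro h n e a b he ha hb
      obtain rfl := isTwoPow_iff.1 he
      have h2 : 0 < (⟨1 + 1, 0, exp2 n⟩ : RatRep N).den := exp2_pos n
      rw [RatRep.distLe_iff (hx.2.1 _ _ ha) (hy.2.1 _ _ hb) (RatRep.add_den_pos hc h2),
        RatRep.val_add hc h2, RatRep.val_two, ← hx.val_eq ha, ← hy.val_eq hb]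
      exact h n
  rw [key]
  constructor
  · intro h δ hδ
    filter_upwards [eventually_tol_lt (half_pos hδ)] with n hn
    linarith [h n]
  · intro h n
    -- Up to δ, the bound at index n follows from that at a far index m: each of the two sequences
    -- moves by less than `tol n` in between.
    refine le_of_forall_pos_le_add fun δ hδ => ?_
    obtain ⟨m, h1, h2, h3⟩ := ((h δ hδ).and
      ((hx.eventually_abs_sub_lt n).and (hy.eventually_abs_sub_lt n))).exists
    rw [abs_lt] at h2 h3
    rw [abs_le] at h1 ⊢
    constructor <;> linarith

theorem eqv_iff (hx : x.IsReal) (hy : y.IsReal) :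
    x.Eqv y ↔ ∀ δ > 0, ∀ᶠ n in atTop, |x.val n - y.val n| ≤ δ := by
  have h : x.Eqv y ↔ x.DistLe y 0 := by
    unfold Eqv DistLe
    refine forall_congr' fun n => forall_congr' fun e => forall_congr' fun a =>
      forall_congr' fun b => imp_congr_right fun he => imp_congr_right fun ha =>
      imp_congr_right fun hb => ?_
    obtain rfl := isTwoPow_iff.1 he
    have h2 : 0 < (⟨1 + 1, 0, exp2 n⟩ : RatRep N).den := exp2_pos n
    rw [RatRep.distLe_iff (hx.2.1 _ _ ha) (hy.2.1 _ _ hb) h2,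
      RatRep.distLe_iff (hx.2.1 _ _ ha) (hy.2.1 _ _ hb) (RatRep.add_den_pos RatRep.zero_den_pos h2),
      RatRep.val_add RatRep.zero_den_pos h2, RatRep.val_zero, zero_add]
  rw [h, distLe_iff hx hy RatRep.zero_den_pos]
  simp

theorem Eqv.symm (hx : x.IsReal) (hy : y.IsReal) (h : x.Eqv y) : y.Eqv x := by
  rw [eqv_iff hx hy] at h
  rw [eqv_iff hy hx]
  simpa only [abs_sub_comm] using h

theorem Eqv.trans (hx : x.IsReal) (hy : y.IsReal) (hz : z.IsReal) (h : x.Eqv y) (h' : y.Eqv z) :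
    x.Eqv z := by
  rw [eqv_iff hx hy] at h
  rw [eqv_iff hy hz] at h'
  rw [eqv_iff hx hz]
  intro δ hδ
  filter_upwards [h _ (half_pos hδ), h' _ (half_pos hδ)] with n h1 h2
  linarith [abs_sub_le (x.val n) (y.val n) (z.val n)]

theorem eqv_refl (hx : x.IsReal) : x.Eqv x := by
  rw [eqv_iff hx hx]
  intro δ hδ
  simp [hδ.le]

theorem DistLt.congr {x' y' : RatSeq N} (hx : x.IsReal) (hy : y.IsReal) (hx' : x'.IsReal)
    (hy' : y'.IsReal) (hc : 0 < c.den) (h : x.DistLt y c) (h1 : x.Eqv x') (h2 : y.Eqv y') :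
    x'.DistLt y' c := by
  rw [distLt_iff hx hy hc] at h
  rw [distLt_iff hx' hy' hc]
  rw [eqv_iff hx hx'] at h1
  rw [eqv_iff hy hy'] at h2
  obtain ⟨δ, hδ, h⟩ := h
  refine ⟨δ / 2, half_pos hδ, ?_⟩
  filter_upwards [h, h1 (δ / 4) (by linarith), h2 (δ / 4) (by linarith)] with n h3 h4 h5
  have h6 := abs_sub_le (x'.val n) (x.val n) (y'.val n)
  have h7 := abs_sub_le (x.val n) (y.val n) (y'.val n)
  rw [abs_sub_comm] at h4
  linarith

theorem Lt.congr_right (hx : x.IsReal) (hy : y.IsReal) (hz : z.IsReal) (h : x.Lt y)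
    (h' : y.Eqv z) : x.Lt z := by
  rw [lt_iff hx hy] at h
  rw [lt_iff hx hz]
  rw [eqv_iff hy hz] at h'
  obtain ⟨δ, hδ, h⟩ := h
  refine ⟨δ / 2, half_pos hδ, ?_⟩
  filter_upwards [h, h' (δ / 2) (by linarith)] with n h3 h4
  linarith [(abs_le.1 h4).2]

/-- Since ≤ is the negation of the reversed <, failure of both strict inequalities gives bounds from
both sides. The resulting classical split between x = 0 and x > 0 is used in both halves of the
theorem. -/
theorem le_iff_lt_or_eqv (hx : x.IsReal) (hy : y.IsReal) : x.Le y ↔ x.Lt y ∨ x.Eqv y := by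
  constructor
  · intro h
    by_cases h1 : x.Lt y
    · exact Or.inl h1
    · refine Or.inr ?_
      have h2 := (le_iff hx hy).1 h
      have h3 := (le_iff hy hx).1 h1
      rw [eqv_iff hx hy]
      intro δ hδ
      filter_upwards [h2 δ hδ, h3 δ hδ] with n h4 h5
      rw [abs_le]
      constructor <;> linarith
  · rintro (h | h)
    · rw [lt_iff hx hy] at h
      obtain ⟨δ, hδ, h⟩ := h
      refine (le_iff hx hy).2 fun ε hε => ?_
      filter_upwards [h] with n hn
      linarith
    · refine (le_iff hx hy).2 fun ε hε => ?_
      filter_upwards [(eqv_iff hx hy).1 h ε hε] with n hn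
      linarith [(abs_le.1 hn).2]

end RatSeq

end Reals

end ReverseMath

/-! ### Combinators in models of the higher-order base theory -/

namespace ReverseMath

namespace OmegaStructure

variable {M : OmegaStructure.{u}}

namespace ExtEq

theorem symm : ∀ {σ : FinType} {x y : M.carrier σ}, M.ExtEq x y → M.ExtEq y x
  | .nat, _, _, h => Eq.symm h
  | .arr _ _, _, _, h => fun z => symm (h z)

theorem trans : ∀ {σ : FinType} {x y z : M.carrier σ}, M.ExtEq x y → M.ExtEq y z → M.ExtEq x z
  | .nat, _, _, _, h, h' => Eq.trans h h'
  | .arr _ _, _, _, _, h, h' => fun w => trans (h w) (h' w)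

end ExtEq

instance [hM : Fact M.ModelsRCAω] : OrderedArith M.Num where
  __ := hM.out.basic

variable [hM : Fact M.ModelsRCAω]

/-- The combinator equations hold only up to `ExtEq`, so every rewriting below an application passes
through the axiom of extensionality. -/
theorem app_congr_right {ρ τ : FinType} (φ : M.carrier (.arr ρ τ)) {x y : M.carrier ρ}
    (h : M.ExtEq x y) : M.ExtEq (M.app φ x) (M.app φ y) := hM.out.ext ρ τ x y φ h

theorem app_congr {ρ τ : FinType} {φ ψ : M.carrier (.arr ρ τ)} {x y : M.carrier ρ}
    (h' : M.ExtEq φ ψ) (h : M.ExtEq x y) : M.ExtEq (M.app φ x) (M.app ψ y) :=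
  (app_congr_right φ h).trans (h' y)

/-- The object `K x`. -/
def kApp {ρ : FinType} (τ : FinType) (x : M.carrier ρ) : M.carrier (.arr τ ρ) :=
  M.app (M.const (.K ρ τ)) x

theorem app_kApp {ρ τ : FinType} (x : M.carrier ρ) (y : M.carrier τ) :
    M.ExtEq (M.app (kApp τ x) y) x := hM.out.K_eq ρ τ x y

/-- The object `S x y`. -/
def sApp {ρ σ τ : FinType} (x : M.carrier (.arr ρ (.arr σ τ))) (y : M.carrier (.arr ρ σ)) :
    M.carrier (.arr ρ τ) := M.app (M.app (M.const (.S ρ σ τ)) x) y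

theorem app_sApp {ρ σ τ : FinType} (x : M.carrier (.arr ρ (.arr σ τ))) (y : M.carrier (.arr ρ σ))
    (z : M.carrier ρ) : M.ExtEq (M.app (sApp x y) z) (M.app (M.app x z) (M.app y z)) :=
  hM.out.S_eq ρ σ τ x y z

/-- The object `S K K`. -/
def idObj (σ : FinType) : M.carrier (.arr σ σ) :=
  sApp (M.const (.K σ (.arr σ σ))) (M.const (.K σ σ))

theorem app_idObj {σ : FinType} (z : M.carrier σ) : M.ExtEq (M.app (idObj σ) z) z :=
  (app_sApp _ _ _).trans (app_kApp (ρ := σ) (τ := .arr σ σ) z _)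

/-- The function with first value `n`, and then the values of `x`. -/
def cons (n : M.Num) (x : M.Fn) : M.Fn :=
  M.app (M.app (M.const (.R .nat))
    -- The recursion step k ↦ K (x k) ignores the previous value, so the recursor only distinguishes
    -- zero from successors.
    (sApp (kApp .nat (M.const (.K .nat .nat))) x)) n

theorem app_cons_zero (n : M.Num) (x : M.Fn) : M.app (cons n x) (0 : M.Num) = n :=
  hM.out.R_zero _ _

theorem app_cons_succ (n : M.Num) (x : M.Fn) (k : M.Num) :
    M.app (cons n x) (k + 1 : M.Num) = M.app x k := by
  refine (hM.out.R_succ _ _ _).trans ?_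
  have h := (app_sApp (kApp .nat (M.const (.K .nat .nat))) x k) (M.app (cons n x) k)
  refine Eq.trans h ?_
  have h2 := (app_kApp (τ := .nat) (M.const (.K .nat .nat)) k) (M.app x k) (M.app (cons n x) k)
  exact Eq.trans h2 (app_kApp (M.app x k) (M.app (cons n x) k))

/-- The function without its first value. -/
def tail (w : M.Fn) : M.Fn := sApp (kApp .nat w) (M.app (M.const .add) (1 : M.Num))

theorem app_tail (w : M.Fn) (k : M.Num) : M.app (tail w) k = M.app w (k + 1 : M.Num) := by
  have h1 : M.app (tail w) k = M.app w (M.app (M.app (M.const .add) (1 : M.Num)) k) :=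
    (app_sApp _ _ _).trans (app_kApp w k _)
  rw [h1, add_comm]
  rfl

/-- A number and a function travel together as the single object `cons n x` of type 1; this lets
functionals of one argument represent predicates of two. -/
theorem tail_cons (n : M.Num) (x : M.Fn) : M.ExtEq (tail (cons n x)) x := fun k => by
  change _ = _
  rw [app_tail, app_cons_succ]

/-! ### Representable functionals -/

/-- The function `F` is given by an object of the structure. -/
def Rep {τ : FinType} (F : M.Fn → M.carrier τ) : Prop :=
  ∃ Φ : M.carrier (.arr .fn τ), ∀ z, M.ExtEq (M.app Φ z) (F z)

/-- The numerical function `F` is given by an object of the structure. -/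
abbrev RepNum (F : M.Fn → M.Num) : Prop := Rep (τ := .nat) F

namespace Rep

theorem id : Rep (M := M) (τ := .fn) fun z => z := ⟨idObj _, fun _ => app_idObj _⟩

theorem const {τ : FinType} (c : M.carrier τ) : Rep (M := M) fun _ => c :=
  ⟨kApp _ c, fun z => app_kApp c z⟩

theorem app {σ τ : FinType} {F : M.Fn → M.carrier (.arr σ τ)} {G : M.Fn → M.carrier σ}
    (hF : Rep F) (hG : Rep G) : Rep fun z => M.app (F z) (G z) := by
  obtain ⟨Φ, hΦ⟩ := hF
  obtain ⟨Γ, hΓ⟩ := hG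
  exact ⟨sApp Φ Γ, fun z => (app_sApp _ _ _).trans (app_congr (hΦ z) (hΓ z))⟩

theorem sApp {ρ σ τ : FinType} {F : M.Fn → M.carrier (.arr ρ (.arr σ τ))}
    {G : M.Fn → M.carrier (.arr ρ σ)} (hF : Rep F) (hG : Rep G) :
    Rep fun z => sApp (F z) (G z) := ((const _).app hF).app hG

theorem kApp {ρ : FinType} (τ : FinType) {F : M.Fn → M.carrier ρ} (hF : Rep F) :
    Rep fun z => kApp τ (F z) := (const _).app hF

theorem cons {F : M.Fn → M.Num} {G : M.Fn → M.Fn} (hF : RepNum F) (hG : Rep G) :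
    Rep fun z => cons (F z) (G z) := ((const _).app ((const _).sApp hG)).app hF

theorem tail {G : M.Fn → M.Fn} (hG : Rep G) : Rep fun z => tail (G z) :=
  (hG.kApp _).sApp (const _)

theorem add {F G : M.Fn → M.Num} (hF : RepNum F) (hG : RepNum G) :
    RepNum fun z => F z + G z := ((const (M.const .add)).app hF).app hG

theorem mul {F G : M.Fn → M.Num} (hF : RepNum F) (hG : RepNum G) :
    RepNum fun z => F z * G z := ((const (M.const .mul)).app hF).app hG

theorem head : RepNum (M := M) fun z => M.app z (0 : M.Num) := id.app (const _)

theorem app_ext {F : M.Fn → M.Num} (hF : RepNum F) {x y : M.Fn} (h : M.ExtEq x y) :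
    F x = F y := by
  obtain ⟨Φ, hΦ⟩ := hF
  exact ((hΦ x).symm.trans (app_congr_right Φ h)).trans (hΦ y)

/-- Composition. -/
theorem comp {F : M.Fn → M.Num} {G : M.Fn → M.Fn} (hF : RepNum F) (hG : Rep G) :
    RepNum fun z => F (G z) := by
  obtain ⟨Φ, hΦ⟩ := hF
  obtain ⟨Ψ, hΨ⟩ := (const Φ).app hG
  exact ⟨Ψ, fun z => (hΨ z).trans (hΦ _)⟩

/-- Abstraction over a number. -/
theorem lam {H : M.Fn → M.Num} (hH : RepNum H) :
    ∃ Φ : M.carrier (.arr .fn .fn), ∀ x (n : M.Num),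
      M.app (M.app Φ x) n = H (OmegaStructure.cons n x) := by
  obtain ⟨Y, hY⟩ := hH
  -- In `cons n x` the number n is the argument of a partially applied recursor, so the composite S
  -- (K Y) of Y with that recursor sends n to Y (cons n x).
  have h : Rep (τ := .fn) fun x : M.Fn => OmegaStructure.sApp (OmegaStructure.kApp .nat Y)
      (M.app (M.const (.R .nat)) (OmegaStructure.sApp (OmegaStructure.kApp .nat (M.const (.K .nat .nat))) x)) :=
    (const _).sApp ((const _).app ((const _).sApp id))
  obtain ⟨Φ, hΦ⟩ := h
  refine ⟨Φ, fun x n => (hΦ x n).trans ?_⟩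
  exact ((app_sApp _ _ _).trans (app_kApp Y n _)).trans (hY _)

theorem lam_num {H : M.Fn → M.Num} (hH : RepNum H) :
    ∃ φ : M.Fn, ∀ n : M.Num, M.app φ n = H (OmegaStructure.cons n (OmegaStructure.kApp _ (0 : M.Num))) := by
  obtain ⟨Φ, hΦ⟩ := hH.lam
  exact ⟨_, hΦ _⟩

end Rep

/-- `F` is a representable function of numbers. -/
def RepFn (F : M.Num → M.Num) : Prop := ∃ φ : M.Fn, ∀ n : M.Num, M.app φ n = F n

theorem RepFn.comp {F : M.Num → M.Num} (hF : RepFn F) {G : M.Fn → M.Num} (hG : RepNum G) :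
    RepNum fun z => F (G z) := by
  obtain ⟨φ, hφ⟩ := hF
  obtain ⟨Ψ, hΨ⟩ := (Rep.const φ).app hG
  exact ⟨Ψ, fun z => (hΨ z).trans (hφ _)⟩

theorem repFn_of_rep {F : M.Num → M.Num} (h : RepNum fun w => F (M.app w (0 : M.Num))) :
    RepFn F := by
  obtain ⟨φ, hφ⟩ := h.lam_num
  exact ⟨φ, fun n => by rw [hφ, app_cons_zero]⟩

/-- Definition by cases. -/
theorem Rep.cases {C F G : M.Fn → M.Num} (hC : RepNum C) (hF : RepNum F) (hG : RepNum G) :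
    ∃ H : M.Fn → M.Num, RepNum H ∧ (∀ z, C z = 0 → H z = F z) ∧ ∀ z, C z ≠ 0 → H z = G z := by
  -- Recursion along C z with base value F z and constant step G z: only the distinction between
  -- zero and successor matters.
  refine ⟨_, ((((Rep.const (M.const (.R .nat))).app ((hG.kApp .nat).kApp .nat)).app hF).app hC),
    fun z hz => ?_, fun z hz => ?_⟩
  · change M.app _ (C z) = _
    rw [hz]
    exact hM.out.R_zero _ _
  · have h1 : (1 : M.Num) ≤ C z := by
      rw [← zero_add (1 : M.Num), add_one_le_iff, pos_iff_ne_zero]; exact hz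
    obtain ⟨k, hk⟩ := exists_add_of_le h1
    rw [add_comm] at hk
    change M.app _ (C z) = _
    rw [hk]
    refine (hM.out.R_succ _ _ _).trans ?_
    exact (app_kApp (OmegaStructure.kApp .nat (G z)) k _).trans (app_kApp (G z) _)

/-- The predicate `P` is decided by an object of the structure. -/
def Dec (P : M.Fn → Prop) : Prop := ∃ C : M.Fn → M.Num, RepNum C ∧ ∀ z, P z ↔ C z = 0

theorem Rep.ite {P : M.Fn → Prop} [∀ z, Decidable (P z)] {F G : M.Fn → M.Num} (hP : Dec P)
    (hF : RepNum F) (hG : RepNum G) : RepNum fun z => if P z then F z else G z := by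
  obtain ⟨C, hC, h⟩ := hP
  obtain ⟨H, hH, h1, h2⟩ := Rep.cases hC hF hG
  convert hH using 1
  ext z
  split_ifs with h3
  · exact (h1 z ((h z).1 h3)).symm
  · exact (h2 z fun h4 => h3 ((h z).2 h4)).symm

namespace Dec

theorem congr {P Q : M.Fn → Prop} (hP : Dec P) (h : ∀ z, Q z ↔ P z) : Dec Q := by
  obtain ⟨C, hC, h'⟩ := hP
  exact ⟨C, hC, fun z => (h z).trans (h' z)⟩

theorem not {P : M.Fn → Prop} (hP : Dec P) : Dec fun z => ¬ P z := by
  classical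
  refine ⟨_, Rep.ite hP (Rep.const (1 : M.Num)) (Rep.const (0 : M.Num)), fun z => ?_⟩
  by_cases h : P z <;> simp [h]

theorem and {P Q : M.Fn → Prop} (hP : Dec P) (hQ : Dec Q) : Dec fun z => P z ∧ Q z := by
  classical
  obtain ⟨C, hC, h'⟩ := hQ
  refine ⟨_, Rep.ite hP hC (Rep.const (1 : M.Num)), fun z => ?_⟩
  by_cases h : P z <;> simp [h, h']

theorem or {P Q : M.Fn → Prop} (hP : Dec P) (hQ : Dec Q) : Dec fun z => P z ∨ Q z :=
  (hP.not.and hQ.not).not.congr fun z => by tauto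

theorem imp {P Q : M.Fn → Prop} (hP : Dec P) (hQ : Dec Q) : Dec fun z => P z → Q z :=
  (hP.not.or hQ).congr fun z => by tauto

end Dec

variable (M) in
/-- The object of type `σ` that is constantly zero. -/
def zeroObj : (σ : FinType) → M.carrier σ
  | .nat => (0 : M.Num)
  | .arr σ τ => kApp σ (zeroObj τ)

variable (M) in
/-- The valuation with value zero everywhere. -/
def zeroVal : M.Valuation := fun p => zeroObj M p.1

/-- The relation < is an atomic formula but not a term. `QF-AC^{1,0}`, applied to the
quantifier-free definition of its characteristic function, turns it into an object of type 2. -/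
theorem exists_ltObj : ∃ Y : M.carrier (.arr .fn .nat), ∀ x : M.Fn,
    M.app Y x = 0 ↔ M.app x (0 : M.Num) < M.app x (1 : M.Num) := by
  let t0 : Term .nat := .app (.var .fn 0) (.const .zero)
  let t1 : Term .nat := .app (.var .fn 0) (.const .one)
  let A : QFFormula := .not (.and (.not (.and (.lt t0 t1) (.eq (.var .nat 0) (.const .zero))))
    (.not (.and (.not (.lt t0 t1)) (.eq (.var .nat 0) (.const .one)))))
  let v : M.Valuation := zeroVal M
  have hA : ∀ (x : M.Fn) (y : M.Num), Holds ((v.set .fn 0 x).set .nat 0 y) A ↔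
      (M.app x (0 : M.Num) < M.app x (1 : M.Num) ∧ y = 0) ∨
      (¬ M.app x (0 : M.Num) < M.app x (1 : M.Num) ∧ y = 1) := by
    intro x y
    have e1 : ((v.set .fn 0 x).set .nat 0 y) (.fn, 0) = x := by
      simp [Valuation.set]
    have e2 : ((v.set .fn 0 x).set .nat 0 y) (.nat, 0) = y := by
      simp [Valuation.set]
    simp only [Holds, A, t0, t1, eval, e1, e2]
    change (¬ (¬ (M.app x (0 : M.Num) < M.app x (1 : M.Num) ∧ y = 0) ∧ ¬ (¬ M.app x (0 : M.Num) < M.app x (1 : M.Num) ∧ y = 1))) ↔ _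
    tauto
  obtain ⟨Y, hY⟩ := hM.out.qf_ac A v 0 0 fun x => by
    by_cases h : M.app x (0 : M.Num) < M.app x (1 : M.Num)
    · exact ⟨0, (hA x 0).2 (Or.inl ⟨h, rfl⟩)⟩
    · exact ⟨1, (hA x 1).2 (Or.inr ⟨h, rfl⟩)⟩
  refine ⟨Y, fun x => ?_⟩
  rcases (hA x _).1 (hY x) with ⟨h1, h2⟩ | ⟨h1, h2⟩
  · simp [h1, h2]
  · simp [h1, h2]


theorem Dec.lt {F G : M.Fn → M.Num} (hF : RepNum F) (hG : RepNum G) : Dec fun z => F z < G z := by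
  obtain ⟨Y, hY⟩ := exists_ltObj (M := M)
  refine ⟨_, (Rep.const Y).app (hF.cons (hG.cons (Rep.const (zeroObj M .fn)))), fun z => ?_⟩
  refine Iff.symm ((hY _).trans ?_)
  rw [app_cons_zero, ← zero_add (1 : M.Num), app_cons_succ, app_cons_zero]

theorem Dec.le {F G : M.Fn → M.Num} (hF : RepNum F) (hG : RepNum G) : Dec fun z => F z ≤ G z :=
  (Dec.lt hG hF).not.congr fun _ => not_lt.symm

theorem Dec.eq {F G : M.Fn → M.Num} (hF : RepNum F) (hG : RepNum G) : Dec fun z => F z = G z :=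
  ((Dec.le hF hG).and (Dec.le hG hF)).congr fun _ => le_antisymm_iff

/-- The axiom of choice for decidable predicates. -/
theorem exists_choice {P : M.Fn → M.Num → Prop}
    (hP : Dec fun w => P (tail w) (M.app w (0 : M.Num)))
    (hext : ∀ x y n, M.ExtEq x y → (P x n ↔ P y n)) (h : ∀ x, ∃ n, P x n) :
    ∃ F : M.Fn → M.Num, RepNum F ∧ ∀ x, P x (F x) := by
  obtain ⟨C, hC, hP⟩ := hP
  obtain ⟨Φ, hΦ⟩ := hC.lam
  have hP' : ∀ x n, P x n ↔ M.app (M.app Φ x) n = 0 := fun x n => by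
    have h := hP (cons n x)
    beta_reduce at h
    rw [hΦ, ← h, app_cons_zero, hext _ _ _ (tail_cons n x)]
  let A : QFFormula := .eq (.app (.app (.var (.arr .fn .fn) 0) (.var .fn 0)) (.var .nat 0))
    (.const .zero)
  let v : M.Valuation := (zeroVal M).set (.arr .fn .fn) 0 Φ
  have hA : ∀ (x : M.Fn) (y : M.Num), Holds ((v.set .fn 0 x).set .nat 0 y) A ↔ P x y := by
    intro x y
    have e1 : ((v.set .fn 0 x).set .nat 0 y) (.fn, 0) = x := by simp [Valuation.set]
    have e2 : ((v.set .fn 0 x).set .nat 0 y) (.nat, 0) = y := by simp [Valuation.set]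
    have e3 : ((v.set .fn 0 x).set .nat 0 y) (.arr .fn .fn, 0) = Φ := by simp [Valuation.set, v]
    simp only [Holds, A, eval, e1, e2, e3, hP']
    rfl
  obtain ⟨Y, hY⟩ := hM.out.qf_ac A v 0 0 fun x => by
    obtain ⟨n, hn⟩ := h x
    exact ⟨n, (hA x n).2 hn⟩
  exact ⟨_, ⟨Y, fun _ => rfl⟩, fun x => (hA x _).1 (hY x)⟩

/-- Induction for decidable predicates. -/
theorem dec_induction {P : M.Num → Prop} (hP : Dec fun w => P (M.app w (0 : M.Num))) (h0 : P 0)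
    (hs : ∀ n, P n → P (n + 1)) (n : M.Num) : P n := by
  obtain ⟨C, hC, hP⟩ := hP
  obtain ⟨φ, hφ⟩ := hC.lam_num
  have hP' : ∀ n, P n ↔ M.app φ n = 0 := fun n => by
    have h := hP (cons n (kApp _ (0 : M.Num)))
    beta_reduce at h
    rw [app_cons_zero] at h
    rw [hφ, ← h]
  let A : QFFormula := .eq (.app (.var .fn 0) (.var .nat 0)) (.const .zero)
  let v : M.Valuation := (zeroVal M).set .fn 0 φ
  have hA : ∀ y : M.Num, Holds (v.set .nat 0 y) A ↔ P y := by
    intro y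
    have e1 : (v.set .nat 0 y) (.fn, 0) = φ := by simp [Valuation.set, v]
    have e2 : (v.set .nat 0 y) (.nat, 0) = y := by simp [Valuation.set]
    simp only [Holds, A, eval, e1, e2, hP']
    rfl
  exact (hA n).1 (hM.out.qf_induction A v 0 ((hA 0).2 h0)
    (fun n hn => (hA _).2 (hs n ((hA n).1 hn))) n)

/-- Primitive recursion. -/
theorem exists_rec {F : M.Num → M.Num → M.Num} (a : M.Num)
    (hF : RepNum fun w => F (M.app w (1 : M.Num)) (M.app w (0 : M.Num))) :
    ∃ φ : M.Fn, M.app φ (0 : M.Num) = a ∧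
      ∀ n : M.Num, M.app φ (n + 1 : M.Num) = F n (M.app φ n) := by
  obtain ⟨Φ, hΦ⟩ := hF.lam
  let st : M.carrier (.arr .nat .fn) := sApp (kApp .nat Φ) (M.app (M.const (.R .nat))
    (sApp (kApp .nat (M.const (.K .nat .nat))) (zeroObj M .fn)))
  have hst : ∀ k m : M.Num, M.app (M.app st k) m = F k m := fun k m => by
    have h : M.app (M.app st k) m = M.app (M.app Φ (cons k (zeroObj M .fn))) m :=
      ((app_sApp _ _ _).trans (app_kApp Φ k _)) m
    rw [h, hΦ, app_cons_zero, ← zero_add (1 : M.Num), app_cons_succ, app_cons_zero]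
  exact ⟨M.app (M.app (M.const (.R .nat)) st) a, hM.out.R_zero _ _, fun n =>
    (hM.out.R_succ _ _ _).trans (hst _ _)⟩

/-! ### Unpairing -/

/-- The integer square root inverts the pairing, because `pair i j` lies between (i + j)² and (i + j
+ 1)². It is primitive recursive: at n + 1 it increases by one exactly when the next square has been
reached. -/
theorem exists_sqrt : ∃ φ : M.Fn, ∀ n : M.Num,
    M.app φ n * M.app φ n ≤ n ∧ n < (M.app φ n + 1) * (M.app φ n + 1) := by
  classical
  have h1 : RepNum (M := M) fun w => M.app w (1 : M.Num) := Rep.id.app (Rep.const (1 : M.Num))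
  have h2 := (Rep.head (M := M)).add (Rep.const (1 : M.Num))
  obtain ⟨φ, hφ0, hφ⟩ := exists_rec (M := M)
    (F := fun n m => if (m + 1) * (m + 1) ≤ n + 1 then m + 1 else m) 0
    (Rep.ite (Dec.le (h2.mul h2) (h1.add (Rep.const (1 : M.Num)))) h2 Rep.head)
  have h3 := RepFn.comp ⟨φ, fun _ => rfl⟩ (Rep.head (M := M))
  have h4 := h3.add (Rep.const (1 : M.Num))
  refine ⟨φ, dec_induction ((Dec.le (h3.mul h3) Rep.head).and (Dec.lt Rep.head (h4.mul h4)))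
    (by simp [hφ0]) fun n hn => ?_⟩
  rw [hφ]
  set m := M.app φ n
  split_ifs with h
  · refine ⟨h, ?_⟩
    have := add_one_le_iff.2 hn.2
    refine this.trans_lt ?_
    gcongr <;> exact lt_add_one_iff.2 le_rfl
  · exact ⟨hn.1.trans le_self_add, not_le.1 h⟩

/-- The square root yields i + j; then i is the remainder and j the rest. Quantifier-free choice
replaces subtraction. -/
theorem exists_unpair : ∃ f g : M.Num → M.Num, RepFn f ∧ RepFn g ∧
    ∀ i j : M.Num, f (pair i j) = i ∧ g (pair i j) = j := by
  obtain ⟨φ, hφ⟩ := exists_sqrt (M := M)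
  have hr := RepFn.comp ⟨φ, fun _ => rfl⟩ (Rep.head (M := M))
  have hc : RepNum (M := M) fun w => M.app (tail w) (0 : M.Num) :=
    Rep.id.tail.app (Rep.const (0 : M.Num))
  have hs := RepFn.comp ⟨φ, fun _ => rfl⟩ hc
  have hsqrt : ∀ i j : M.Num, M.app φ (pair i j) = i + j := fun i j => by
    have h1 := (hφ (pair i j)).1
    have h2 := (hφ (pair i j)).2
    generalize M.app φ (pair i j) = r at h1 h2
    unfold pair at h1 h2
    refine le_antisymm ?_ ?_
    · by_contra! h
      have h3 := add_one_le_iff.2 h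
      refine absurd h1 (not_le.2 ?_)
      calc (i + j) * (i + j) + i ≤ (i + j) * (i + j) + (i + j) := by gcongr; exact le_self_add
        _ < (i + j) * (i + j) + (i + j) + (i + j + 1) :=
            lt_add_of_pos_right _ (lt_of_lt_of_le zero_lt_one le_add_self)
        _ = (i + j + 1) * (i + j + 1) := by ring
        _ ≤ r * r := by gcongr
    · by_contra! h
      have h3 := add_one_le_iff.2 h
      refine absurd h2 (not_lt.2 ?_)
      exact (mul_le_mul' h3 h3).trans le_self_add
  obtain ⟨F, hF, hF'⟩ := exists_choice (M := M)
    (P := fun x i => M.app φ (M.app x (0 : M.Num)) * M.app φ (M.app x (0 : M.Num)) + i =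
      M.app x (0 : M.Num))
    (Dec.eq ((hs.mul hs).add Rep.head) hc)
    (fun x y n h => by rw [show M.app x (0 : M.Num) = M.app y (0 : M.Num) from h _])
    (fun x => by
      obtain ⟨i, hi⟩ := exists_add_of_le (hφ (M.app x (0 : M.Num))).1
      exact ⟨i, hi.symm⟩)
  have hFt := hF.comp (Rep.id (M := M)).tail
  -- The second disjunct makes the choice predicate total; it does not occur for numbers that code a
  -- pair.
  obtain ⟨G, hG, hG'⟩ := exists_choice (M := M)
    (P := fun x j => F x + j = M.app φ (M.app x (0 : M.Num)) ∨
      M.app φ (M.app x (0 : M.Num)) < F x)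
    ((Dec.eq (hFt.add Rep.head) hs).or (Dec.lt hs hFt))
    (fun x y n h => by rw [show M.app x (0 : M.Num) = M.app y (0 : M.Num) from h _, hF.app_ext h])
    (fun x => by
      rcases lt_or_ge (M.app φ (M.app x (0 : M.Num))) (F x) with h | h
      · exact ⟨0, Or.inr h⟩
      · obtain ⟨i, hi⟩ := exists_add_of_le h
        exact ⟨i, Or.inl hi.symm⟩)
  have hz := Rep.const (M := M) (zeroObj M .fn)
  have hF0 : ∀ i j, F (cons (pair i j) (zeroObj M .fn)) = i := fun i j => by
    have h := hF' (cons (pair i j) (zeroObj M .fn))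
    rw [app_cons_zero, hsqrt] at h
    exact add_left_cancel h
  refine ⟨fun n => F (cons n (zeroObj M .fn)), fun n => G (cons n (zeroObj M .fn)),
    repFn_of_rep (hF.comp (Rep.head.cons hz)), repFn_of_rep (hG.comp (Rep.head.cons hz)),
    fun i j => ⟨hF0 i j, ?_⟩⟩
  have h := hG' (cons (pair i j) (zeroObj M .fn))
  rw [app_cons_zero, hsqrt, hF0] at h
  rcases h with h | h
  · exact add_left_cancel h
  · exact absurd h (not_lt.2 le_self_add)

/-! ### Powers of two -/

theorem twoPow_zero : M.twoPow (0 : M.Num) = 1 := hM.out.R_zero _ _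

theorem twoPow_succ (n : M.Num) : M.twoPow (n + 1 : M.Num) = M.twoPow n + M.twoPow n := by
  refine (hM.out.R_succ _ _ _).trans ?_
  refine (app_kApp (ρ := .fn) (τ := .nat) _ n _).trans ?_
  refine (app_sApp (ρ := .nat) (σ := .nat) (τ := .nat) _ _ _).trans ?_
  exact app_congr_right (M.app (M.const .add) (M.twoPow n)) (app_idObj (M.twoPow n))

theorem repFn_twoPow : RepFn M.twoPow := ⟨_, fun _ => rfl⟩

theorem lt_twoPow (n : M.Num) : n < M.twoPow n := by
  refine dec_induction (P := fun n => n < M.twoPow n)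
    (Dec.lt Rep.head (repFn_twoPow.comp Rep.head)) ?_ (fun n hn => ?_) n
  · rw [twoPow_zero]; exact zero_lt_one
  · rw [twoPow_succ]
    exact add_lt_add_of_lt_of_le hn (by
      rw [← zero_add (1 : M.Num), add_one_le_iff]; exact lt_of_le_of_lt zero_le hn)

theorem twoPow_lt_twoPow (m n : M.Num) : m < n → M.twoPow m < M.twoPow n := by
  refine dec_induction (P := fun n => m < n → M.twoPow m < M.twoPow n)
    ((Dec.lt (Rep.const m) Rep.head).imp
      (Dec.lt (Rep.const (M.twoPow m)) (repFn_twoPow.comp Rep.head))) ?_ (fun n hn h => ?_) n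
  · intro h; exact absurd h not_lt_zero
  · have hpos : M.twoPow n < M.twoPow (n + 1 : M.Num) := by
      rw [twoPow_succ]
      exact lt_add_of_pos_right _ (lt_of_le_of_lt zero_le (lt_twoPow n))
    rcases (lt_add_one_iff.1 h).lt_or_eq with h | rfl
    · exact (hn h).trans hpos
    · exact hpos

instance : ArithLaws M.Num where
  twoPow_zero e := by
    change e = _ ↔ _
    rw [twoPow_zero]
  twoPow_succ n e := by
    change e = _ ↔ ∃ d, d = _ ∧ _
    rw [twoPow_succ]
    simp
  twoPow_existsUnique n := ⟨_, rfl, fun _ h => h⟩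
  lt_twoPow n e h := by
    obtain rfl : e = M.twoPow n := h
    exact lt_twoPow n
  twoPow_strictMono m n d e h hd he := by
    obtain rfl : d = M.twoPow m := hd
    obtain rfl : e = M.twoPow n := he
    exact twoPow_lt_twoPow _ _ h

theorem exp2_eq (n : M.Num) : exp2 n = M.twoPow n := (isTwoPow_iff.1 rfl).symm

end OmegaStructure
end ReverseMath

/-! ### One-point extension of third-order functions -/

namespace ReverseMath

/-- Since clamping does not increase distances, it may be applied term by term to a fast Cauchy
sequence without loss of the rate. -/
theorem abs_clamp_sub_le {K : Type*} [Field K] [LinearOrder K] [IsStrictOrderedRing K]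
    (a b c : K) : |max 0 (min a c) - max 0 (min b c)| ≤ |a - b| := by
  have h1 := neg_abs_le (a - b)
  have h2 := le_abs_self (a - b)
  have h3 := abs_nonneg (a - b)
  rw [abs_le]
  simp only [max_def, min_def]
  split_ifs <;> constructor <;> linarith

namespace OmegaStructure

open Filter

variable {M : OmegaStructure.{u}} [hM : Fact M.ModelsRCAω]

theorem seq_unique {x : M.Fn} {n : M.Num} {a b : RatRep M.Num} (h : seq x n a) (h' : seq x n b) :
    a = b := RatRep.code_inj.1 (h.2.symm.trans h'.2)

theorem isReal_seq {x : M.Fn} {ρ : M.Num → RatRep M.Num} (hρ : ∀ n, 0 < (ρ n).den)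
    (hx : ∀ n, M.app x n = (ρ n).code)
    (hc : ∀ m n, m ≤ n → |(ρ m).val - (ρ n).val| < tol m) :
    (seq x).IsReal ∧ ∀ n, (seq x).val n = (ρ n).val := by
  have h : ∀ n, seq x n (ρ n) := fun n => ⟨hρ n, hx n⟩
  have hR : (seq x).IsReal := RatSeq.isReal_iff.2
    ⟨fun n => ⟨ρ n, h n, fun a ha => seq_unique ha (h n)⟩, fun n a ha => ha.1,
      fun m n a b hmn ha hb => by
        rw [seq_unique ha (h m), seq_unique hb (h n)]; exact hc m n hmn⟩
  exact ⟨hR, fun n => hR.val_eq (h n)⟩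

theorem exists_terms {x : M.Fn} (hx : (seq x).IsReal) : ∃ ρ : M.Num → RatRep M.Num,
    (∀ n, 0 < (ρ n).den) ∧ (∀ n, M.app x n = (ρ n).code) ∧ ∀ n, (seq x).val n = (ρ n).val := by
  choose ρ h1 h2 h3 using hx.exists_term
  exact ⟨ρ, h2, fun n => (h1 n).2, fun n => (h3 n).symm⟩

theorem seq_congr {x y : M.Fn} (h : ∀ n : M.Num, M.app x n = M.app y n) : seq x = seq y := by
  funext n a
  simp only [seq, h n]

theorem tol_eq (n : M.Num) : (⟨1, 0, M.twoPow n⟩ : RatRep M.Num).val = tol n := by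
  rw [RatRep.val_unit, tol, exp2_eq]

theorem twoPow_pos (n : M.Num) : 0 < M.twoPow n := by rw [← exp2_eq]; exact exp2_pos n

/-- The zero real. -/
def zeroReal (M : OmegaStructure.{u}) : M.Fn := kApp _ (0 : RatRep M.Num).code

theorem seq_zeroReal : seq (zeroReal M) = RatSeq.const 0 := by
  funext n a
  have h : M.app (zeroReal M) n = (0 : RatRep M.Num).code :=
    app_kApp (τ := .nat) (0 : RatRep M.Num).code n
  simp only [seq, RatSeq.const, h, RatRep.code_inj, eq_iff_iff]
  constructor
  · exact fun h => h.2.symm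
  · rintro rfl
    exact ⟨RatRep.zero_den_pos, rfl⟩

open RatSeq

/-- At a point x ≥ δ > 0, a radius below δ / 2 keeps all competitors positive, and continuity of f
applies. At x = 0 the limit condition bounds g at positive competitors, and g vanishes at the
others. -/
theorem continuousOnReals_Ico {f g : M.carrier (.arr .fn .fn)} (hf : IsRealFun f)
    (hg : IsRealFun g) (hc : ContinuousOnReals f InIoo) (hlim : TendsToZeroAtZeroRight f)
    (h1 : ∀ x : M.Fn, (seq x).InIoo → (seq (M.app g x)).Eqv (seq (M.app f x)))
    (h0 : ∀ x : M.Fn, (seq x).IsReal → (seq x).Eqv (RatSeq.const 0) →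
      (seq (M.app g x)).Eqv (RatSeq.const 0)) : ContinuousOnReals g InIco := by
  have hR0 : (RatSeq.const (0 : RatRep M.Num)).IsReal := isReal_const RatRep.zero_den_pos
  rintro x ⟨hx, hx0, hx1⟩ k
  rcases (le_iff_lt_or_eqv hR0 hx).1 hx0 with h | h
  · obtain ⟨m, hm⟩ := hc x ⟨hx, h, hx1⟩ k
    have h' := h
    obtain ⟨δ, hδ, h⟩ := (lt_iff hR0 hx).1 h
    obtain ⟨n, hn⟩ := exists_tol_lt (half_pos hδ)
    refine ⟨max m n, fun y hy hxy => ?_⟩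
    have hxy' := hxy
    rw [distLt_iff hx hy.1 (twoPow_pos _), tol_eq] at hxy
    obtain ⟨ε, hε, hxy⟩ := hxy
    have hy0 : (RatSeq.const 0).Lt (seq y) := by
      rw [lt_iff hR0 hy.1]
      refine ⟨δ / 2, half_pos hδ, ?_⟩
      filter_upwards [h, hxy] with l h2 h3
      have h4 := tol_anti (le_max_right m n)
      have := le_abs_self ((seq x).val l - (seq y).val l)
      linarith
    have hym : (seq x).DistLt (seq y) ⟨1, 0, M.twoPow m⟩ := by
      rw [distLt_iff hx hy.1 (twoPow_pos _), tol_eq]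
      refine ⟨ε, hε, ?_⟩
      filter_upwards [hxy] with l h3
      exact h3.trans (tol_anti (le_max_left m n))
    have hy' : (seq y).InIoo := ⟨hy.1, hy0, hy.2.2⟩
    refine (hm y hy' hym).congr (hf.1 _ hx) (hf.1 _ hy.1) (hg.1 _ hx) (hg.1 _ hy.1)
      (twoPow_pos _) ?_ ?_
    · exact (h1 x ⟨hx, h', hx1⟩).symm (hg.1 _ hx) (hf.1 _ hx)
    · exact (h1 y hy').symm (hg.1 _ hy.1) (hf.1 _ hy.1)
  · obtain ⟨m, hm⟩ := hlim k
    have hgx := h0 x hx (h.symm hR0 hx)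
    have hgx' := (eqv_iff (hg.1 x hx) hR0).1 hgx
    refine ⟨m, fun y hy hxy => ?_⟩
    rw [distLt_iff (hg.1 x hx) (hg.1 y hy.1) (twoPow_pos _), tol_eq]
    rcases (le_iff_lt_or_eqv hR0 hy.1).1 hy.2.1 with hy0 | hy0
    · have hlt : (seq y).Lt (RatSeq.const ⟨1, 0, M.twoPow m⟩) := by
        rw [lt_iff hy.1 (isReal_const (twoPow_pos _))]
        rw [distLt_iff hx hy.1 (twoPow_pos _), tol_eq] at hxy
        obtain ⟨ε, hε, hxy⟩ := hxy
        refine ⟨ε / 2, half_pos hε, ?_⟩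
        filter_upwards [hxy, (eqv_iff hR0 hx).1 h _ (half_pos hε)] with l h2 h3
        rw [val_const, RatRep.val_zero] at h3
        rw [val_const, tol_eq]
        have h4 := abs_le.1 h3
        have := neg_abs_le ((seq x).val l - (seq y).val l)
        linarith
      have h3 := hm y hy.1 hy0 hlt
      rw [distLt_iff (hf.1 y hy.1) hR0 (twoPow_pos _), tol_eq] at h3
      obtain ⟨ε, hε, h3⟩ := h3
      refine ⟨ε / 2, half_pos hε, ?_⟩
      filter_upwards [h3, hgx' (ε / 4) (by linarith),
        (eqv_iff (hg.1 y hy.1) (hf.1 y hy.1)).1 (h1 y ⟨hy.1, hy0, hy.2.2⟩) (ε / 4) (by linarith)]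
        with l h4 h5 h6
      rw [val_const, RatRep.val_zero, sub_zero] at h4 h5
      have h7 := abs_sub_le ((seq (M.app g x)).val l) 0 ((seq (M.app g y)).val l)
      have h8 := abs_sub_le 0 ((seq (M.app f y)).val l) ((seq (M.app g y)).val l)
      rw [zero_sub, abs_neg] at h7 h8
      rw [zero_sub, abs_neg] at h8
      rw [sub_zero] at h7
      rw [abs_sub_comm] at h6
      linarith
    · have h3 := (eqv_iff (hg.1 y hy.1) hR0).1 (h0 y hy.1 (hy0.symm hR0 hy.1))
      have hk := tol_pos k
      refine ⟨tol k / 2, half_pos hk, ?_⟩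
      filter_upwards [h3 (tol k / 4) (by linarith), hgx' (tol k / 4) (by linarith)] with l h4 h5
      rw [val_const, RatRep.val_zero, sub_zero] at h4 h5
      have h7 := abs_sub ((seq (M.app g x)).val l) ((seq (M.app g y)).val l)
      linarith

/-- The rational clamped to the interval from `0` to `1 / e`. -/
noncomputable def clamp (e : M.Num) (a : RatRep M.Num) : RatRep M.Num :=
  open Classical in
  -- With denominators cleared, the tests read a ≤ 0 and 1 / e < a, so they are decidable from the
  -- code of a.
  if a.pos ≤ a.neg then 0 else if a.den + a.neg * e < a.pos * e then ⟨1, 0, e⟩ else a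

theorem clamp_spec {e : M.Num} (he : 0 < e) {a : RatRep M.Num} (ha : 0 < a.den) :
    0 < (clamp e a).den ∧ (clamp e a).val = max 0 (min a.val (Frac.cast e)⁻¹) := by
  have hd := Frac.cast_pos.2 ha
  have he' := Frac.cast_pos.2 he
  unfold clamp
  split_ifs with h h'
  · refine ⟨RatRep.zero_den_pos, ?_⟩
    have : a.val ≤ 0 := div_nonpos_of_nonpos_of_nonneg (by
      rw [sub_nonpos]; exact Frac.cast_le.2 h) hd.le
    rw [RatRep.val_zero, max_eq_left ((min_le_left _ _).trans this)]
  · refine ⟨he, ?_⟩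
    have : (Frac.cast e)⁻¹ ≤ a.val := by
      rw [RatRep.val, inv_eq_one_div, div_le_div_iff₀ he' hd]
      have := (Frac.cast_lt.2 h').le
      simp only [map_add, map_mul] at this
      linarith
    rw [RatRep.val_unit, min_eq_right this, max_eq_right (inv_pos.2 he').le]
  · refine ⟨ha, ?_⟩
    have h1 : 0 ≤ a.val := div_nonneg (by
      rw [sub_nonneg]; exact Frac.cast_le.2 (not_le.1 h).le) hd.le
    have : a.val ≤ (Frac.cast e)⁻¹ := by
      rw [RatRep.val, inv_eq_one_div, div_le_div_iff₀ hd he']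
      have := Frac.cast_le.2 (not_lt.1 h')
      simp only [map_add, map_mul] at this
      linarith
    rw [min_eq_left this, max_eq_right h1]

theorem exists_repFn_code : ∃ p q d : M.Num → M.Num, RepFn p ∧ RepFn q ∧ RepFn d ∧
    ∀ a : RatRep M.Num, p a.code = a.pos ∧ q a.code = a.neg ∧ d a.code = a.den := by
  obtain ⟨f, g, hf, hg, h⟩ := exists_unpair (M := M)
  exact ⟨fun n => f (f n), fun n => g (f n), g,
    repFn_of_rep (hf.comp (hf.comp Rep.head)), repFn_of_rep (hg.comp (hf.comp Rep.head)), hg,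
    fun a => by simp [RatRep.code, h]⟩

theorem exists_clampObj (e : M.Num) : ∃ C : M.Num → M.Num, RepFn C ∧
    ∀ a : RatRep M.Num, C a.code = (clamp e a).code := by
  classical
  obtain ⟨p, q, d, hp, hq, hd, h⟩ := exists_repFn_code (M := M)
  have hp := hp.comp Rep.head
  have hq := hq.comp Rep.head
  have hd := hd.comp Rep.head
  have he := Rep.const (M := M) (τ := .nat) e
  refine ⟨_, repFn_of_rep (F := fun n => if p n ≤ q n then (0 : RatRep M.Num).code else
    if d n + q n * e < p n * e then (⟨1, 0, e⟩ : RatRep M.Num).code else n)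
    (Rep.ite (Dec.le hp hq) (Rep.const _)
      (Rep.ite (Dec.lt (hd.add (hq.mul he)) (hp.mul he)) (Rep.const _) Rep.head)), fun a => ?_⟩
  obtain ⟨h1, h2, h3⟩ := h a
  simp only [h1, h2, h3, clamp]
  split_ifs <;> rfl

theorem exists_abs_lt_dec (h : M.Num) (hh : 0 < h) : ∃ T : M.Num → Prop,
    (∀ F : M.Fn → M.Num, RepNum F → Dec fun z => T (F z)) ∧
    ∀ a : RatRep M.Num, 0 < a.den → (T a.code ↔ |a.val| < (Frac.cast h)⁻¹) := by
  obtain ⟨p, q, d, hp, hq, hd, hpqd⟩ := exists_repFn_code (M := M)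
  have he := Rep.const (M := M) (τ := .nat) h
  refine ⟨fun n => p n * h < d n + q n * h ∧ q n * h < d n + p n * h, fun F hF => ?_,
    fun a ha => ?_⟩
  · have hp := hp.comp hF
    have hq := hq.comp hF
    have hd := hd.comp hF
    exact (Dec.lt (hp.mul he) (hd.add (hq.mul he))).and (Dec.lt (hq.mul he) (hd.add (hp.mul he)))
  · obtain ⟨h1, h2, h3⟩ := hpqd a
    simp only [h1, h2, h3]
    have hd := Frac.cast_pos.2 ha
    have hh' := Frac.cast_pos.2 hh
    rw [abs_lt, neg_eq_neg_one_mul, ← div_eq_mul_inv, RatRep.val, inv_eq_one_div,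
      div_lt_div_iff₀ hh' hd, div_lt_div_iff₀ hd hh', ← Frac.cast_lt, ← Frac.cast_lt]
    simp only [map_add, map_mul]
    constructor <;> rintro ⟨h4, h5⟩ <;> constructor <;> linarith

theorem exists_clampFun (m : M.Num) : ∃ t : M.carrier (.arr .fn .fn), ∀ x : M.Fn,
    (seq x).IsReal → (seq (M.app t x)).IsReal ∧
      ∀ n, (seq (M.app t x)).val n = max 0 (min ((seq x).val n) (tol m)) := by
  obtain ⟨C, hC, hC'⟩ := exists_clampObj (M := M) (M.twoPow m)
  obtain ⟨t, ht⟩ := (hC.comp (Rep.id.app (Rep.head.add (Rep.const (1 : M.Num))))).lam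
  refine ⟨t, fun x hx => ?_⟩
  obtain ⟨ρ, h1, h2, h3⟩ := exists_terms hx
  have h4 := fun n => clamp_spec (twoPow_pos m) (h1 n)
  have h5 : (Frac.cast (M.twoPow m))⁻¹ = tol m := by rw [tol, exp2_eq]
  have := isReal_seq (x := M.app t x) (fun n => (h4 n).1) (fun n => by
    rw [ht, app_cons_zero, app_cons_succ, h2, hC']) (fun k n hkn => by
      rw [(h4 k).2, (h4 n).2]
      have h6 := hx.abs_sub_lt hkn
      rw [h3, h3] at h6
      exact lt_of_le_of_lt (abs_clamp_sub_le _ _ _) h6)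
  refine ⟨this.1, fun n => ?_⟩
  rw [this.2, (h4 n).2, h3, h5]

/-- The jump at 0 decides x > 0. Choose l with |f(0)| ≥ 2 · 2^(-l), and m such that |f| < 2^(-l-1)
on (0, 2^(-m)). Let t(x) be x clamped to [0, 2^(-m-1)]. If x > 0, then f(t(x)) is below 2^(-l-1) in
absolute value; otherwise t(x) = 0. The approximation of f(t(x)) at index l + 1 has error at most
2^(-l-1), so comparing its absolute value with 2^(-l) separates the two cases. -/
theorem exists_extension_of_not_eqv {f : M.carrier (.arr .fn .fn)} (hf : IsRealFun f)
    (hlim : TendsToZeroAtZeroRight f)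
    (hne : ¬ (seq (M.app f (zeroReal M))).Eqv (RatSeq.const 0)) :
    ∃ g : M.carrier (.arr .fn .fn), IsRealFun g ∧
      (∀ x : M.Fn, (seq x).InIoo → (seq (M.app g x)).Eqv (seq (M.app f x))) ∧
      ∀ x : M.Fn, (seq x).IsReal → (seq x).Eqv (RatSeq.const 0) → (seq (M.app g x)).Eqv (RatSeq.const 0) := by
  classical
  have hR0 : (RatSeq.const (0 : RatRep M.Num)).IsReal := isReal_const RatRep.zero_den_pos
  have hz : (seq (zeroReal M)).IsReal := by rw [seq_zeroReal]; exact hR0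
  have hfz := hf.1 _ hz
  obtain ⟨l, hl⟩ : ∃ l : M.Num, ∀ᶠ n in atTop,
      2 * tol l ≤ |(seq (M.app f (zeroReal M))).val n| := by
    rw [eqv_iff hfz hR0] at hne
    push Not at hne
    obtain ⟨δ, hδ, hne⟩ := hne
    obtain ⟨l, hl⟩ := exists_tol_lt (show 0 < δ / 4 by linarith)
    obtain ⟨n, hn1, hn2⟩ := (hne.and_eventually (eventually_tol_lt (half_pos hδ))).exists
    rw [val_const, RatRep.val_zero, sub_zero] at hn1
    refine ⟨l, ?_⟩
    filter_upwards [hfz.eventually_abs_sub_lt n] with i hi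
    have := abs_sub_abs_le_abs_sub ((seq (M.app f (zeroReal M))).val n)
      ((seq (M.app f (zeroReal M))).val i)
    linarith
  have hl0 := tol_pos l
  have hl1 := tol_succ l
  obtain ⟨m, hm⟩ := hlim (l + 1)
  -- Clamping at 2^(-m-1) rather than 2^(-m) keeps t(x) strictly inside the interval of the limit
  -- condition.
  obtain ⟨t, ht⟩ := exists_clampFun (M := M) (m + 1)
  obtain ⟨T, hT, hT'⟩ := exists_abs_lt_dec (M := M) (M.twoPow l) (twoPow_pos l)
  rw [show (Frac.cast (M.twoPow l))⁻¹ = tol l by rw [tol, exp2_eq]] at hT'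
  have htail := Rep.id (M := M).tail
  have hTd : Dec (M := M) fun w => T (M.app (M.app f (M.app t (tail w))) (l + 1 : M.Num)) :=
    hT _ (((Rep.const f).app ((Rep.const t).app htail)).app (Rep.const (l + 1 : M.Num)))
  have hrep := Rep.ite hTd (((Rep.const f).app htail).app Rep.head)
    (Rep.const ((0 : RatRep M.Num).code : M.Num))
  obtain ⟨g, hg⟩ := hrep.lam
  have hg' : ∀ (x : M.Fn) (n : M.Num), M.app (M.app g x) n =
      if T (M.app (M.app f (M.app t x)) (l + 1 : M.Num)) then M.app (M.app f x) n
      else (0 : RatRep M.Num).code := by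
    intro x n
    have e1 := app_congr_right t (tail_cons n x)
    have e2 : M.app (M.app f (M.app t (tail (cons n x)))) (l + 1 : M.Num) =
      M.app (M.app f (M.app t x)) (l + 1 : M.Num) := (app_congr_right f e1) _
    have e3 : M.app (M.app f (tail (cons n x))) n = M.app (M.app f x) n :=
      (app_congr_right f (tail_cons n x)) n
    rw [hg, e2, app_cons_zero, e3]
  have hpos : ∀ x : M.Fn, (seq x).IsReal → (RatSeq.const 0).Lt (seq x) →
      seq (M.app g x) = seq (M.app f x) := by
    intro x hx h0
    obtain ⟨htx, htv⟩ := ht x hx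
    obtain ⟨δ, hδ, h⟩ := (lt_iff hR0 hx).1 h0
    have hm0 := tol_pos (m + 1)
    have h1 := hm (M.app t x) htx (by
      rw [lt_iff hR0 htx]
      refine ⟨min δ (tol (m + 1)), lt_min hδ hm0, ?_⟩
      filter_upwards [h] with n hn
      rw [val_const, RatRep.val_zero, zero_add] at hn ⊢
      rw [htv]
      exact le_max_of_le_right (min_le_min_right _ hn)) (by
      rw [lt_iff htx (isReal_const (twoPow_pos _))]
      refine ⟨tol (m + 1), hm0, Eventually.of_forall fun n => ?_⟩
      have : (seq (M.app t x)).val n ≤ tol (m + 1) := by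
        rw [htv]; exact max_le hm0.le (min_le_right _ _)
      rw [val_const, tol_eq]
      have := tol_succ m
      linarith)
    have hft := hf.1 _ htx
    rw [distLt_iff hft hR0 (twoPow_pos _), tol_eq] at h1
    obtain ⟨ε, hε, h1⟩ := h1
    obtain ⟨n, h2, h3⟩ := (h1.and (hft.eventually_abs_sub_lt (l + 1))).exists
    obtain ⟨ρ, r1, r2, r3⟩ := exists_terms hft
    have hTx : T (M.app (M.app f (M.app t x)) (l + 1 : M.Num)) := by
      rw [r2, hT' _ (r1 _), ← r3]
      rw [val_const, RatRep.val_zero, sub_zero] at h2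
      have := abs_sub_abs_le_abs_sub ((seq (M.app f (M.app t x))).val (l + 1))
        ((seq (M.app f (M.app t x))).val n)
      linarith
    exact seq_congr fun n => by rw [hg', if_pos hTx]
  have hnpos : ∀ x : M.Fn, (seq x).IsReal → ¬ (RatSeq.const 0).Lt (seq x) →
      seq (M.app g x) = RatSeq.const 0 := by
    intro x hx h0
    obtain ⟨htx, htv⟩ := ht x hx
    have hft := hf.1 _ htx
    have h1 : (seq (M.app t x)).Eqv (seq (zeroReal M)) := by
      rw [seq_zeroReal, eqv_iff htx hR0]
      intro δ hδ
      filter_upwards [(le_iff hx hR0).1 h0 δ hδ] with n hn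
      rw [val_const, RatRep.val_zero, zero_add] at hn
      rw [val_const, RatRep.val_zero, sub_zero, htv, abs_of_nonneg (le_max_left _ _)]
      exact max_le hδ.le ((min_le_left _ _).trans hn)
    have h2 := (eqv_iff hft hfz).1 (hf.2 _ _ htx hz h1)
    obtain ⟨n, h3, h4, h5⟩ := ((h2 (tol l / 4) (by linarith)).and
      (hl.and (hft.eventually_abs_sub_lt (l + 1)))).exists
    obtain ⟨ρ, r1, r2, r3⟩ := exists_terms hft
    have hTx : ¬ T (M.app (M.app f (M.app t x)) (l + 1 : M.Num)) := by
      rw [r2, hT' _ (r1 _), ← r3, not_lt]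
      have e1 := abs_sub_abs_le_abs_sub ((seq (M.app f (M.app t x))).val n)
        ((seq (M.app f (M.app t x))).val (l + 1))
      have e2 := abs_sub_abs_le_abs_sub ((seq (M.app f (zeroReal M))).val n)
        ((seq (M.app f (M.app t x))).val n)
      rw [abs_sub_comm] at h3 h5
      linarith
    rw [← seq_zeroReal]
    refine seq_congr fun n => ?_
    rw [hg', if_neg hTx]
    exact (app_kApp (τ := .nat) (0 : RatRep M.Num).code n).symm
  refine ⟨g, ⟨fun x hx => ?_, fun x y hx hy hxy => ?_⟩, fun x hx => ?_, fun x hx h => ?_⟩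
  · by_cases h : (RatSeq.const 0).Lt (seq x)
    · rw [hpos x hx h]; exact hf.1 x hx
    · rw [hnpos x hx h]; exact hR0
  · by_cases h : (RatSeq.const 0).Lt (seq x)
    · rw [hpos x hx h, hpos y hy (h.congr_right hR0 hx hy hxy)]; exact hf.2 x y hx hy hxy
    · rw [hnpos x hx h, hnpos y hy fun h' => h (h'.congr_right hR0 hy hx (hxy.symm hx hy))]
      exact eqv_refl hR0
  · rw [hpos x hx.1 hx.2.1]; exact eqv_refl (hf.1 x hx.1)
  · rw [hnpos x hx fun h' => ?_]
    · exact eqv_refl hR0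
    · exact (le_iff_lt_or_eqv hx hR0).2 (Or.inr h) h'

-- Excluded middle on f(0) = 0. In the first case f already is the extension, because it respects
-- equality of reals.
variable (M) in
theorem onePointExtension : M.OnePointExtension := by
  intro f hf hc hlim
  have hR0 : (RatSeq.const (0 : RatRep M.Num)).IsReal := isReal_const RatRep.zero_den_pos
  have hz : (seq (zeroReal M)).IsReal := by rw [seq_zeroReal]; exact hR0
  obtain ⟨g, hg, h1, h0⟩ : ∃ g : M.carrier (.arr .fn .fn), IsRealFun g ∧
      (∀ x : M.Fn, (seq x).InIoo → (seq (M.app g x)).Eqv (seq (M.app f x))) ∧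
      ∀ x : M.Fn, (seq x).IsReal → (seq x).Eqv (RatSeq.const 0) →
        (seq (M.app g x)).Eqv (RatSeq.const 0) := by
    by_cases h : (seq (M.app f (zeroReal M))).Eqv (RatSeq.const 0)
    · refine ⟨f, hf, fun x hx => eqv_refl (hf.1 x hx.1), fun x hx hx0 => ?_⟩
      rw [← seq_zeroReal] at hx0
      exact (hf.2 _ _ hx hz hx0).trans (hf.1 x hx) (hf.1 _ hz) hR0 h
    · exact exists_extension_of_not_eqv hf hlim h
  exact ⟨g, hg, h1, h0, continuousOnReals_Ico hf hg hc hlim h1 h0⟩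

end OmegaStructure
end ReverseMath

/-! ### Definability by instance search, comprehension and induction -/

namespace ReverseMath

/-- Renaming of the variables of a term. -/
def NumTerm.rename (σ : ℕ → ℕ) : NumTerm → NumTerm
  | .var i => .var (σ i)
  | .zero => .zero
  | .one => .one
  | .add t s => .add (t.rename σ) (s.rename σ)
  | .mul t s => .mul (t.rename σ) (s.rename σ)

/-- Renaming of the number variables and of the set variables of a formula. -/
def ArithFormula.rename (σ τ : ℕ → ℕ) : ArithFormula → ArithFormula
  | .eq t s => .eq (t.rename σ) (s.rename σ)
  | .lt t s => .lt (t.rename σ) (s.rename σ)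
  | .mem t j => .mem (t.rename σ) (τ j)
  | .not A => .not (A.rename σ τ)
  | .and A B => .and (A.rename σ τ) (B.rename σ τ)
  | .ball i t A => .ball (σ i) (t.rename σ) (A.rename σ τ)
  | .all i A => .all (σ i) (A.rename σ τ)

theorem ArithFormula.isBounded_rename {σ τ : ℕ → ℕ} (A : ArithFormula) (h : A.IsBounded) :
    (A.rename σ τ).IsBounded := by
  induction A with
  | eq | lt | mem => trivial
  | not A ih => exact ih h
  | and A B ihA ihB => exact ⟨ihA h.1, ihB h.2⟩
  | ball i t A ih => exact ih h
  | all i A ih => exact h.elim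

/-- The sequence with `ρ` at the even positions and `ρ'` at the odd ones. -/
def merge {β : Type*} (ρ ρ' : ℕ → β) (n : ℕ) : β := if n % 2 = 0 then ρ (n / 2) else ρ' (n / 2)

theorem merge_even {β : Type*} (ρ ρ' : ℕ → β) (n : ℕ) : merge ρ ρ' (2 * n) = ρ n := by
  simp [merge]

theorem merge_odd {β : Type*} (ρ ρ' : ℕ → β) (n : ℕ) : merge ρ ρ' (2 * n + 1) = ρ' n := by
  have h1 : ¬ (2 * n + 1) % 2 = 0 := by omega
  have h2 : (2 * n + 1) / 2 = n := by omega
  rw [merge, if_neg h1, h2]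

/-- Moves the odd number `2 i + 1` to `2 (2 i) + 1`. -/
def spreadLeft (n : ℕ) : ℕ := if n % 2 = 0 then n else 2 * n - 1

/-- Moves the odd number `2 i + 1` to `2 (2 i + 1) + 1`. -/
def spreadRight (n : ℕ) : ℕ := if n % 2 = 0 then n else 2 * n + 1

theorem spreadLeft_injective : Function.Injective spreadLeft := by
  intro m n h
  unfold spreadLeft at h
  split_ifs at h <;> omega

theorem spreadRight_injective : Function.Injective spreadRight := by
  intro m n h
  unfold spreadRight at h
  split_ifs at h <;> omega

theorem spreadLeft_even (n : ℕ) : spreadLeft (2 * n) = 2 * n := by simp [spreadLeft]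

theorem spreadLeft_odd (n : ℕ) : spreadLeft (2 * n + 1) = 2 * (2 * n) + 1 := by
  have : ¬ (2 * n + 1) % 2 = 0 := by omega
  rw [spreadLeft, if_neg this]; omega

theorem spreadRight_even (n : ℕ) : spreadRight (2 * n) = 2 * n := by simp [spreadRight]

theorem spreadRight_odd (n : ℕ) : spreadRight (2 * n + 1) = 2 * (2 * n + 1) + 1 := by
  have : ¬ (2 * n + 1) % 2 = 0 := by omega
  rw [spreadRight, if_neg this]

namespace L2Structure

variable {M : L2Structure.{u, v}}

theorem eval_rename (σ : ℕ → ℕ) (v : ℕ → M.Num) :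
    ∀ t : NumTerm, eval v (t.rename σ) = eval (v ∘ σ) t
  | .var _ => rfl
  | .zero => rfl
  | .one => rfl
  | .add t s => by
    change eval v (t.rename σ) + eval v (s.rename σ) = _
    rw [eval_rename σ v t, eval_rename σ v s]; rfl
  | .mul t s => by
    change eval v (t.rename σ) * eval v (s.rename σ) = _
    rw [eval_rename σ v t, eval_rename σ v s]; rfl

/-- Injectivity prevents capture: reassigning the renamed bound variable changes no other renamed
variable. -/
theorem holds_rename {σ : ℕ → ℕ} (hσ : σ.Injective) (τ : ℕ → ℕ) (V : ℕ → M.Sets) :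
    ∀ (A : ArithFormula) (v : ℕ → M.Num),
      Holds V v (A.rename σ τ) ↔ Holds (V ∘ τ) (v ∘ σ) A
  | .eq t s, v => by simp only [ArithFormula.rename, Holds, eval_rename]
  | .lt t s, v => by simp only [ArithFormula.rename, Holds, eval_rename]
  | .mem t j, v => by simp only [ArithFormula.rename, Holds, eval_rename, Function.comp]
  | .not A, v => by simp only [ArithFormula.rename, Holds, holds_rename hσ τ V A]
  | .and A B, v => by
    simp only [ArithFormula.rename, Holds, holds_rename hσ τ V A, holds_rename hσ τ V B]
  | .ball i t A, v => by
    simp only [ArithFormula.rename, Holds, eval_rename, holds_rename hσ τ V A,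
      Function.update_comp_eq_of_injective _ hσ]
  | .all i A, v => by
    simp only [ArithFormula.rename, Holds, holds_rename hσ τ V A,
      Function.update_comp_eq_of_injective _ hσ]

variable (M) in
/-- A type of finite sequences of numbers. -/
class Env (α : Type u) where
  size : ℕ
  get : α → ℕ → M.Num

instance : Env M PUnit := ⟨0, fun _ _ => 0⟩

/-- Contexts are nested pairs with the newest variable last. Entries occupy the even variables and
parameters the odd ones, so a fresh bound variable never collides with a parameter. -/
instance (α : Type u) [Env M α] : Env M (α × M.Num) :=
  ⟨Env.size M α + 1, fun x i => if i = Env.size M α then x.2 else Env.get x.1 i⟩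

/-- The valuation `v` gives the entries of `x` to the even variables and `ρ` to the odd ones. -/
def Fits {α : Type u} [Env M α] (ρ : ℕ → M.Num) (v : ℕ → M.Num) (x : α) : Prop :=
  (∀ i < Env.size M α, v (2 * i) = Env.get x i) ∧ ∀ i, v (2 * i + 1) = ρ i

/-- The function `t` is given by a term with parameters `ρ`. -/
def TmAt {α : Type u} [Env M α] (ρ : ℕ → M.Num) (t : α → M.Num) : Prop :=
  ∃ τ : NumTerm, ∀ v x, Fits ρ v x → eval v τ = t x

/-- The function `t` is given by a term with parameters. -/
class Tm {α : Type u} [Env M α] (t : α → M.Num) : Prop where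
  out : ∃ ρ, TmAt ρ t

/-- The predicate `P` is given by an arithmetical formula, which is bounded if `b = true`, with
parameters `ρ` and `V`. -/
def DfnAt {α : Type u} [Env M α] (b : Bool) (ρ : ℕ → M.Num) (V : ℕ → M.Sets) (P : α → Prop) :
    Prop :=
  ∃ A : ArithFormula, (b = true → A.IsBounded) ∧ ∀ v x, Fits ρ v x → (Holds V v A ↔ P x)

/-- The predicate `P` is given by an arithmetical formula with parameters, which is bounded if
`b = true`. -/
class Dfn (M : L2Structure.{u, v}) {α : Type u} [Env M α] (b : Bool) (P : α → Prop) : Prop where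
  out : ∃ (ρ : ℕ → M.Num) (V : ℕ → M.Sets), DfnAt b ρ V P

section Merge

variable {α : Type u} [Env M α] {ρ ρ' : ℕ → M.Num}

/-- Two formulas with separate parameter lists are joined by interleaving the lists; the renamings
send each formula to its own half. -/
theorem Fits.left {v : ℕ → M.Num} {x : α} (h : Fits (merge ρ ρ') v x) :
    Fits ρ (v ∘ spreadLeft) x :=
  ⟨fun i hi => by rw [Function.comp, spreadLeft_even, h.1 i hi],
    fun i => by rw [Function.comp, spreadLeft_odd, h.2, merge_even]⟩

theorem Fits.right {v : ℕ → M.Num} {x : α} (h : Fits (merge ρ ρ') v x) :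
    Fits ρ' (v ∘ spreadRight) x :=
  ⟨fun i hi => by rw [Function.comp, spreadRight_even, h.1 i hi],
    fun i => by rw [Function.comp, spreadRight_odd, h.2, merge_odd]⟩

theorem TmAt.left {t : α → M.Num} (h : TmAt ρ t) (ρ' : ℕ → M.Num) : TmAt (merge ρ ρ') t := by
  obtain ⟨τ, h⟩ := h
  exact ⟨τ.rename spreadLeft, fun v x hv => by rw [eval_rename, h _ _ hv.left]⟩

theorem TmAt.right {t : α → M.Num} (h : TmAt ρ' t) (ρ : ℕ → M.Num) : TmAt (merge ρ ρ') t := by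
  obtain ⟨τ, h⟩ := h
  exact ⟨τ.rename spreadRight, fun v x hv => by rw [eval_rename, h _ _ hv.right]⟩

theorem DfnAt.left {b : Bool} {V : ℕ → M.Sets} {P : α → Prop} (h : DfnAt b ρ V P)
    (ρ' : ℕ → M.Num) (V' : ℕ → M.Sets) : DfnAt b (merge ρ ρ') (merge V V') P := by
  obtain ⟨A, hA, h⟩ := h
  refine ⟨A.rename spreadLeft (2 * ·), fun hb => A.isBounded_rename (hA hb), fun v x hv => ?_⟩
  rw [holds_rename spreadLeft_injective, ← h _ _ hv.left]
  have : merge V V' ∘ (2 * ·) = V := funext fun i => merge_even V V' i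
  rw [this]

theorem DfnAt.right {b : Bool} {V' : ℕ → M.Sets} {P : α → Prop} (h : DfnAt b ρ' V' P)
    (ρ : ℕ → M.Num) (V : ℕ → M.Sets) : DfnAt b (merge ρ ρ') (merge V V') P := by
  obtain ⟨A, hA, h⟩ := h
  refine ⟨A.rename spreadRight (2 * · + 1), fun hb => A.isBounded_rename (hA hb), fun v x hv => ?_⟩
  rw [holds_rename spreadRight_injective, ← h _ _ hv.right]
  have : merge V V' ∘ (2 * · + 1) = V' := funext fun i => merge_odd V V' i
  rw [this]

end Merge

section Rules

variable {α β : Type u} [Env M α] [Env M β]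

theorem fits_prod {ρ v : ℕ → M.Num} {x : α} {a : M.Num} : Fits ρ v (x, a) ↔
    Fits ρ v x ∧ v (2 * Env.size M α) = a := by
  constructor
  · rintro ⟨h, h'⟩
    refine ⟨⟨fun i hi => ?_, h'⟩, ?_⟩
    · rw [h i (Nat.lt_succ_of_lt hi)]; exact if_neg hi.ne
    · rw [h _ (Nat.lt_succ_self _)]; exact if_pos rfl
  · rintro ⟨⟨h, h'⟩, ha⟩
    refine ⟨fun i hi => ?_, h'⟩
    rcases (Nat.lt_succ_iff_lt_or_eq.1 hi) with hi | rfl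
    · rw [h i hi]; exact (if_neg hi.ne).symm
    · rw [ha]; exact (if_pos rfl).symm

/-- Reassigning the first unused even variable amounts to appending an entry to the context; this is
the step behind every quantifier rule. -/
theorem Fits.update {ρ v : ℕ → M.Num} {x : α} (h : Fits ρ v x) (a : M.Num) :
    Fits ρ (Function.update v (2 * Env.size M α) a) (x, a) := by
  refine fits_prod.2 ⟨⟨fun i hi => ?_, fun i => ?_⟩, by simp⟩
  · rw [Function.update_of_ne (by omega), h.1 i hi]
  · rw [Function.update_of_ne (by omega), h.2 i]

variable (M) in
/-- The function `f` drops the last entries of a finite sequence. -/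
class Proj (f : α → β) : Prop where
  out : ∀ t : β → M.Num, Tm t → Tm fun x => t (f x)

instance : Proj M fun x : α => x := ⟨fun _ h => h⟩

namespace Tm

instance (priority := low) weaken {t : α → M.Num} [h : Tm t] : Tm fun y : α × M.Num => t y.1 := by
  obtain ⟨ρ, τ, h⟩ := h.out
  exact ⟨ρ, τ, fun v x hv => h v x.1 (fits_prod.1 hv).1⟩

/-- Older variables are reached through chains of first projections, which instance search unwinds
link by link. -/
instance _root_.ReverseMath.L2Structure.Proj.fst (f : α → β × M.Num) [hf : Proj M f] :
    Proj M fun x => (f x).1 :=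
  ⟨fun t ht => hf.out (fun y => t y.1) (weaken (h := ht))⟩

instance const (c : M.Num) : Tm fun _ : α => c :=
  ⟨fun _ => c, .var 1, fun _ _ hv => hv.2 0⟩

instance var0 : Tm fun y : α × M.Num => y.2 :=
  ⟨fun _ => 0, .var (2 * Env.size M α), fun _ _ hv => (fits_prod.1 hv).2⟩

instance proj (f : α → β × M.Num) [hf : Proj M f] : Tm fun y => (f y).2 :=
  hf.out _ var0

instance add (s t : α → M.Num) [hs : Tm s] [ht : Tm t] : Tm fun x => s x + t x := by
  obtain ⟨ρ, hs⟩ := hs.out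
  obtain ⟨ρ', ht⟩ := ht.out
  obtain ⟨σ, hs⟩ := hs.left ρ'
  obtain ⟨τ, ht⟩ := ht.right ρ
  exact ⟨_, .add σ τ, fun v x hv => by rw [eval, hs v x hv, ht v x hv]⟩

instance mul (s t : α → M.Num) [hs : Tm s] [ht : Tm t] : Tm fun x => s x * t x := by
  obtain ⟨ρ, hs⟩ := hs.out
  obtain ⟨ρ', ht⟩ := ht.out
  obtain ⟨σ, hs⟩ := hs.left ρ'
  obtain ⟨τ, ht⟩ := ht.right ρ
  exact ⟨_, .mul σ τ, fun v x hv => by rw [eval, hs v x hv, ht v x hv]⟩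

instance pair (s t : α → M.Num) [Tm s] [Tm t] : Tm fun x => pair (s x) (t x) := by
  unfold ReverseMath.pair; infer_instance

theorem eval {f : α → ℕ → M.Num} (hf : ∀ i, Tm fun x => f x i) :
    ∀ t : NumTerm, Tm fun x => L2Structure.eval (f x) t
  | .var i => hf i
  | .zero => Tm.const 0
  | .one => Tm.const 1
  | .add t s => @add _ _ _ _ _ (Tm.eval hf t) (Tm.eval hf s)
  | .mul t s => @mul _ _ _ _ _ (Tm.eval hf t) (Tm.eval hf s)

end Tm

variable [hM : Fact M.ModelsRCA] {b : Bool}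

namespace Dfn

instance eq (s t : α → M.Num) [hs : Tm s] [ht : Tm t] : Dfn M b fun x => s x = t x := by
  -- Only a default value for the set parameters, none of which occurs in the formula.
  obtain ⟨X⟩ := hM.out.sets_nonempty
  obtain ⟨ρ, hs⟩ := hs.out
  obtain ⟨ρ', ht⟩ := ht.out
  obtain ⟨σ, hs⟩ := hs.left ρ'
  obtain ⟨τ, ht⟩ := ht.right ρ
  exact ⟨_, fun _ => X, .eq σ τ, fun _ => trivial, fun v x hv => by
    rw [Holds, hs v x hv, ht v x hv]⟩

instance lt (s t : α → M.Num) [hs : Tm s] [ht : Tm t] : Dfn M b fun x => s x < t x := by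
  obtain ⟨X⟩ := hM.out.sets_nonempty
  obtain ⟨ρ, hs⟩ := hs.out
  obtain ⟨ρ', ht⟩ := ht.out
  obtain ⟨σ, hs⟩ := hs.left ρ'
  obtain ⟨τ, ht⟩ := ht.right ρ
  exact ⟨_, fun _ => X, .lt σ τ, fun _ => trivial, fun v x hv => by
    rw [Holds, hs v x hv, ht v x hv]⟩

instance mem (t : α → M.Num) (X : M.Sets) [ht : Tm t] : Dfn M b fun x => M.mem (t x) X := by
  obtain ⟨ρ, τ, ht⟩ := ht.out
  exact ⟨_, fun _ => X, .mem τ 0, fun _ => trivial, fun v x hv => by rw [Holds, ht v x hv]⟩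

instance not (P : α → Prop) [hP : Dfn M b P] : Dfn M b fun x => ¬ P x := by
  obtain ⟨ρ, V, A, hA, h⟩ := hP.out
  exact ⟨ρ, V, .not A, hA, fun v x hv => by rw [Holds, h v x hv]⟩

instance and (P Q : α → Prop) [hP : Dfn M b P] [hQ : Dfn M b Q] : Dfn M b fun x => P x ∧ Q x := by
  obtain ⟨ρ, V, hP⟩ := hP.out
  obtain ⟨ρ', V', hQ⟩ := hQ.out
  obtain ⟨A, hA, h⟩ := hP.left ρ' V'
  obtain ⟨B, hB, h'⟩ := hQ.right ρ V
  exact ⟨_, _, .and A B, fun hb => ⟨hA hb, hB hb⟩, fun v x hv => by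
    rw [Holds, h v x hv, h' v x hv]⟩

theorem congr {P Q : α → Prop} (hP : Dfn M b P) (h : ∀ x, Q x ↔ P x) : Dfn M b Q := by
  rwa [show Q = P from funext fun x => propext (h x)]

instance or (P Q : α → Prop) [hP : Dfn M b P] [hQ : Dfn M b Q] : Dfn M b fun x => P x ∨ Q x :=
  (inferInstance : Dfn M b fun x => ¬ (¬ P x ∧ ¬ Q x)).congr fun x => by tauto

instance imp (P Q : α → Prop) [hP : Dfn M b P] [hQ : Dfn M b Q] : Dfn M b fun x => P x → Q x :=
  (inferInstance : Dfn M b fun x => ¬ (P x ∧ ¬ Q x)).congr fun x => by tauto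

instance ne (s t : α → M.Num) [hs : Tm s] [ht : Tm t] : Dfn M b fun x => s x ≠ t x :=
  inferInstanceAs (Dfn M b fun x => ¬ (s x = t x))

/-- A proposition that does not depend on the context has a fixed truth value, so a true or a false
equation defines it. -/
instance (priority := low) prop (p : Prop) : Dfn M b fun _ : α => p := by
  by_cases hp : p
  · exact (eq (fun _ : α => (0 : M.Num)) fun _ => 0).congr fun _ => by simp [hp]
  · exact (ne (fun _ : α => (0 : M.Num)) fun _ => 0).congr fun _ => by simp [hp]

instance ball (t : α → M.Num) (P : α → M.Num → Prop) [ht : Tm t]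
    [hP : Dfn M b fun y : α × M.Num => P y.1 y.2] : Dfn M b fun x => ∀ a, a < t x → P x a := by
  obtain ⟨ρ, ht⟩ := ht.out
  obtain ⟨ρ', V, hP⟩ := hP.out
  obtain ⟨τ, ht⟩ := ht.left ρ'
  obtain ⟨A, hA, h⟩ := hP.right ρ V
  refine ⟨merge ρ ρ', merge V V, .ball (2 * Env.size M α) τ A, hA, fun v x hv => ?_⟩
  rw [Holds, ht v x hv]
  exact forall_congr' fun a => imp_congr_right fun _ => h _ _ (hv.update a)

instance all (P : α → M.Num → Prop) [hP : Dfn M false fun y : α × M.Num => P y.1 y.2] :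
    Dfn M false fun x => ∀ a, P x a := by
  obtain ⟨ρ, V, A, hA, h⟩ := hP.out
  refine ⟨ρ, V, .all (2 * Env.size M α) A, by simp, fun v x hv => ?_⟩
  rw [Holds]
  exact forall_congr' fun a => h _ _ (hv.update a)

instance ex (P : α → M.Num → Prop) [hP : Dfn M false fun y : α × M.Num => P y.1 y.2] :
    Dfn M false fun x => ∃ a, P x a :=
  (inferInstance : Dfn M false fun x => ¬ ∀ a, ¬ P x a).congr fun x => by
    simp only [not_forall, not_not]

instance bex (t : α → M.Num) (P : α → M.Num → Prop) [ht : Tm t]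
    [hP : Dfn M b fun y : α × M.Num => P y.1 y.2] : Dfn M b fun x => ∃ a, a < t x ∧ P x a :=
  (inferInstance : Dfn M b fun x => ¬ ∀ a, a < t x → ¬ P x a).congr fun _ => by
    simp only [not_forall, not_not, exists_prop]

/-- Satisfaction of a formula remains definable when arbitrary terms are put in for its variables.
This yields closure of definability under substitution, including changes of context. -/
theorem holds {V : ℕ → M.Sets} : ∀ (A : ArithFormula), (b = true → A.IsBounded) →
    ∀ {α : Type u} [Env M α] {f : α → ℕ → M.Num}, (∀ i, Tm fun x => f x i) →
      Dfn M b fun x => Holds V (f x) A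
  | .eq t s, _, _, _, f, hf => by
    have := Tm.eval hf t
    have := Tm.eval hf s
    exact eq (fun x => L2Structure.eval (f x) t) fun x => L2Structure.eval (f x) s
  | .lt t s, _, _, _, f, hf => by
    have := Tm.eval hf t
    have := Tm.eval hf s
    exact lt (fun x => L2Structure.eval (f x) t) fun x => L2Structure.eval (f x) s
  | .mem t j, _, _, _, f, hf => by
    have := Tm.eval hf t
    exact mem (fun x => L2Structure.eval (f x) t) (V j)
  | .not A, hA, _, _, f, hf => by
    have := holds (V := V) A hA hf
    exact not fun x => Holds V (f x) A
  | .and A B, hA, _, _, f, hf => by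
    have := holds (V := V) A (fun h => (hA h).1) hf
    have := holds (V := V) B (fun h => (hA h).2) hf
    exact and (fun x => Holds V (f x) A) fun x => Holds V (f x) B
  | .ball i t A, hA, α, _, f, hf => by
    have := Tm.eval hf t
    have := holds (V := V) A hA (f := fun y : α × M.Num => Function.update (f y.1) i y.2)
      fun j => by
        by_cases hj : j = i
        · subst hj; simpa using Tm.var0
        · simpa [Function.update_of_ne hj] using @Tm.weaken _ _ _ _ (hf j)
    exact ball (fun x => L2Structure.eval (f x) t)
      fun x a => Holds V (Function.update (f x) i a) A
  | .all i A, hA, α, _, f, hf => by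
    have hb : b = false := by
      cases b
      · rfl
      · exact (hA rfl).elim
    have := holds (V := V) A (by simp [hb])
      (f := fun y : α × M.Num => Function.update (f y.1) i y.2) fun j => by
        by_cases hj : j = i
        · subst hj; simpa using Tm.var0
        · simpa [Function.update_of_ne hj] using @Tm.weaken _ _ _ _ (hf j)
    subst hb
    exact all fun x a => Holds V (Function.update (f x) i a) A

/-- Substitution. -/
theorem comp {P : α → Prop} (hP : Dfn M b P) {g : β → α}
    (hg : ∀ i < Env.size M α, Tm fun y => Env.get (M := M) (g y) i) : Dfn M b fun y => P (g y) := by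
  obtain ⟨ρ, V, A, hA, h⟩ := hP.out
  let w : α → ℕ → M.Num := fun x => merge
    (fun i => if i < Env.size M α then Env.get x i else 0) ρ
  have hw : ∀ x, Fits ρ (w x) x := fun x =>
    ⟨fun i hi => by simp only [w, merge_even, if_pos hi], fun i => by simp only [w, merge_odd]⟩
  refine (holds (V := V) A hA (f := fun y => w (g y)) fun i => ?_).congr
    fun y => (h _ _ (hw (g y))).symm
  simp only [w, merge]
  split_ifs with h1 h2
  · exact hg _ h2
  · exact Tm.const _
  · exact Tm.const _

theorem comp1 {P : M.Num → Prop} (hP : Dfn M b fun y : PUnit.{u + 1} × M.Num => P y.2)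
    (s : β → M.Num) [hs : Tm s] : Dfn M b fun y => P (s y) :=
  hP.comp (g := fun y => (PUnit.unit, s y)) fun i hi => by
    obtain rfl : i = 0 := Nat.lt_one_iff.1 hi
    exact hs

theorem comp2 {P : M.Num → M.Num → Prop}
    (hP : Dfn M b fun y : (PUnit.{u + 1} × M.Num) × M.Num => P y.1.2 y.2)
    (s t : β → M.Num) [hs : Tm s] [ht : Tm t] : Dfn M b fun y => P (s y) (t y) :=
  hP.comp (g := fun y => ((PUnit.unit, s y), t y)) fun i hi => by
    obtain rfl | rfl : i = 0 ∨ i = 1 := by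
      have : i < 2 := hi
      omega
    · exact hs
    · exact ht

end Dfn

end Rules

variable [hM : Fact M.ModelsRCA]

variable (M) in
/-- One number variable. -/
abbrev Ctx1 : Type u := PUnit.{u + 1} × M.Num

variable (M) in
/-- Two number variables. -/
abbrev Ctx2 : Type u := (PUnit.{u + 1} × M.Num) × M.Num

/-- `Σ⁰₁` induction. -/
theorem sigma_ind {P : M.Num → M.Num → Prop} (hP : Dfn M true fun y : Ctx2 M => P y.1.2 y.2)
    (h0 : ∃ a, P 0 a) (hs : ∀ n, (∃ a, P n a) → ∃ a, P (n + 1) a) (n : M.Num) : ∃ a, P n a := by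
  obtain ⟨ρ, V, A, hA, h⟩ := hP.out
  let v : ℕ → M.Num := merge (fun _ => 0) ρ
  -- The two entries of the context are the even variables 0 and 2.
  have key : ∀ n a, Holds V (Function.update (Function.update v 0 n) 2 a) A ↔ P n a := by
    intro n a
    refine h _ ((PUnit.unit, n), a) (Fits.update (α := Ctx1 M) (Fits.update (α := PUnit)
      ⟨fun i hi => absurd hi (Nat.not_lt_zero i), fun i => ?_⟩ n) a)
    exact merge_odd _ _ _
  have := hM.out.sigma_induction A (hA rfl) V v 0 2
  simp only [key] at this
  exact this h0 hs n

/-- `Δ⁰₁` comprehension. -/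
theorem delta_comp {P Q : M.Num → M.Num → Prop} (hP : Dfn M true fun y : Ctx2 M => P y.1.2 y.2)
    (hQ : Dfn M true fun y : Ctx2 M => Q y.1.2 y.2) (hPQ : ∀ n, (∃ a, P n a) ↔ ∀ a, Q n a) :
    ∃ X : M.Sets, ∀ n, M.mem n X ↔ ∃ a, P n a := by
  obtain ⟨ρ, V, hP⟩ := hP.out
  obtain ⟨ρ', V', hQ⟩ := hQ.out
  obtain ⟨A, hA, h⟩ := hP.left ρ' V'
  obtain ⟨B, hB, h'⟩ := hQ.right ρ V
  let v : ℕ → M.Num := merge (fun _ => 0) (merge ρ ρ')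
  have hv : ∀ n a, Fits (merge ρ ρ') (Function.update (Function.update v 0 n) 2 a)
      (((PUnit.unit, n), a) : Ctx2 M) := fun n a =>
    Fits.update (α := Ctx1 M) (Fits.update (α := PUnit)
      ⟨fun i hi => absurd hi (Nat.not_lt_zero i), fun i => merge_odd _ _ _⟩ n) a
  have := hM.out.delta_comprehension A B (hA rfl) (hB rfl) (merge V V') v 0 2 2
  simp only [fun n a => h _ _ (hv n a), fun n a => h' _ _ (hv n a)] at this
  exact this hPQ

/-- Arithmetical comprehension. -/
theorem ACA.comp (h : M.ACA) {P : M.Num → Prop} (hP : Dfn M false fun y : Ctx1 M => P y.2) :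
    ∃ X : M.Sets, ∀ n, M.mem n X ↔ P n := by
  obtain ⟨ρ, V, A, hA, h'⟩ := hP.out
  obtain ⟨X, hX⟩ := h A V (merge (fun _ => 0) ρ) 0
  refine ⟨X, fun n => (hX n).trans (h' _ (PUnit.unit, n) (Fits.update (α := PUnit)
      ⟨fun i hi => absurd hi (Nat.not_lt_zero i), fun i => merge_odd _ _ _⟩ n))⟩

/-- Bounded comprehension. -/
theorem bdd_comp {P : M.Num → Prop} (hP : Dfn M true fun y : Ctx1 M => P y.2) :
    ∃ X : M.Sets, ∀ n, M.mem n X ↔ P n := by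
  have h := hP.comp1 (fun y : Ctx2 M => y.1.2)
  obtain ⟨X, hX⟩ := delta_comp (P := fun n _ => P n) (Q := fun n _ => P n) h h
    fun n => by simp
  exact ⟨X, fun n => by simp [hX]⟩

/-- Bounded induction. -/
theorem bdd_ind {P : M.Num → Prop} (hP : Dfn M true fun y : Ctx1 M => P y.2)
    (h0 : P 0) (hs : ∀ n, P n → P (n + 1)) (n : M.Num) : P n := by
  have := sigma_ind (P := fun n _ => P n) (hP.comp1 (fun y : Ctx2 M => y.1.2)) ⟨0, h0⟩ (by simpa using hs) n
  simpa using this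

/-- The least number principle for bounded formulas. -/
theorem bdd_least {P : M.Num → Prop} (hP : Dfn M true fun y : Ctx1 M => P y.2) {n : M.Num}
    (hn : P n) : ∃ m, P m ∧ ∀ k, k < m → ¬ P k := by
  have hP' := hP.comp1 (fun y : Ctx2 M => y.2)
  have hP'' := hP.comp1 (fun y : Ctx2 M × M.Num => y.2)
  have key := bdd_ind
    (P := fun n => (∃ k, k < n ∧ P k) → ∃ k, k < n ∧ (P k ∧ ∀ j, j < k → ¬ P j))
    inferInstance (by simp [hM.out.not_lt_zero]) (fun n ih => ?_) (n + 1)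
  · obtain ⟨k, -, hk⟩ := key ⟨n, (hM.out.lt_succ n n).2 (Or.inr rfl), hn⟩
    exact ⟨k, hk⟩
  · rintro ⟨k, hk, hPk⟩
    by_cases h : ∃ k, k < n ∧ P k
    · obtain ⟨k, h1, h2⟩ := ih h
      exact ⟨k, (hM.out.lt_succ _ _).2 (Or.inl h1), h2⟩
    · rcases (hM.out.lt_succ _ _).1 hk with hk | rfl
      · exact absurd ⟨k, hk, hPk⟩ h
      · exact ⟨k, (hM.out.lt_succ _ _).2 (Or.inr rfl), hPk, fun j hj hPj => h ⟨j, hj, hPj⟩⟩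

end L2Structure

end ReverseMath

/-! ### Elementary arithmetic from Σ⁰₁ induction -/

namespace ReverseMath

namespace L2Structure

variable {M : L2Structure.{u, v}} [hM : Fact M.ModelsRCA]

namespace Peano

theorem zero_add (n : M.Num) : 0 + n = n :=
  bdd_ind (P := fun n => 0 + n = n) inferInstance (hM.out.add_zero 0)
    (fun n ih => by rw [hM.out.add_succ, ih]) n

theorem succ_add (m n : M.Num) : m + 1 + n = m + n + 1 :=
  bdd_ind (P := fun n => m + 1 + n = m + n + 1) inferInstance
    (by rw [hM.out.add_zero, hM.out.add_zero])
    (fun n ih => by rw [hM.out.add_succ, ih, hM.out.add_succ]) n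

theorem add_comm (m n : M.Num) : m + n = n + m :=
  bdd_ind (P := fun n => m + n = n + m) inferInstance (by rw [hM.out.add_zero, zero_add])
    (fun n ih => by rw [hM.out.add_succ, ih, succ_add]) n

theorem add_assoc (l m n : M.Num) : l + m + n = l + (m + n) :=
  bdd_ind (P := fun n => l + m + n = l + (m + n)) inferInstance
    (by rw [hM.out.add_zero, hM.out.add_zero])
    (fun n ih => by rw [hM.out.add_succ, ih, hM.out.add_succ, hM.out.add_succ]) n

theorem add_right_cancel {l m n : M.Num} : l + n = m + n → l = m :=
  bdd_ind (P := fun n => l + n = m + n → l = m) inferInstance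
    (by rw [hM.out.add_zero, hM.out.add_zero]; exact id)
    (fun n ih h => by
      rw [hM.out.add_succ, hM.out.add_succ] at h; exact ih (hM.out.succ_inj _ _ h)) n

theorem zero_mul (n : M.Num) : 0 * n = 0 :=
  bdd_ind (P := fun n => 0 * n = 0) inferInstance (hM.out.mul_zero 0)
    (fun n ih => by rw [hM.out.mul_succ, ih, hM.out.add_zero]) n

theorem succ_mul (m n : M.Num) : (m + 1) * n = m * n + n :=
  bdd_ind (P := fun n => (m + 1) * n = m * n + n) inferInstance
    (by rw [hM.out.mul_zero, hM.out.mul_zero, hM.out.add_zero])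
    (fun n ih => by
      rw [hM.out.mul_succ, ih, hM.out.mul_succ, hM.out.add_succ, hM.out.add_succ,
        add_assoc (m * n) n m, add_comm n m, ← add_assoc]) n

theorem mul_comm (m n : M.Num) : m * n = n * m :=
  bdd_ind (P := fun n => m * n = n * m) inferInstance (by rw [hM.out.mul_zero, zero_mul])
    (fun n ih => by rw [hM.out.mul_succ, ih, succ_mul]) n

theorem mul_add (l m n : M.Num) : l * (m + n) = l * m + l * n :=
  bdd_ind (P := fun n => l * (m + n) = l * m + l * n) inferInstance
    (by rw [hM.out.add_zero, hM.out.mul_zero, hM.out.add_zero])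
    (fun n ih => by
      rw [hM.out.add_succ, hM.out.mul_succ, ih, hM.out.mul_succ, add_assoc]) n

theorem mul_assoc (l m n : M.Num) : l * m * n = l * (m * n) :=
  bdd_ind (P := fun n => l * m * n = l * (m * n)) inferInstance
    (by rw [hM.out.mul_zero, hM.out.mul_zero, hM.out.mul_zero])
    (fun n ih => by rw [hM.out.mul_succ, ih, hM.out.mul_succ, mul_add]) n

theorem mul_one (n : M.Num) : n * 1 = n := by
  rw [← zero_add (1 : M.Num), hM.out.mul_succ, hM.out.mul_zero, zero_add]

theorem eq_zero_or_succ (n : M.Num) : n = 0 ∨ ∃ m, n = m + 1 := by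
  obtain ⟨m, h⟩ := sigma_ind (P := fun n m => n = 0 ∨ n = m + 1) inferInstance ⟨0, Or.inl rfl⟩
    (fun n _ => ⟨n, Or.inr rfl⟩) n
  exact h.imp_right fun h => ⟨m, h⟩

/-- The axioms describe < only at 0 and at successors; expressing it by addition makes the laws of
order consequences of those of addition and multiplication. -/
theorem lt_iff {a b : M.Num} : a < b ↔ ∃ c, b = a + c + 1 := by
  constructor
  · obtain ⟨c, h⟩ := sigma_ind (P := fun b c => a < b → b = a + c + 1) inferInstance
      ⟨0, fun h => absurd h (hM.out.not_lt_zero a)⟩ (fun b ih => by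
        obtain ⟨c, hc⟩ := ih
        by_cases h : a < b
        · exact ⟨c + 1, fun _ => by rw [hM.out.add_succ, ← hc h]⟩
        · refine ⟨0, fun h' => ?_⟩
          rcases (hM.out.lt_succ a b).1 h' with h' | rfl
          · exact absurd h' h
          · rw [hM.out.add_zero]) b
    exact fun h' => ⟨c, h h'⟩
  · rintro ⟨c, rfl⟩
    refine bdd_ind (P := fun c => a < a + c + 1) inferInstance ?_ (fun c ih => ?_) c
    · rw [hM.out.add_zero]; exact (hM.out.lt_succ _ _).2 (Or.inr rfl)
    · rw [hM.out.add_succ]; exact (hM.out.lt_succ _ _).2 (Or.inl ih)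

theorem lt_irrefl (a : M.Num) : ¬ a < a := by
  intro h
  obtain ⟨c, h⟩ := lt_iff.1 h
  rw [add_assoc] at h
  have : 0 + a = c + 1 + a := by rw [zero_add, add_comm (c + 1)]; exact h
  exact hM.out.succ_ne_zero c (add_right_cancel this).symm

theorem lt_trichotomy (a b : M.Num) : a < b ∨ a = b ∨ b < a := by
  refine bdd_ind (P := fun b => a < b ∨ a = b ∨ b < a) inferInstance ?_ (fun b ih => ?_) b
  · rcases eq_zero_or_succ a with rfl | ⟨m, rfl⟩
    · exact Or.inr (Or.inl rfl)
    · exact Or.inr (Or.inr (lt_iff.2 ⟨m, by rw [zero_add]⟩))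
  · rcases ih with h | rfl | h
    · exact Or.inl ((hM.out.lt_succ _ _).2 (Or.inl h))
    · exact Or.inl ((hM.out.lt_succ _ _).2 (Or.inr rfl))
    · obtain ⟨c, rfl⟩ := lt_iff.1 h
      rcases eq_zero_or_succ c with rfl | ⟨c, rfl⟩
      · rw [hM.out.add_zero]; exact Or.inr (Or.inl rfl)
      · refine Or.inr (Or.inr (lt_iff.2 ⟨c, ?_⟩))
        rw [hM.out.add_succ, succ_add b c]

end Peano

open Peano in
instance : OrderedArith M.Num where
  add_assoc := add_assoc
  add_comm := add_comm
  add_zero := hM.out.add_zero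
  mul_assoc := mul_assoc
  mul_comm := mul_comm
  mul_one := mul_one
  mul_zero := hM.out.mul_zero
  mul_add := mul_add
  lt_irrefl := lt_irrefl
  lt_trans a b c h h' := by
    obtain ⟨d, rfl⟩ := lt_iff.1 h
    obtain ⟨e, rfl⟩ := lt_iff.1 h'
    refine lt_iff.2 ⟨d + 1 + e, ?_⟩
    rw [← Peano.add_assoc a (d + 1) e, ← Peano.add_assoc a d 1]
  lt_trichotomy := lt_trichotomy
  add_lt_add a b c h := by
    obtain ⟨d, rfl⟩ := lt_iff.1 h
    refine lt_iff.2 ⟨d, ?_⟩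
    rw [Peano.succ_add, Peano.add_assoc a d c, Peano.add_comm d c, ← Peano.add_assoc]
  mul_lt_mul a b c h hc := by
    obtain ⟨d, rfl⟩ := lt_iff.1 h
    obtain ⟨e, rfl⟩ := lt_iff.1 hc
    refine lt_iff.2 ⟨d * (0 + e + 1) + e, ?_⟩
    rw [Peano.succ_mul, Peano.mul_comm _ (0 + e + 1), Peano.mul_add, Peano.mul_comm _ a,
      Peano.mul_comm _ d, Peano.zero_add e, Peano.add_assoc, ← Peano.add_assoc (d * _),
      ← Peano.add_assoc (a * _)]
  exists_add a b h := by
    obtain ⟨d, rfl⟩ := lt_iff.1 h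
    exact ⟨d + 1, (Peano.add_assoc _ _ _).symm⟩
  not_lt_zero := hM.out.not_lt_zero
  zero_lt_one := lt_iff.2 ⟨0, by rw [Peano.zero_add, Peano.zero_add]⟩
  discrete a h := by
    obtain ⟨c, rfl⟩ := lt_iff.1 h
    rw [Peano.zero_add]
    rcases eq_zero_or_succ c with rfl | ⟨c, rfl⟩
    · exact Or.inl (Peano.zero_add 1)
    · exact Or.inr (lt_iff.2 ⟨c, by rw [Peano.add_comm c]⟩)

section Rules

variable {α : Type u} [Env M α] {b : Bool}

namespace Dfn

instance le (s t : α → M.Num) [Tm s] [Tm t] : Dfn M b fun x => s x ≤ t x :=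
  (inferInstance : Dfn M b fun x => ¬ t x < s x).congr fun _ => not_lt.symm

instance ball_le (t : α → M.Num) (P : α → M.Num → Prop) [Tm t]
    [Dfn M b fun y : α × M.Num => P y.1 y.2] : Dfn M b fun x => ∀ a, a ≤ t x → P x a :=
  (inferInstance : Dfn M b fun x => ∀ a, a < t x + 1 → P x a).congr fun _ => by
    simp only [lt_add_one_iff]

instance bex_le (t : α → M.Num) (P : α → M.Num → Prop) [Tm t]
    [Dfn M b fun y : α × M.Num => P y.1 y.2] : Dfn M b fun x => ∃ a, a ≤ t x ∧ P x a :=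
  (inferInstance : Dfn M b fun x => ∃ a, a < t x + 1 ∧ P x a).congr fun _ => by
    simp only [lt_add_one_iff]

/-- A bound on the quotient makes divisibility a bounded formula; for a = 0 the quotient has to be
replaced by 0. -/
theorem exists_dvd_iff {a b : M.Num} : a ∣ b ↔ ∃ c, c ≤ b ∧ b = a * c := by
  constructor
  · rintro ⟨c, rfl⟩
    rcases eq_zero_or_pos a with rfl | h
    · exact ⟨0, by simp, by simp⟩
    · exact ⟨c, le_mul_of_one_le_left zero_le
        (by rw [← _root_.zero_add (1 : M.Num), add_one_le_iff]; exact h), rfl⟩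
  · rintro ⟨c, -, rfl⟩
    exact dvd_mul_right _ _

instance dvd (s t : α → M.Num) [Tm s] [Tm t] : Dfn M b fun x => s x ∣ t x :=
  (inferInstance : Dfn M b fun x => ∃ c, c ≤ t x ∧ t x = s x * c).congr fun _ => exists_dvd_iff

end Dfn

end Rules

/-- `Π⁰₁` induction. -/
theorem pi_ind {P : M.Num → M.Num → Prop} (hP : Dfn M true fun y : Ctx2 M => P y.1.2 y.2)
    (h0 : ∀ a, P 0 a) (hs : ∀ n, (∀ a, P n a) → ∀ a, P (n + 1) a) (n a : M.Num) : P n a := by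
  by_contra hna
  have hP' := hP.comp2 (fun y : Ctx2 M × M.Num => y.2) (fun y => y.1.2)
  -- Σ⁰₁ induction on i pushes a counterexample at n down to one at the number k with k + i = n; at
  -- i = n it would be one at 0.
  obtain ⟨a', h⟩ := sigma_ind
    (P := fun i a => i ≤ n → ∃ k, k ≤ n ∧ (k + i = n ∧ ¬ P k a)) inferInstance
    ⟨a, fun _ => ⟨n, le_rfl, add_zero n, hna⟩⟩ (fun i ih => by
      obtain ⟨a, ha⟩ := ih
      by_cases hi : i + 1 ≤ n
      · obtain ⟨k, -, h1, h2⟩ := ha ((le_self_add).trans hi)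
        rcases Peano.eq_zero_or_succ k with rfl | ⟨k, rfl⟩
        · exact absurd (h0 a) h2
        · have : ∃ a, ¬ P k a := by
            by_contra! h
            exact h2 (hs k h a)
          obtain ⟨a', ha'⟩ := this
          refine ⟨a', fun _ => ⟨k, ?_, ?_, ha'⟩⟩
          · rw [← h1, add_assoc]; exact le_self_add
          · rw [← h1]; ring
      · exact ⟨0, fun h => absurd h hi⟩) n
  obtain ⟨k, -, h1, h2⟩ := h le_rfl
  have : k = 0 := by
    have : k + n = 0 + n := by rw [h1, zero_add]
    exact add_right_cancel this
  exact h2 (this ▸ h0 a')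

/-! ### Codes of bounded sets -/

theorem dvd_of_mul_add_eq {a c s t : M.Num} (ha : 0 < a) (h : a * s + c = a * t) : a ∣ c := by
  have hst : s ≤ t := by
    refine le_of_mul_le_mul_left ?_ ha
    rw [← h]; exact le_self_add
  obtain ⟨r, rfl⟩ := exists_add_of_le hst
  rw [mul_add] at h
  exact ⟨r, add_left_cancel h⟩

/-- The witness is a factorial. No recursion theorem is available yet, so Σ⁰₁ induction asserts its
existence. -/
theorem exists_multiple (n : M.Num) : ∃ d : M.Num, 0 < d ∧ ∀ i, i < n → i + 1 ∣ d := by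
  refine sigma_ind (P := fun n d => 0 < d ∧ ∀ i, i < n → i + 1 ∣ d) inferInstance
    ⟨1, zero_lt_one, fun i hi => absurd hi not_lt_zero⟩ (fun n ih => ?_) n
  obtain ⟨d, hd, h⟩ := ih
  refine ⟨d * (n + 1), mul_pos hd (lt_of_lt_of_le zero_lt_one le_add_self), fun i hi => ?_⟩
  rcases (lt_add_one_iff.1 hi).lt_or_eq with hi | rfl
  · exact (h i hi).mul_right _
  · exact dvd_mul_left _ _

/-- The modulus that represents membership of `x`. -/
def modulus (d x : M.Num) : M.Num := (x + 1) * d + 1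

theorem modulus_pos (d x : M.Num) : 0 < modulus d x := lt_of_lt_of_le zero_lt_one le_add_self

instance {α : Type u} [Env M α] (s t : α → M.Num) [Tm s] [Tm t] :
    Tm fun x => modulus (s x) (t x) := by
  unfold modulus; infer_instance

/-- As for Gödel's β function, put m_x = (x + 1) d + 1. Then (x + 1) m_y - (y + 1) m_x = x - y, and
|x - y| divides d. With d = q |x - y|, elimination of d gives 1 = m_x (1 ∓ q (x + 1)(y + 1)) ± q (x
+ 1)² m_y, with the upper signs if x < y. Multiplied by c and rearranged without subtraction, this
identity supplies s and t. -/
theorem modulus_coprime {n d x y c : M.Num} (hd : ∀ i, i < n → i + 1 ∣ d) (hx : x < n)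
    (hy : y < n) (hxy : x ≠ y) (h : modulus d x ∣ modulus d y * c) : modulus d x ∣ c := by
  obtain ⟨e, he⟩ := h
  rcases lt_or_gt_of_ne hxy with h | h
  · obtain ⟨k, rfl⟩ := Peano.lt_iff.1 h
    obtain ⟨q, hq⟩ := hd k ((lt_add_one_iff.2 le_add_self).trans hy)
    refine dvd_of_mul_add_eq (s := q * (x + 1) * (x + k + 1 + 1) * c)
      (t := q * (x + 1) * (x + 1) * e + c) (modulus_pos _ _) ?_
    rw [mul_add (modulus d x) (q * (x + 1) * (x + 1) * e) c, show modulus d x * (q * (x + 1) * (x + 1) * e) =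
      q * (x + 1) * (x + 1) * (modulus d x * e) by ring, ← he]
    simp only [modulus, hq]
    ring
  · obtain ⟨k, rfl⟩ := Peano.lt_iff.1 h
    obtain ⟨q, hq⟩ := hd k ((lt_add_one_iff.2 le_add_self).trans hx)
    refine dvd_of_mul_add_eq (t := q * (y + k + 1 + 1) * (y + 1) * c + c)
      (s := q * (y + k + 1 + 1) * (y + k + 1 + 1) * e) (modulus_pos _ _) ?_
    rw [show modulus d (y + k + 1) * (q * (y + k + 1 + 1) * (y + k + 1 + 1) * e) =
      q * (y + k + 1 + 1) * (y + k + 1 + 1) * (modulus d (y + k + 1) * e) by ring, ← he]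
    simp only [modulus, hq]
    ring

/-- All these moduli are at most n d + 1, so a common multiple of 1, …, n d + 1 serves. -/
theorem exists_common_multiple (n d : M.Num) :
    ∃ c : M.Num, 0 < c ∧ ∀ x, x < n → modulus d x ∣ c := by
  obtain ⟨c, hc, h⟩ := exists_multiple (n * d + 1)
  refine ⟨c, hc, fun x hx => h _ ?_⟩
  rw [lt_add_one_iff]
  exact mul_le_mul_left (add_one_le_iff.2 hx) d

/-- The least common multiple of the moduli of the elements of `P` has no further moduli as
divisors. -/
theorem modulus_dvd_least {n d c : M.Num} {P : M.Num → Prop} (hd0 : 0 < d)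
    (hd : ∀ i, i < n → i + 1 ∣ d) (hc : 0 < c ∧ ∀ x, x < n → P x → modulus d x ∣ c)
    (hmin : ∀ c', c' < c → ¬ (0 < c' ∧ ∀ x, x < n → P x → modulus d x ∣ c'))
    {x : M.Num} (hx : x < n) : modulus d x ∣ c ↔ P x := by
  refine ⟨fun h => ?_, hc.2 x hx⟩
  by_contra hPx
  -- A modulus outside P could be divided out: by coprimality the quotient is still a multiple of
  -- the moduli of P, contrary to minimality.
  obtain ⟨c', rfl⟩ := h
  have hc' : 0 < c' := pos_of_mul_pos_right hc.1 zero_le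
  refine hmin c' ?_ ⟨hc', fun y hy hPy => ?_⟩
  · refine lt_mul_of_one_lt_left hc' ?_
    unfold modulus
    exact lt_add_of_pos_left _ (mul_pos (lt_of_lt_of_le zero_lt_one le_add_self) hd0)
  · exact modulus_coprime hd hy hx (fun h => hPx (h ▸ hPy)) (hc.2 y hy hPy)

/-- Two numbers code the part of P below n. For bounded P, being a common multiple of the moduli of
P is a bounded condition, so a least such c exists. -/
theorem exists_code {P : M.Num → Prop} (hP : Dfn M true fun y : Ctx1 M => P y.2) (n : M.Num) :
    ∃ d c : M.Num, ∀ x, x < n → (modulus d x ∣ c ↔ P x) := by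
  obtain ⟨d, hd0, hd⟩ := exists_multiple n
  obtain ⟨c, hc0, hc⟩ := exists_common_multiple n d
  have hP' := hP.comp1 (fun y : Ctx2 M => y.2)
  obtain ⟨c, h1, h2⟩ := bdd_least
    (P := fun c => 0 < c ∧ ∀ x, x < n → P x → modulus d x ∣ c) inferInstance (n := c)
    ⟨hc0, fun x hx _ => hc x hx⟩
  exact ⟨d, c, fun x hx => modulus_dvd_least hd0 hd h1 h2 hx⟩

/-! ### Powers of two -/

/-- The numbers `d`, `c`, `l` code a set of pairs `(i, 2 ^ i)`. -/
def TwoPowCode (l d c : M.Num) : Prop :=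
  ∀ x, x < l → modulus d x ∣ c → x = pair 0 1 ∨ ∃ i, i < l ∧ ∃ f, f < l ∧
    (x = pair (i + 1) (f + f) ∧ (pair i f < l ∧ modulus d (pair i f) ∣ c))

/-- The number `t` bounds a code of a set of pairs `(i, 2 ^ i)` to which `(n, e)` belongs. -/
def TwoPowWitness (n e t : M.Num) : Prop :=
  ∃ l, l < t ∧ ∃ d, d < t ∧ ∃ c, c < t ∧
    (TwoPowCode l d c ∧ (pair n e < l ∧ modulus d (pair n e) ∣ c))

set_option synthInstance.maxSize 1000 in
instance {α : Type u} [Env M α] (r s t : α → M.Num) [Tm r] [Tm s] [Tm t] :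
    Dfn M true fun x => TwoPowWitness (r x) (s x) (t x) := by
  have h : Dfn M true fun y : ((PUnit.{u + 1} × M.Num) × M.Num) × M.Num =>
      TwoPowWitness y.1.1.2 y.1.2 y.2 := by
    unfold TwoPowWitness TwoPowCode; infer_instance
  exact h.comp (g := fun y => (((PUnit.unit, r y), s y), t y)) fun i hi => by
    obtain rfl | rfl | rfl : i = 0 ∨ i = 1 ∨ i = 2 := by
      have : i < 3 := hi
      omega
    · exact inferInstanceAs (Tm r)
    · exact inferInstanceAs (Tm s)
    · exact inferInstanceAs (Tm t)

end L2Structure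

end ReverseMath

/-! ### Existence and uniqueness of powers of two -/

namespace ReverseMath

namespace L2Structure

variable {M : L2Structure.{u, v}} [hM : Fact M.ModelsRCA]

/-- A code contains a positive pair only together with its predecessor, so induction on n compares
two codes. The bounds l and l' on the values keep the induction formula bounded. -/
theorem TwoPowCode.unique {l d c l' d' c' : M.Num} (h : TwoPowCode l d c)
    (h' : TwoPowCode l' d' c') (n : M.Num) : ∀ e, e < l → ∀ e', e' < l' →
      (pair n e < l ∧ modulus d (pair n e) ∣ c) →
      (pair n e' < l' ∧ modulus d' (pair n e') ∣ c') → e = e' := by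
  refine bdd_ind (P := fun n => ∀ e, e < l → ∀ e', e' < l' →
      (pair n e < l ∧ modulus d (pair n e) ∣ c) →
      (pair n e' < l' ∧ modulus d' (pair n e') ∣ c') → e = e') inferInstance ?_ (fun n ih => ?_) n
  · have key : ∀ {l d c e : M.Num}, TwoPowCode l d c →
        (pair 0 e < l ∧ modulus d (pair 0 e) ∣ c) → e = 1 := by
      intro l d c e h he
      rcases h _ he.1 he.2 with h | ⟨i, -, f, -, h, -⟩
      · exact (pair_inj.1 h).2
      · exact absurd (pair_inj.1 h).1.symm (hM.out.succ_ne_zero i)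
    intro e _ e' _ he he'
    rw [key h he, key h' he']
  · have key : ∀ {l d c e : M.Num}, TwoPowCode l d c →
        (pair (n + 1) e < l ∧ modulus d (pair (n + 1) e) ∣ c) → ∃ f, f < l ∧ e = f + f ∧
          (pair n f < l ∧ modulus d (pair n f) ∣ c) := by
      intro l d c e h he
      rcases h _ he.1 he.2 with h | ⟨i, -, f, hf, h, h'⟩
      · exact absurd (pair_inj.1 h).1 (hM.out.succ_ne_zero n)
      · obtain ⟨h1, rfl⟩ := pair_inj.1 h
        obtain rfl := hM.out.succ_inj _ _ h1
        exact ⟨f, hf, rfl, h'⟩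
    intro e _ e' _ he he'
    obtain ⟨f, hf, rfl, h1⟩ := key h he
    obtain ⟨f', hf', rfl, h2⟩ := key h' he'
    rw [ih f hf f' hf' h1 h2]

theorem TwoPowWitness.unique {n e t e' t' : M.Num} (h : TwoPowWitness n e t)
    (h' : TwoPowWitness n e' t') : e = e' := by
  obtain ⟨l, -, d, -, c, -, h1, h2⟩ := h
  obtain ⟨l', -, d', -, c', -, h1', h2'⟩ := h'
  exact h1.unique h1' n e ((le_pair_right _ _).trans_lt h2.1) e'
    ((le_pair_right _ _).trans_lt h2'.1) h2 h2'

/-- A definable set that contains the last pair and is closed under predecessors gives a code. -/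
theorem exists_twoPowWitness {n e : M.Num} {P : M.Num → Prop} (l : M.Num)
    (hP : Dfn M true fun y : Ctx1 M => P y.2) (hl : ∀ x, P x → x < l)
    (h : ∀ x, P x → x = pair 0 1 ∨ ∃ i f, x = pair (i + 1) (f + f) ∧ P (pair i f))
    (hne : P (pair n e)) : ∃ t, TwoPowWitness n e t := by
  obtain ⟨d, c, hdc⟩ := exists_code hP l
  refine ⟨l + d + c + 1, l, ?_, d, ?_, c, ?_, fun x hx hxc => ?_, hl _ hne,
    (hdc _ (hl _ hne)).2 hne⟩
  · exact lt_add_one_iff.2 (le_self_add.trans le_self_add)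
  · exact lt_add_one_iff.2 (le_add_self.trans le_self_add)
  · exact lt_add_one_iff.2 le_add_self
  · refine (h x ((hdc x hx).1 hxc)).imp_right ?_
    rintro ⟨i, f, h1, h2⟩
    have h3 := hl _ h2
    exact ⟨i, (le_pair_left i f).trans_lt h3, f, (le_pair_right i f).trans_lt h3, h1, h3,
      (hdc _ h3).2 h2⟩

theorem exists_twoPowWitness_zero : ∃ t : M.Num, TwoPowWitness 0 1 t :=
  exists_twoPowWitness (P := fun x => x = pair 0 1) (pair 0 1 + 1) inferInstance
    (fun x hx => hx ▸ lt_add_one_iff.2 le_rfl) (fun _ hx => Or.inl hx) rfl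

theorem exists_twoPowWitness_succ {n e t : M.Num} (h : TwoPowWitness n e t) :
    ∃ t, TwoPowWitness (n + 1) (e + e) t := by
  obtain ⟨l, -, d, -, c, -, h1, h2⟩ := h
  refine exists_twoPowWitness
    (P := fun x => (x < l ∧ modulus d x ∣ c) ∨ x = pair (n + 1) (e + e))
    (l + pair (n + 1) (e + e) + 1) inferInstance ?_ ?_ (Or.inr rfl)
  · rintro x (⟨hx, -⟩ | rfl)
    · exact hx.trans (lt_add_one_iff.2 le_self_add)
    · exact lt_add_one_iff.2 le_add_self
  · rintro x (⟨hx, hx'⟩ | rfl)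
    · refine (h1 x hx hx').imp_right ?_
      rintro ⟨i, -, f, -, h3, h4⟩
      exact ⟨i, f, h3, Or.inl h4⟩
    · exact Or.inr ⟨n, e, rfl, Or.inl h2⟩

theorem exists_twoPow (n : M.Num) : ∃ e t, TwoPowWitness n e t := by
  obtain ⟨t, e, -, h⟩ := sigma_ind (P := fun n t => ∃ e, e ≤ t ∧ ∃ s, s ≤ t ∧ TwoPowWitness n e s)
    inferInstance (by
      obtain ⟨t, ht⟩ := exists_twoPowWitness_zero (M := M)
      exact ⟨1 + t, 1, le_self_add, t, le_add_self, ht⟩) (fun n ih => by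
      obtain ⟨_, e, -, s, -, h⟩ := ih
      obtain ⟨t, ht⟩ := exists_twoPowWitness_succ h
      exact ⟨e + e + t, e + e, le_self_add, t, le_add_self, ht⟩) n
  exact ⟨e, h.imp fun _ h => h.2⟩

-- Because powers are unique, "some code contains (n, e)" is equivalent to "every value coded for n
-- equals e". The first form is Σ⁰₁ and the second Π⁰₁, so Δ⁰₁ comprehension applies.
variable (M) in
theorem exists_twoPowGraph : ∃ X : M.Sets, M.IsTwoPowGraph X := by
  obtain ⟨X, hX⟩ := delta_comp
    (P := fun m t : M.Num => ∃ n, n ≤ m ∧ ∃ e, e ≤ m ∧ (m = pair n e ∧ TwoPowWitness n e t))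
    (Q := fun m t : M.Num => ∃ n, n ≤ m ∧ ∃ e, e ≤ m ∧ (m = pair n e ∧
      ∀ e', e' ≤ t → ∀ s, s ≤ t → TwoPowWitness n e' s → e' = e))
    inferInstance inferInstance fun m => by
      constructor
      · rintro ⟨t, n, hn, e, he, rfl, h⟩ t'
        exact ⟨n, hn, e, he, rfl, fun e' _ s _ h' => h'.unique h⟩
      · intro h
        obtain ⟨n, hn, e, he, rfl, -⟩ := h 0
        obtain ⟨e', t, h'⟩ := exists_twoPow n
        obtain ⟨n', -, e'', -, h1, h2⟩ := h (e' + t)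
        obtain ⟨rfl, rfl⟩ := pair_inj.1 h1
        obtain rfl := h2 e' le_self_add t le_add_self h'
        exact ⟨t, n, hn, e', he, rfl, h'⟩
  have key : ∀ n e, M.mem (pair n e) X ↔ ∃ t, TwoPowWitness n e t := by
    intro n e
    rw [hX]
    constructor
    · rintro ⟨t, n', -, e', -, h1, h2⟩
      obtain ⟨rfl, rfl⟩ := pair_inj.1 h1
      exact ⟨t, h2⟩
    · rintro ⟨t, h⟩
      exact ⟨t, n, le_pair_left _ _, e, le_pair_right _ _, rfl, h⟩
  refine ⟨X, fun e => (key 0 e).trans ?_, fun n e => (key (n + 1) e).trans ?_⟩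
  · obtain ⟨t, ht⟩ := exists_twoPowWitness_zero (M := M)
    exact ⟨fun ⟨t', h⟩ => h.unique ht, fun h => ⟨t, by rw [show e = 1 from h]; exact ht⟩⟩
  · obtain ⟨d, t, hd⟩ := exists_twoPow n
    obtain ⟨s, hs⟩ := exists_twoPowWitness_succ hd
    constructor
    · rintro ⟨t', h⟩
      exact ⟨d, (key n d).2 ⟨t, hd⟩, h.unique hs⟩
    · rintro ⟨d', h1, rfl⟩
      obtain ⟨t', h1⟩ := (key n d').1 h1
      rw [h1.unique hd]
      exact ⟨s, hs⟩

/-- Any two graphs agree, by Π⁰₁ induction on n; the set quantifier in `IsTwoPow` can therefore be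
replaced by one fixed graph. -/
theorem IsTwoPowGraph.subset {X Y : M.Sets} (hX : M.IsTwoPowGraph X) (hY : M.IsTwoPowGraph Y)
    (n e : M.Num) : M.mem (pair n e) X → M.mem (pair n e) Y := by
  refine pi_ind (P := fun n e => M.mem (pair n e) X → M.mem (pair n e) Y) inferInstance
    (fun e h => (hY.1 e).2 ((hX.1 e).1 h)) (fun n ih e h => ?_) n e
  obtain ⟨d, h1, h2⟩ := (hX.2 n e).1 h
  exact (hY.2 n e).2 ⟨d, ih d h1, h2⟩

theorem isTwoPow_iff_mem {X : M.Sets} (hX : M.IsTwoPowGraph X) {n e : M.Num} :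
    NumOps.IsTwoPow n e ↔ M.mem (pair n e) X :=
  ⟨fun ⟨_, hY, h⟩ => hY.subset hX n e h, fun h => ⟨X, hX, h⟩⟩

instance : ArithLaws M.Num := by
  obtain ⟨X, hX⟩ := exists_twoPowGraph M
  have h0 : ∀ e : M.Num, M.mem (pair 0 e) X ↔ e = 1 := hX.1
  have hs : ∀ n e : M.Num, M.mem (pair (n + 1) e) X ↔ ∃ d, M.mem (pair n d) X ∧ e = d + d := hX.2
  have hex : ∀ n : M.Num, ∃ e, n < e ∧ M.mem (pair n e) X := by
    refine sigma_ind inferInstance ⟨1, zero_lt_one, (h0 1).2 rfl⟩ ?_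
    rintro n ⟨e, h, he⟩
    exact ⟨e + e, add_lt_add_of_lt_of_le h
      (by rw [← zero_add (1 : M.Num), add_one_le_iff]; exact lt_of_le_of_lt zero_le h),
      (hs _ _).2 ⟨e, he, rfl⟩⟩
  -- The common bound a on both values leaves a single unbounded quantifier, as `pi_ind` requires.
  have huniq : ∀ n a : M.Num, ∀ e, e ≤ a → ∀ e', e' ≤ a → M.mem (pair n e) X →
      M.mem (pair n e') X → e = e' := by
    refine pi_ind inferInstance ?_ ?_
    · intro a e _ e' _ h h'
      rw [(h0 e).1 h, (h0 e').1 h']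
    · intro n ih a e _ e' _ h h'
      obtain ⟨d, h1, rfl⟩ := (hs _ _).1 h
      obtain ⟨d', h1', rfl⟩ := (hs _ _).1 h'
      rw [ih (d + d') d le_self_add d' le_add_self h1 h1']
  have huniq' : ∀ {n e e' : M.Num}, M.mem (pair n e) X → M.mem (pair n e') X → e = e' :=
    fun {n e e'} h h' => huniq n (e + e') e le_self_add e' le_add_self h h'
  have hmono : ∀ m d n : M.Num, M.mem (pair m d) X → m < n → ∃ e, d < e ∧ M.mem (pair n e) X := by
    intro m d n hd hmn
    obtain ⟨c, rfl⟩ := Peano.lt_iff.1 hmn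
    have hd0 : 0 < d := by
      obtain ⟨e, h1, h2⟩ := hex m
      rw [huniq' hd h2]; exact lt_of_le_of_lt zero_le h1
    refine sigma_ind (P := fun c e => d < e ∧ M.mem (pair (m + c + 1) e) X) inferInstance ?_ ?_ c
    · rw [add_zero]
      exact ⟨d + d, lt_add_of_pos_right _ hd0, (hs _ _).2 ⟨d, hd, rfl⟩⟩
    · rintro c ⟨e, h1, h2⟩
      rw [← add_assoc]
      exact ⟨e + e, h1.trans_le le_self_add, (hs _ _).2 ⟨e, h2, rfl⟩⟩
  exact
    { twoPow_zero := fun e => (isTwoPow_iff_mem hX).trans (h0 e)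
      twoPow_succ := fun n e => by
        rw [isTwoPow_iff_mem hX, hs]
        exact exists_congr fun d => and_congr_left fun _ => (isTwoPow_iff_mem hX).symm
      twoPow_existsUnique := fun n => by
        obtain ⟨e, -, he⟩ := hex n
        exact ⟨e, (isTwoPow_iff_mem hX).2 he, fun e' he' =>
          huniq' ((isTwoPow_iff_mem hX).1 he') he⟩
      lt_twoPow := fun n e he => by
        obtain ⟨e', h, he'⟩ := hex n
        rwa [huniq' ((isTwoPow_iff_mem hX).1 he) he']
      twoPow_strictMono := fun m n d e h hd he => by
        obtain ⟨e', h', he'⟩ := hmono m d n ((isTwoPow_iff_mem hX).1 hd) h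
        rwa [huniq' ((isTwoPow_iff_mem hX).1 he) he'] }

variable (M) in
theorem exists_exp2Graph : ∃ X : M.Sets, ∀ n e : M.Num, M.mem (pair n e) X ↔ e = exp2 n := by
  obtain ⟨X, hX⟩ := exists_twoPowGraph M
  exact ⟨X, fun n e => by rw [← isTwoPow_iff_mem hX, isTwoPow_iff]⟩

end L2Structure

end ReverseMath

/-! ### Definability for rationals, reals and RM-codes -/

namespace ReverseMath

namespace L2Structure

set_option synthInstance.maxSize 1000
set_option synthInstance.maxHeartbeats 100000

variable {M : L2Structure.{u, v}} {α β : Type u} [Env M α] [Env M β]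

/-- The function `a` is given by three terms with parameters. -/
class RatTm (a : α → RatRep M.Num) : Prop where
  pos : Tm fun x => (a x).pos
  neg : Tm fun x => (a x).neg
  den : Tm fun x => (a x).den

attribute [instance] RatTm.pos RatTm.neg RatTm.den

namespace Tm

instance (priority := low) proj_comp (t : β → M.Num) (f : α → β) [ht : Tm t] [hf : Proj M f] :
    Tm fun x => t (f x) := hf.out t ht

end Tm

namespace RatTm

instance (priority := low) proj_comp (a : β → RatRep M.Num) (f : α → β) [ha : RatTm a]
    [Proj M f] : RatTm fun x => a (f x) :=
  have hf : Proj M f := inferInstance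
  ⟨hf.out _ ha.pos, hf.out _ ha.neg, hf.out _ ha.den⟩

instance const (a : RatRep M.Num) : RatTm fun _ : α => a := ⟨Tm.const _, Tm.const _, Tm.const _⟩

instance rep (p n d : α → M.Num) [hp : Tm p] [hn : Tm n] [hd : Tm d] :
    RatTm fun x => (⟨p x, n x, d x⟩ : RatRep M.Num) := ⟨hp, hn, hd⟩

instance add (a b : α → RatRep M.Num) [RatTm a] [RatTm b] : RatTm fun x => a x + b x :=
  ⟨inferInstanceAs (Tm fun x => (a x).pos * (b x).den + (b x).pos * (a x).den),
    inferInstanceAs (Tm fun x => (a x).neg * (b x).den + (b x).neg * (a x).den),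
    inferInstanceAs (Tm fun x => (a x).den * (b x).den)⟩

end RatTm

instance (a : α → RatRep M.Num) [RatTm a] : Tm fun x => (a x).code := by
  unfold RatRep.code; infer_instance

variable [hM : Fact M.ModelsRCA] {b : Bool}

namespace Dfn

instance ratLt (s t : α → RatRep M.Num) [RatTm s] [RatTm t] : Dfn M b fun x => s x < t x :=
  inferInstanceAs (Dfn M b fun x => (s x).pos * (t x).den + (t x).neg * (s x).den <
    (t x).pos * (s x).den + (s x).neg * (t x).den)

instance ratLe (s t : α → RatRep M.Num) [RatTm s] [RatTm t] : Dfn M b fun x => s x ≤ t x :=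
  inferInstanceAs (Dfn M b fun x => ¬ t x < s x)

instance ratEq (s t : α → RatRep M.Num) [RatTm s] [RatTm t] : Dfn M b fun x => s x = t x :=
  (inferInstance : Dfn M b fun x => (s x).code = (t x).code).congr
    fun _ => RatRep.code_inj.symm

instance ratDistLe (r s t : α → RatRep M.Num) [RatTm r] [RatTm s] [RatTm t] :
    Dfn M b fun x => (r x).DistLe (s x) (t x) := by
  unfold RatRep.DistLe; infer_instance

instance ratAll (P : α → RatRep M.Num → Prop)
    [hP : Dfn M false fun y : ((α × M.Num) × M.Num) × M.Num => P y.1.1.1 ⟨y.1.1.2, y.1.2, y.2⟩] :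
    Dfn M false fun x => ∀ a, P x a := by
  have h := all (fun (y : (α × M.Num) × M.Num) d => P y.1.1 ⟨y.1.2, y.2, d⟩) (hP := hP)
  have h := all (fun (y : α × M.Num) n => ∀ d, P y.1 ⟨y.2, n, d⟩) (hP := h)
  exact (all (fun y p => ∀ n d, P y ⟨p, n, d⟩) (hP := h)).congr fun x =>
    ⟨fun h p n d => h ⟨p, n, d⟩, fun h a => h a.pos a.neg a.den⟩

instance ratEx (P : α → RatRep M.Num → Prop)
    [hP : Dfn M false fun y : ((α × M.Num) × M.Num) × M.Num => P y.1.1.1 ⟨y.1.1.2, y.1.2, y.2⟩] :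
    Dfn M false fun x => ∃ a, P x a :=
  (inferInstance : Dfn M false fun x => ¬ ∀ a, ¬ P x a).congr fun _ => by
    simp only [not_forall, not_not]

theorem _root_.ReverseMath.RatRep.le_code (a : RatRep M.Num) :
    a.pos ≤ a.code ∧ a.neg ≤ a.code ∧ a.den ≤ a.code :=
  ⟨(le_pair_left _ _).trans (le_pair_left _ _), (le_pair_right _ _).trans (le_pair_left _ _),
    le_pair_right _ _⟩

instance ratBex (t : α → M.Num) (P : α → RatRep M.Num → Prop) [ht : Tm t]
    [hP : Dfn M b fun y : ((α × M.Num) × M.Num) × M.Num => P y.1.1.1 ⟨y.1.1.2, y.1.2, y.2⟩] :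
    Dfn M b fun x => ∃ a : RatRep M.Num, a.code ≤ t x ∧ P x a :=
  (inferInstance : Dfn M b fun x => ∃ p, p ≤ t x ∧ ∃ n, n ≤ t x ∧ ∃ d, d ≤ t x ∧
    ((⟨p, n, d⟩ : RatRep M.Num).code ≤ t x ∧ P x ⟨p, n, d⟩)).congr fun x =>
      ⟨fun ⟨a, h, h'⟩ => ⟨a.pos, a.le_code.1.trans h, a.neg, a.le_code.2.1.trans h, a.den,
        a.le_code.2.2.trans h, h, h'⟩, fun ⟨p, _, n, _, d, _, h, h'⟩ => ⟨⟨p, n, d⟩, h, h'⟩⟩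

instance isTwoPow (s t : α → M.Num) [Tm s] [Tm t] :
    Dfn M b fun x => NumOps.IsTwoPow (s x) (t x) := by
  obtain ⟨X, hX⟩ := exists_exp2Graph M
  exact (inferInstance : Dfn M b fun x => M.mem (pair (s x) (t x)) X).congr
    fun x => isTwoPow_iff.trans (hX _ _).symm

instance seq (X : M.Sets) (s : α → M.Num) (t : α → RatRep M.Num) [Tm s] [RatTm t] :
    Dfn M b fun x => L2Structure.seq X (s x) (t x) := by
  unfold L2Structure.seq; infer_instance

instance seqDistLt (X : M.Sets) (s t : α → RatRep M.Num) [RatTm s] [RatTm t] :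
    Dfn M false fun x => (L2Structure.seq X).DistLt (RatSeq.const (s x)) (t x) := by
  unfold RatSeq.DistLt RatSeq.const; infer_instance

instance rel (Φ : M.Sets) (a r c s : α → RatRep M.Num) [RatTm a] [RatTm r] [RatTm c] [RatTm s] :
    Dfn M false fun x => Rel Φ (a x) (r x) (c x) (s x) := by
  unfold Rel; infer_instance

end Dfn

/-- A definable relation between rationals gives a set of tuples. -/
theorem exists_rel {b : Bool}
    (hcomp : ∀ P : M.Num → Prop, (Dfn M b fun y : Ctx1 M => P y.2) →
      ∃ X : M.Sets, ∀ n, M.mem n X ↔ P n)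
    (θ : M.Num → RatRep M.Num → RatRep M.Num → RatRep M.Num → RatRep M.Num → Prop)
    (hθ : ∀ {γ : Type u} [Env M γ] (n : γ → M.Num) (a r c s : γ → RatRep M.Num) [Tm n] [RatTm a]
      [RatTm r] [RatTm c] [RatTm s], Dfn M b fun x => θ (n x) (a x) (r x) (c x) (s x)) :
    ∃ Φ : M.Sets, ∀ a r c s, Rel Φ a r c s ↔
      (0 < a.den ∧ 0 < r.den ∧ 0 < c.den ∧ 0 < s.den) ∧ (0 < r ∧ 0 < s) ∧ ∃ n, θ n a r c s := by
  obtain ⟨Φ, hΦ⟩ := hcomp (fun m => ∃ n, n ≤ m ∧ ∃ a : RatRep M.Num, a.code ≤ m ∧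
    ∃ r : RatRep M.Num, r.code ≤ m ∧ ∃ c : RatRep M.Num, c.code ≤ m ∧
      ∃ s : RatRep M.Num, s.code ≤ m ∧
        (m = pair n (pair a.code (pair r.code (pair c.code s.code))) ∧ θ n a r c s)) (by
    have := @hθ
    infer_instance)
  refine ⟨Φ, fun a r c s => and_congr_right fun _ => and_congr_right fun _ =>
    exists_congr fun n => ?_⟩
  rw [hΦ]
  constructor
  · rintro ⟨n', -, a', -, r', -, c', -, s', -, h, h'⟩
    obtain ⟨h0, h⟩ := pair_inj.1 h
    obtain ⟨h1, h⟩ := pair_inj.1 h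
    obtain ⟨h2, h⟩ := pair_inj.1 h
    obtain ⟨h3, h4⟩ := pair_inj.1 h
    rwa [h0, RatRep.code_inj.1 h1, RatRep.code_inj.1 h2, RatRep.code_inj.1 h3,
      RatRep.code_inj.1 h4]
  · intro h
    have h1 := le_pair_right n (pair a.code (pair r.code (pair c.code s.code)))
    have h2 := (le_pair_right a.code (pair r.code (pair c.code s.code))).trans h1
    have h3 := (le_pair_right r.code (pair c.code s.code)).trans h2
    exact ⟨n, le_pair_left _ _, a, (le_pair_left _ _).trans h1, r, (le_pair_left _ _).trans h2, c,
      (le_pair_left _ _).trans h3, s, (le_pair_right _ _).trans h3, rfl, h⟩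

/-- A rational number is a real number of the structure. -/
theorem exists_seq_const {c : RatRep M.Num} (hc : 0 < c.den) :
    ∃ X : M.Sets, seq X = RatSeq.const c := by
  obtain ⟨X, hX⟩ := bdd_comp (P := fun m : M.Num => ∃ n, n ≤ m ∧ m = pair n c.code) inferInstance
  refine ⟨X, ?_⟩
  ext n a
  simp only [seq, hX, RatSeq.const, pair_inj]
  constructor
  · rintro ⟨-, n', -, rfl, h⟩; exact RatRep.code_inj.1 h
  · rintro rfl; exact ⟨hc, n, le_pair_left _ _, rfl, rfl⟩

/-! ### Codes of continuous functions -/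

open Filter

variable {Φ : M.Sets} {a r b s a' r' b' s' : RatRep M.Num} {x : RatSeq M.Num}

theorem isContinuousCode_iff : IsContinuousCode Φ ↔
    (∀ a r b s b' s', Rel Φ a r b s → Rel Φ a r b' s' → |b.val - b'.val| ≤ s.val + s'.val) ∧
    (∀ a r b s a' r', Rel Φ a r b s → 0 < a'.den → 0 < r'.den → 0 < r'.val →
      |a.val - a'.val| + r'.val < r.val → Rel Φ a' r' b s) ∧
    ∀ a r b s b' s', Rel Φ a r b s → 0 < b'.den → 0 < s'.den →
      |b.val - b'.val| + s.val < s'.val → Rel Φ a r b' s' := by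
  constructor
  · intro h
    refine ⟨fun a r b s b' s' h1 h2 => ?_, fun a r b s a' r' h1 ha hr hr' hlt => ?_,
      fun a r b s b' s' h1 hb hs hlt => ?_⟩
    · have := h.consistent _ _ _ _ _ _ h1 h2
      rwa [RatRep.distLe_iff h1.1.2.2.1 h2.1.2.2.1 (RatRep.add_den_pos h1.1.2.2.2 h2.1.2.2.2),
        RatRep.val_add h1.1.2.2.2 h2.1.2.2.2] at this
    · rw [← lt_sub_iff_add_lt, abs_lt] at hlt
      refine h.shrink _ _ _ _ _ _ h1 ha hr ((RatRep.val_pos hr).1 hr') ?_ ?_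
      · rw [← RatRep.val_lt (RatRep.add_den_pos h1.1.1 hr) (RatRep.add_den_pos ha h1.1.2.1),
          RatRep.val_add h1.1.1 hr, RatRep.val_add ha h1.1.2.1]
        linarith
      · rw [← RatRep.val_lt (RatRep.add_den_pos ha hr) (RatRep.add_den_pos h1.1.1 h1.1.2.1),
          RatRep.val_add ha hr, RatRep.val_add h1.1.1 h1.1.2.1]
        linarith
    · rw [← lt_sub_iff_add_lt, abs_lt] at hlt
      refine h.enlarge _ _ _ _ _ _ h1 hb hs ?_ ?_
      · rw [← RatRep.val_lt (RatRep.add_den_pos h1.1.2.2.1 h1.1.2.2.2) (RatRep.add_den_pos hb hs),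
          RatRep.val_add h1.1.2.2.1 h1.1.2.2.2, RatRep.val_add hb hs]
        linarith
      · rw [← RatRep.val_lt (RatRep.add_den_pos hb h1.1.2.2.2) (RatRep.add_den_pos h1.1.2.2.1 hs),
          RatRep.val_add hb h1.1.2.2.2, RatRep.val_add h1.1.2.2.1 hs]
        linarith
  · rintro ⟨h1, h2, h3⟩
    refine ⟨fun a r b s b' s' h h' => ?_, fun a r b s a' r' h ha hr hr' hlt hlt' => ?_,
      fun a r b s b' s' h hb hs hlt hlt' => ?_⟩
    · rw [RatRep.distLe_iff h.1.2.2.1 h'.1.2.2.1 (RatRep.add_den_pos h.1.2.2.2 h'.1.2.2.2),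
        RatRep.val_add h.1.2.2.2 h'.1.2.2.2]
      exact h1 _ _ _ _ _ _ h h'
    · refine h2 _ _ _ _ _ _ h ha hr ((RatRep.val_pos hr).2 hr') ?_
      rw [← RatRep.val_lt (RatRep.add_den_pos h.1.1 hr) (RatRep.add_den_pos ha h.1.2.1),
        RatRep.val_add h.1.1 hr, RatRep.val_add ha h.1.2.1] at hlt
      rw [← RatRep.val_lt (RatRep.add_den_pos ha hr) (RatRep.add_den_pos h.1.1 h.1.2.1),
        RatRep.val_add ha hr, RatRep.val_add h.1.1 h.1.2.1] at hlt'
      rw [← lt_sub_iff_add_lt, abs_lt]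
      constructor <;> linarith
    · refine h3 _ _ _ _ _ _ h hb hs ?_
      rw [← RatRep.val_lt (RatRep.add_den_pos h.1.2.2.1 h.1.2.2.2) (RatRep.add_den_pos hb hs),
        RatRep.val_add h.1.2.2.1 h.1.2.2.2, RatRep.val_add hb hs] at hlt
      rw [← RatRep.val_lt (RatRep.add_den_pos hb h.1.2.2.2) (RatRep.add_den_pos h.1.2.2.1 hs),
        RatRep.val_add hb h.1.2.2.2, RatRep.val_add h.1.2.2.1 hs] at hlt'
      rw [← lt_sub_iff_add_lt, abs_lt]
      constructor <;> linarith

/-- The open ball of radius `r` about `a` contains `x`. -/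
theorem distLt_const_iff (hx : x.IsReal) (ha : 0 < a.den) (hr : 0 < r.den) :
    x.DistLt (RatSeq.const a) r ↔ ∃ δ > 0, ∀ᶠ n in atTop, |x.val n - a.val| + δ ≤ r.val := by
  simp only [RatSeq.distLt_iff hx (RatSeq.isReal_const ha) hr, RatSeq.val_const]

theorem distLe_const_iff (hx : x.IsReal) (ha : 0 < a.den) (hr : 0 < r.den) :
    x.DistLe (RatSeq.const a) r ↔ ∀ δ > 0, ∀ᶠ n in atTop, |x.val n - a.val| ≤ r.val + δ := by
  simp only [RatSeq.distLe_iff hx (RatSeq.isReal_const ha) hr, RatSeq.val_const]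

namespace Rel

theorem r_pos (h : Rel Φ a r b s) : 0 < r.val := (RatRep.val_pos h.1.2.1).2 h.2.1.1

theorem s_pos (h : Rel Φ a r b s) : 0 < s.val := (RatRep.val_pos h.1.2.2.2).2 h.2.1.2

/-- Simpson's consistency condition concerns a single ball. Both tuples are shrunk to a ball about
the common point c, with half the smaller of its distances to the two boundaries as radius. -/
theorem overlap (hΦ : IsContinuousCode Φ) (h : Rel Φ a r b s) (h' : Rel Φ a' r' b' s')
    {c : Frac M.Num} (hc : |c - a.val| < r.val) (hc' : |c - a'.val| < r'.val) :
    |b.val - b'.val| ≤ s.val + s'.val := by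
  obtain ⟨c, hcd, rfl⟩ := RatRep.exists_val_eq c
  obtain ⟨d, hdd, hd⟩ := RatRep.exists_val_eq
    (min (r.val - |c.val - a.val|) (r'.val - |c.val - a'.val|) / 2)
  have h1 := min_le_left (r.val - |c.val - a.val|) (r'.val - |c.val - a'.val|)
  have h2 := min_le_right (r.val - |c.val - a.val|) (r'.val - |c.val - a'.val|)
  have h3 := lt_min (sub_pos.2 hc) (sub_pos.2 hc')
  have hΦ := isContinuousCode_iff.1 hΦ
  refine hΦ.1 c d b s b' s' (hΦ.2.1 _ _ _ _ _ _ h hcd hdd (by linarith) ?_)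
    (hΦ.2.1 _ _ _ _ _ _ h' hcd hdd (by linarith) ?_)
  · rw [abs_sub_comm]; linarith
  · rw [abs_sub_comm]; linarith

theorem overlap_real (hΦ : IsContinuousCode Φ) (h : Rel Φ a r b s) (h' : Rel Φ a' r' b' s')
    (hx : x.IsReal) (hxa : x.DistLt (RatSeq.const a) r) (hxa' : x.DistLt (RatSeq.const a') r') :
    |b.val - b'.val| ≤ s.val + s'.val := by
  obtain ⟨δ, hδ, h1⟩ := (distLt_const_iff hx h.1.1 h.1.2.1).1 hxa
  obtain ⟨δ', hδ', h2⟩ := (distLt_const_iff hx h'.1.1 h'.1.2.1).1 hxa'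
  obtain ⟨n, h1, h2⟩ := (h1.and h2).exists
  exact h.overlap hΦ h' (c := x.val n) (by linarith) (by linarith)

end Rel

/-- Small rational balls about a real. -/
theorem exists_small_ball (hx : x.IsReal) {η : Frac M.Num} (hη : 0 < η) {p : Frac M.Num → Prop}
    (hp : ∀ᶠ n in atTop, p (x.val n)) :
    ∃ a r : RatRep M.Num, 0 < a.den ∧ 0 < r.den ∧ 0 < r.val ∧ r.val < η ∧ p a.val ∧
      x.DistLt (RatSeq.const a) r := by
  obtain ⟨n, h1, h2⟩ := (hp.and (eventually_tol_lt (N := M.Num) (half_pos (half_pos hη)))).exists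
  obtain ⟨a, -, ha, hav⟩ := hx.exists_term n
  obtain ⟨r, hr, hrv⟩ := RatRep.exists_val_eq (η / 2)
  refine ⟨a, r, ha, hr, by linarith, by linarith, hav ▸ h1, ?_⟩
  rw [distLt_const_iff hx ha hr]
  refine ⟨η / 2 / 2, by linarith, ?_⟩
  filter_upwards [hx.eventually_abs_sub_lt n] with m hm
  rw [hav, abs_sub_comm]
  linarith

theorem InDomain.exists_rel (h : InDomain Φ x) {ε : Frac M.Num} (hε : 0 < ε) :
    ∃ a r b s, Rel Φ a r b s ∧ x.DistLt (RatSeq.const a) r ∧ s.val < ε := by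
  obtain ⟨e, he, rfl⟩ := RatRep.exists_val_eq ε
  obtain ⟨a, r, b, s, h1, h2, h3⟩ := h e he ((RatRep.val_pos he).1 hε)
  exact ⟨a, r, b, s, h1, h2, (RatRep.val_lt h1.1.2.2.2 he).2 h3⟩

theorem InDomain.of_exists_rel (h : ∀ ε : Frac M.Num, 0 < ε →
    ∃ a r b s, Rel Φ a r b s ∧ x.DistLt (RatSeq.const a) r ∧ s.val < ε) : InDomain Φ x := by
  intro e he he'
  obtain ⟨a, r, b, s, h1, h2, h3⟩ := h e.val ((RatRep.val_pos he).2 he')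
  exact ⟨a, r, b, s, h1, h2, (RatRep.val_lt h1.1.2.2.2 he).1 h3⟩

/-- The least number principle for arithmetical predicates. -/
theorem ACA.least (h : M.ACA) {P : M.Num → Prop} (hP : Dfn M false fun y : Ctx1 M => P y.2)
    {n : M.Num} (hn : P n) : ∃ m, P m ∧ ∀ k, k < m → ¬ P k := by
  obtain ⟨X, hX⟩ := h.comp hP
  obtain ⟨m, h1, h2⟩ := bdd_least (P := fun n => M.mem n X) inferInstance ((hX n).2 hn)
  exact ⟨m, (hX m).1 h1, fun k hk hk' => h2 k hk ((hX k).2 hk')⟩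

end L2Structure

end ReverseMath

/-! ### Extending a code under arithmetical comprehension -/

namespace ReverseMath

namespace L2Structure

set_option synthInstance.maxSize 1000
set_option synthInstance.maxHeartbeats 100000

open Filter

variable {M : L2Structure.{u, v}} [hM : Fact M.ModelsRCA]

variable {Φ : M.Sets}

/-- Under arithmetical comprehension a coded function has values on its domain. -/
theorem ACA.exists_isValue (h : M.ACA) (hΦ : IsContinuousCode Φ) {x : M.Sets}
    (hx : (seq x).IsReal) (hd : InDomain Φ (seq x)) : ∃ y : M.Sets, IsValue Φ (seq x) (seq y) := by
  -- The n-th term of the value will be the b of least code with a tuple about x whose s is below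
  -- 2^(-n-2). Two such terms differ by at most s + s', hence by less than the required rate.
  let Q : M.Num → RatRep M.Num → Prop := fun n b => ∃ e, ∃ a r s : RatRep M.Num,
    NumOps.IsTwoPow (n + 1 + 1) e ∧
      (Rel Φ a r b s ∧ ((seq x).DistLt (RatSeq.const a) r ∧ s < ⟨1, 0, e⟩))
  have hQ : ∀ {γ : Type u} [Env M γ] (n : γ → M.Num) (b : γ → RatRep M.Num) [Tm n] [RatTm b],
      Dfn M false fun y => Q (n y) (b y) := by
    intro γ _ n b _ _; unfold Q; infer_instance
  obtain ⟨Y, hY⟩ := h.comp (P := fun m => ∃ n, ∃ b : RatRep M.Num, m = pair n b.code ∧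
    (Q n b ∧ ∀ b' : RatRep M.Num, b'.code < b.code → ¬ Q n b')) (by
      have := @hQ; infer_instance)
  have hseq : ∀ n b, seq Y n b ↔ Q n b ∧ ∀ b' : RatRep M.Num, b'.code < b.code → ¬ Q n b' := by
    intro n b
    simp only [seq, hY, pair_inj]
    constructor
    · rintro ⟨-, n', b', ⟨rfl, h⟩, h'⟩
      rwa [RatRep.code_inj.1 h]
    · intro h
      obtain ⟨e, a, r, s, -, hrel, -⟩ := h.1
      exact ⟨hrel.1.2.2.1, n, b, ⟨rfl, rfl⟩, h⟩
  have hQ' : ∀ {n b}, Q n b → ∃ a r s, Rel Φ a r b s ∧ (seq x).DistLt (RatSeq.const a) r ∧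
      s.val < tol n / 4 := by
    rintro n b ⟨e, a, r, s, he, h1, h2, h3⟩
    obtain rfl := isTwoPow_iff.1 he
    refine ⟨a, r, s, h1, h2, ?_⟩
    rw [← RatRep.val_lt h1.1.2.2.2 (exp2_pos _), RatRep.val_unit] at h3
    change s.val < tol _ at h3
    rw [tol_succ, tol_succ] at h3
    linarith
  have hreal : (seq Y).IsReal := by
    refine RatSeq.isReal_iff.2 ⟨fun n => ?_, fun n b hb => hb.1, fun m n b b' hmn hb hb' => ?_⟩
    · obtain ⟨a, r, b, s, h1, h2, h3⟩ := hd.exists_rel (tol_pos (n + 1 + 1))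
      obtain ⟨c, ⟨b, rfl, hb⟩, hc⟩ := h.least
        (P := fun c => ∃ b : RatRep M.Num, c = b.code ∧ Q n b)
        (by have := @hQ; infer_instance) (n := b.code)
        ⟨b, rfl, exp2 (n + 1 + 1), a, r, s, isTwoPow_exp2 _, h1, h2,
          (RatRep.val_lt h1.1.2.2.2 (exp2_pos _)).1 (by rw [RatRep.val_unit]; exact h3)⟩
      refine ⟨b, (hseq n b).2 ⟨hb, fun b' hb' hQb' => hc _ hb' ⟨b', rfl, hQb'⟩⟩, fun b' hb' => ?_⟩
      replace hb' := (hseq n b').1 hb'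
      rcases lt_trichotomy b.code b'.code with hlt | heq | hlt
      · exact (hb'.2 b hlt hb).elim
      · exact (RatRep.code_inj.1 heq).symm
      · exact (hc _ hlt ⟨b', rfl, hb'.1⟩).elim
    · obtain ⟨a, r, s, h1, h2, h3⟩ := hQ' ((hseq m b).1 hb).1
      obtain ⟨a', r', s', h1', h2', h3'⟩ := hQ' ((hseq n b').1 hb').1
      have := h1.overlap_real hΦ h1' hx h2 h2'
      have := tol_anti hmn
      have := tol_pos m
      linarith
  refine ⟨Y, hd, hreal, fun a r b s hr hxa => ?_⟩
  rw [distLe_const_iff hreal hr.1.2.2.1 hr.1.2.2.2]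
  intro δ hδ
  filter_upwards [eventually_tol_lt hδ] with n hn
  obtain ⟨b', hb', -, hv⟩ := hreal.exists_term n
  obtain ⟨a', r', s', h1', h2', h3'⟩ := hQ' ((hseq n b').1 hb').1
  have := h1'.overlap_real hΦ hr hx h2' hxa
  have := tol_pos n
  rw [← hv]
  linarith

/-- The relation that codes the extension by `0` of the function coded by `Φ`. -/
def ExtRel (Φ : M.Sets) (a r b s : RatRep M.Num) : Prop :=
  -- Balls stay to the left of 1, where f is known to be defined. A ball reaching below 0 must allow
  -- the value 0; the other condition tests only those balls of Φ that lie inside this ball and in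
  -- the positive half-line.
  a + r ≤ 1 ∧ ((a < r → b.DistLe 0 s) ∧ ∀ a' r' b' s', Rel Φ a' r' b' s' →
    a + r' ≤ a' + r → a' + r' ≤ a + r → r' ≤ a' → b.DistLe b' (s + s'))

/-- The relation of `ExtRel`, in terms of the values. -/
def ExtVal (Φ : M.Sets) (a r b s : Frac M.Num) : Prop :=
  a + r ≤ 1 ∧ (a < r → |b| ≤ s) ∧ ∀ a' r' b' s', Rel Φ a' r' b' s' →
    |a - a'.val| + r'.val ≤ r → r'.val ≤ a'.val → |b - b'.val| ≤ s + s'.val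

theorem extRel_iff {a r b s : RatRep M.Num} (ha : 0 < a.den) (hr : 0 < r.den) (hb : 0 < b.den)
    (hs : 0 < s.den) : ExtRel Φ a r b s ↔ ExtVal Φ a.val r.val b.val s.val := by
  refine and_congr ?_ (and_congr ?_ ?_)
  · rw [← RatRep.val_le (RatRep.add_den_pos ha hr) RatRep.one_den_pos, RatRep.val_add ha hr,
      RatRep.val_one]
  · rw [RatRep.val_lt ha hr, RatRep.distLe_iff hb RatRep.zero_den_pos hs, RatRep.val_zero, sub_zero]
  · refine forall_congr' fun a' => forall_congr' fun r' => forall_congr' fun b' =>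
      forall_congr' fun s' => imp_congr_right fun h => ?_
    rw [← RatRep.val_le (RatRep.add_den_pos ha h.1.2.1) (RatRep.add_den_pos h.1.1 hr),
      ← RatRep.val_le (RatRep.add_den_pos h.1.1 h.1.2.1) (RatRep.add_den_pos ha hr),
      ← RatRep.val_le h.1.2.1 h.1.1, RatRep.distLe_iff hb h.1.2.2.1 (RatRep.add_den_pos hs h.1.2.2.2),
      RatRep.val_add hs h.1.2.2.2, RatRep.val_add ha h.1.2.1, RatRep.val_add h.1.1 hr,
      RatRep.val_add h.1.1 h.1.2.1, RatRep.val_add ha hr, ← and_imp]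
    refine imp_congr ?_ Iff.rfl
    rw [← le_sub_iff_add_le (a := |a.val - a'.val|), abs_le]
    constructor
    · rintro ⟨h1, h2⟩; constructor <;> linarith
    · rintro ⟨h1, h2⟩; constructor <;> linarith

theorem ACA.exists_extRel (h : M.ACA) (Φ : M.Sets) : ∃ Ψ : M.Sets, ∀ a r b s, Rel Ψ a r b s ↔
    (0 < a.den ∧ 0 < r.den ∧ 0 < b.den ∧ 0 < s.den) ∧ (0 < r.val ∧ 0 < s.val) ∧
      ExtVal Φ a.val r.val b.val s.val := by
  obtain ⟨Ψ, hΨ⟩ := exists_rel (fun P hP => h.comp hP) (fun _ => ExtRel Φ) (by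
    intro γ _ n a r c s _ _ _ _ _
    unfold ExtRel
    infer_instance)
  refine ⟨Ψ, fun a r b s => (hΨ a r b s).trans (and_congr_right fun hd => ?_)⟩
  rw [RatRep.val_pos hd.2.1, RatRep.val_pos hd.2.2.2, exists_const, extRel_iff hd.1 hd.2.1 hd.2.2.1 hd.2.2.2]

theorem const_lt_const {a b : RatRep M.Num} (ha : 0 < a.den) (hb : 0 < b.den) :
    (RatSeq.const a).Lt (RatSeq.const b) ↔ a.val < b.val := by
  rw [RatSeq.lt_iff (RatSeq.isReal_const ha) (RatSeq.isReal_const hb)]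
  simp only [RatSeq.val_const, eventually_const]
  exact ⟨fun ⟨δ, hδ, h⟩ => by linarith, fun h => ⟨b.val - a.val, by linarith, by linarith⟩⟩

theorem zero_lt_iff {x : RatSeq M.Num} (hx : x.IsReal) :
    (RatSeq.const 0).Lt x ↔ ∃ δ > 0, ∀ᶠ n in atTop, δ ≤ x.val n := by
  simp only [RatSeq.lt_iff (RatSeq.isReal_const RatRep.zero_den_pos) hx, RatSeq.val_const,
    RatRep.val_zero, zero_add]

theorem lt_const_iff {x : RatSeq M.Num} {a : RatRep M.Num} (hx : x.IsReal) (ha : 0 < a.den) :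
    x.Lt (RatSeq.const a) ↔ ∃ δ > 0, ∀ᶠ n in atTop, x.val n + δ ≤ a.val := by
  simp only [RatSeq.lt_iff hx (RatSeq.isReal_const ha), RatSeq.val_const]

theorem eqv_zero_iff {x : RatSeq M.Num} (hx : x.IsReal) :
    x.Eqv (RatSeq.const 0) ↔ ∀ δ > 0, ∀ᶠ n in atTop, |x.val n| ≤ δ := by
  simp only [RatSeq.eqv_iff hx (RatSeq.isReal_const RatRep.zero_den_pos), RatSeq.val_const,
    RatRep.val_zero, sub_zero]

theorem inIoo_const {a : RatRep M.Num} (ha : 0 < a.den) (h0 : 0 < a.val) (h1 : a.val < 1) :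
    (RatSeq.const a).InIoo :=
  ⟨RatSeq.isReal_const ha, (const_lt_const RatRep.zero_den_pos ha).2 (by rwa [RatRep.val_zero]),
    (const_lt_const ha RatRep.one_den_pos).2 (by rwa [RatRep.val_one])⟩

section Extension

variable {Ψ : M.Sets} (hΦ : IsContinuousCode Φ)
  (hdom : ∀ x : M.Sets, (seq x).InIoo → InDomain Φ (seq x))
  (hΨ : ∀ a r b s, Rel Ψ a r b s ↔ (0 < a.den ∧ 0 < r.den ∧ 0 < b.den ∧ 0 < s.den) ∧
    (0 < r.val ∧ 0 < s.val) ∧ ExtVal Φ a.val r.val b.val s.val)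

include hdom in
theorem inDomain_const {a : RatRep M.Num} (ha : 0 < a.den) (h0 : 0 < a.val) (h1 : a.val < 1) :
    InDomain Φ (RatSeq.const a) := by
  obtain ⟨A, hA⟩ := exists_seq_const ha
  rw [← hA]
  exact hdom A (by rw [hA]; exact inIoo_const ha h0 h1)

include hΦ hdom hΨ in
-- Consistency is the main point. If the ball reaches below 0, both values are compared with 0.
-- Otherwise its center lies in (0, 1), where f is defined, and a tuple of Φ about the center with
-- small s is compared with both.
theorem isContinuousCode_extension : IsContinuousCode Ψ := by
  refine isContinuousCode_iff.2 ⟨fun a r b s b' s' h h' => ?_,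
    fun a r b s a' r' h ha' hr' hr0 hlt => ?_, fun a r b s b' s' h hb' hs' hlt => ?_⟩
  · obtain ⟨hd, ⟨hr, hs⟩, h1, h2, h3⟩ := (hΨ _ _ _ _).1 h
    obtain ⟨hd', ⟨-, hs'⟩, -, h2', h3'⟩ := (hΨ _ _ _ _).1 h'
    by_cases har : a.val < r.val
    · have := abs_sub b.val b'.val
      have := h2 har
      have := h2' har
      linarith
    · refine le_of_forall_pos_lt_add fun ε hε => ?_
      obtain ⟨a₀, r₀, b₀, s₀, g1, g2, g3⟩ := (inDomain_const hdom hd.1 (by linarith)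
        (by linarith)).exists_rel (half_pos hε)
      obtain ⟨δ, hδ, g2⟩ := (distLt_const_iff (RatSeq.isReal_const hd.1) g1.1.1 g1.1.2.1).1 g2
      simp only [RatSeq.val_const, eventually_const] at g2
      obtain ⟨ρ, hρ, hρv⟩ := RatRep.exists_val_eq (min r.val (δ / 2))
      have hρ0 : 0 < ρ.val := hρv ▸ lt_min hr (half_pos hδ)
      have hρ1 : ρ.val ≤ r.val := hρv ▸ min_le_left _ _
      have hρ2 : ρ.val ≤ δ / 2 := hρv ▸ min_le_right _ _
      have g := (isContinuousCode_iff.1 hΦ).2.1 _ _ _ _ a ρ g1 hd.1 hρ hρ0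
        (by rw [abs_sub_comm]; linarith)
      have k1 := h3 _ _ _ _ g (by simpa using hρ1) (by linarith)
      have k2 := h3' _ _ _ _ g (by simpa using hρ1) (by linarith)
      have := abs_sub_le b.val b₀.val b'.val
      rw [abs_sub_comm] at k2
      linarith
  · obtain ⟨hd, ⟨hr, hs⟩, h1, h2, h3⟩ := (hΨ _ _ _ _).1 h
    have hlt' := abs_lt.1 (lt_sub_iff_add_lt.2 hlt)
    refine (hΨ _ _ _ _).2 ⟨⟨ha', hr', hd.2.2⟩, ⟨hr0, hs⟩, by linarith, fun h => h2 (by linarith),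
      fun a₁ r₁ b₁ s₁ g g1 g2 => h3 _ _ _ _ g ?_ g2⟩
    have := abs_sub_le a.val a'.val a₁.val
    linarith
  · obtain ⟨hd, ⟨hr, hs⟩, h1, h2, h3⟩ := (hΨ _ _ _ _).1 h
    refine (hΨ _ _ _ _).2 ⟨⟨hd.1, hd.2.1, hb', hs'⟩,
      ⟨hr, by have := abs_nonneg (b.val - b'.val); linarith⟩, h1, fun h => ?_,
      fun a₁ r₁ b₁ s₁ g g1 g2 => ?_⟩
    · have := h2 h
      have := abs_sub_abs_le_abs_sub b'.val b.val
      rw [abs_sub_comm] at this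
      linarith
    · have := h3 _ _ _ _ g g1 g2
      have := abs_sub_le b'.val b.val b₁.val
      rw [abs_sub_comm] at hlt
      linarith

theorem eventually_mem_ball {x : RatSeq M.Num} (h : x.InIoo) :
    ∃ η > 0, ∀ᶠ n in atTop, η ≤ x.val n ∧ x.val n + η ≤ 1 := by
  obtain ⟨η, hη, h0⟩ := (zero_lt_iff h.1).1 h.2.1
  obtain ⟨η', hη', h1⟩ := (lt_const_iff h.1 RatRep.one_den_pos).1 h.2.2
  refine ⟨min η η', lt_min hη hη', ?_⟩
  filter_upwards [h0, h1] with n h0 h1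
  rw [RatRep.val_one] at h1
  have := min_le_left η η'
  have := min_le_right η η'
  constructor <;> linarith

include hΦ hdom hΨ in
-- A precise tuple of Φ, restricted to a ball about x inside (0, 1), belongs to Ψ: by `Rel.overlap`
-- it is compatible with every tuple of Φ on a smaller ball.
theorem inDomain_extension {x : M.Sets} (hx : (seq x).InIoo) : InDomain Ψ (seq x) := by
  refine InDomain.of_exists_rel fun ε hε => ?_
  obtain ⟨a, r, b, s, h1, h2, h3⟩ := (hdom x hx).exists_rel hε
  obtain ⟨δ, hδ, h2⟩ := (distLt_const_iff hx.1 h1.1.1 h1.1.2.1).1 h2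
  obtain ⟨η, hη, h4⟩ := eventually_mem_ball hx
  obtain ⟨a', r', ha', hr', hr0, hrη, ⟨h2, h4⟩, h5⟩ :=
    exists_small_ball hx.1 (lt_min hδ hη)
      (p := fun z => |z - a.val| + δ ≤ r.val ∧ η ≤ z ∧ z + η ≤ 1) (h2.and h4)
  have := hrη.trans_le (min_le_left _ _)
  have := hrη.trans_le (min_le_right _ _)
  refine ⟨a', r', b, s, (hΨ _ _ _ _).2 ⟨⟨ha', hr', h1.1.2.2⟩, ⟨hr0, h1.s_pos⟩, by linarith,
    fun h => by linarith, fun a₁ r₁ b₁ s₁ g g1 g2 => ?_⟩, h5, h3⟩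
  refine h1.overlap hΦ g (c := a₁.val) ?_ (by simpa using g.r_pos)
  have := abs_sub_le a₁.val a'.val a.val
  have := g.r_pos
  rw [abs_sub_comm] at g1
  linarith

include hΦ hdom hΨ in
-- Inside a ball of Ψ about x there is a positive ball on which a precise tuple of Φ holds; its b₀
-- is close to y and compatible with b.
theorem isValue_extension {x y : M.Sets} (hx : (seq x).InIoo) (hy : IsValue Φ (seq x) (seq y)) :
    IsValue Ψ (seq x) (seq y) := by
  refine ⟨inDomain_extension hΦ hdom hΨ hx, hy.2.1, fun a r b s h hxa => ?_⟩
  rw [distLe_const_iff hy.2.1 h.1.2.2.1 h.1.2.2.2]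
  intro δ hδ
  have hδ4 : 0 < δ / 4 := by linarith
  obtain ⟨a₀, r₀, b₀, s₀, h1, h2, h3⟩ := (hdom x hx).exists_rel hδ4
  have hyb := (distLe_const_iff hy.2.1 h1.1.2.2.1 h1.1.2.2.2).1 (hy.2.2 _ _ _ _ h1 h2) _ hδ4
  obtain ⟨δ₁, hδ₁, k1⟩ := (distLt_const_iff hx.1 h1.1.1 h1.1.2.1).1 h2
  obtain ⟨δ₂, hδ₂, k2⟩ := (distLt_const_iff hx.1 h.1.1 h.1.2.1).1 hxa
  obtain ⟨η, hη, h4⟩ := eventually_mem_ball hx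
  obtain ⟨a', r', ha', hr', hr0, hrη, ⟨k1, k2, k4, -⟩, h5⟩ :=
    exists_small_ball hx.1 (lt_min hδ₁ (lt_min hδ₂ hη))
      (p := fun z => |z - a₀.val| + δ₁ ≤ r₀.val ∧ |z - a.val| + δ₂ ≤ r.val ∧ η ≤ z ∧ z + η ≤ 1)
      (k1.and (k2.and h4))
  have e1 := hrη.trans_le (min_le_left _ _)
  have e2 := hrη.trans_le ((min_le_right _ _).trans (min_le_left _ _))
  have e3 := hrη.trans_le ((min_le_right _ _).trans (min_le_right _ _))
  rw [abs_sub_comm] at k1 k2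
  have g := (isContinuousCode_iff.1 hΦ).2.1 _ _ _ _ a' r' h1 ha' hr' hr0 (by linarith)
  have := ((hΨ _ _ _ _).1 h).2.2.2.2 _ _ _ _ g (by linarith) (by linarith)
  filter_upwards [hyb] with n hn
  have := abs_sub_le ((seq y).val n) b₀.val b.val
  rw [abs_sub_comm b₀.val] at this
  linarith

include hΦ hdom hΨ in
-- The tuple (0, 2^(-m), 0, 2^(-k)) belongs to Ψ when |f| < 2^(-k) on (0, 2^(-m)): a tuple of Φ
-- within that interval is tested against the value of f at its rational center, which exists by
-- arithmetical comprehension.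
theorem inDomain_extension_zero (hACA : M.ACA) (hlim : TendsToZeroAtZeroRight Φ)
    {x : RatSeq M.Num} (hx : x.IsReal) (hx0 : x.Eqv (RatSeq.const 0)) : InDomain Ψ x := by
  refine InDomain.of_exists_rel fun ε hε => ?_
  obtain ⟨k, hk⟩ := exists_tol_lt hε
  obtain ⟨m, d, hd, hm⟩ := hlim k _ (isTwoPow_exp2 k)
  obtain rfl := isTwoPow_iff.1 hd
  have hm1 : tol m ≤ 1 := by
    have h1 : (1 : M.Num) ≤ exp2 m := by
      rw [← zero_add (1 : M.Num), add_one_le_iff]; exact exp2_pos m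
    have := inv_anti₀ (Frac.cast_pos.2 (zero_lt_one' M.Num)) (Frac.cast_le.2 h1)
    simpa [tol] using this
  have hzero : (0 : RatRep M.Num).val = 0 := RatRep.val_zero
  have hkv : (⟨1, 0, exp2 k⟩ : RatRep M.Num).val = tol k := RatRep.val_unit _
  have hmv : (⟨1, 0, exp2 m⟩ : RatRep M.Num).val = tol m := RatRep.val_unit _
  refine ⟨0, ⟨1, 0, exp2 m⟩, 0, ⟨1, 0, exp2 k⟩, (hΨ _ _ _ _).2 ⟨⟨RatRep.zero_den_pos, exp2_pos m,
    RatRep.zero_den_pos, exp2_pos k⟩, ⟨hmv ▸ tol_pos m, hkv ▸ tol_pos k⟩, ?_⟩, ?_, hkv ▸ hk⟩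
  · rw [hzero, hkv, hmv]
    refine ⟨by linarith, fun _ => by simpa using (tol_pos k).le, fun a r b s g g1 g2 => ?_⟩
    rw [zero_sub, abs_neg] at g1
    have hr := g.r_pos
    have ha := le_abs_self a.val
    obtain ⟨A, hA⟩ := exists_seq_const g.1.1
    have hA' : (seq A).InIoo := by
      rw [hA]; exact inIoo_const g.1.1 (by linarith) (by linarith)
    obtain ⟨y, hy⟩ := hACA.exists_isValue hΦ hA'.1 (hdom A hA')
    have h1 := hm A y hA'.1 hA'.2.1 (by
      rw [hA, const_lt_const g.1.1 (exp2_pos m), hmv]; linarith) hy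
    obtain ⟨δ, hδ, h1⟩ := (distLt_const_iff hy.2.1 RatRep.zero_den_pos (exp2_pos k)).1 h1
    have h2 := hy.2.2 _ _ _ _ g (by
      rw [hA, distLt_const_iff (RatSeq.isReal_const g.1.1) g.1.1 g.1.2.1]
      exact ⟨r.val, hr, by simp⟩)
    rw [distLe_const_iff hy.2.1 g.1.2.2.1 g.1.2.2.2] at h2
    obtain ⟨n, h1, h2⟩ := (h1.and (h2 δ hδ)).exists
    rw [hzero, sub_zero, hkv] at h1
    have := abs_sub_le 0 ((seq y).val n) b.val
    simp only [zero_sub, abs_neg] at this ⊢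
    linarith
  · rw [distLt_const_iff hx RatRep.zero_den_pos (exp2_pos m), hmv, hzero]
    refine ⟨tol m / 2, half_pos (tol_pos m), ?_⟩
    filter_upwards [(eqv_zero_iff hx).1 hx0 _ (half_pos (tol_pos m))] with n hn
    rw [sub_zero]
    linarith

include hΨ in
theorem distLe_extension_zero {x : RatSeq M.Num} (hx : x.IsReal) (hx0 : x.Eqv (RatSeq.const 0))
    {a r b s : RatRep M.Num} (h : Rel Ψ a r b s) (hxa : x.DistLt (RatSeq.const a) r) :
    (RatSeq.const 0).DistLe (RatSeq.const b) s := by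
  obtain ⟨δ, hδ, h1⟩ := (distLt_const_iff hx h.1.1 h.1.2.1).1 hxa
  obtain ⟨n, h1, h2⟩ := (h1.and ((eqv_zero_iff hx).1 hx0 _ (half_pos hδ))).exists
  rw [distLe_const_iff (RatSeq.isReal_const RatRep.zero_den_pos) h.1.2.2.1 h.1.2.2.2]
  intro δ' hδ'
  refine Eventually.of_forall fun _ => ?_
  rw [RatSeq.val_const, RatRep.val_zero, zero_sub, abs_neg]
  have := ((hΨ _ _ _ _).1 h).2.2.2.1 (by
    have := le_abs_self (a.val - x.val n)
    have := le_abs_self (x.val n)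
    rw [abs_sub_comm] at h1
    linarith)
  linarith

end Extension

/-- Arithmetical comprehension implies the one-point-extension theorem for codes. -/
theorem ACA.onePointExtension (h : M.ACA) : M.OnePointExtension := by
  intro Φ hΦ hdom hlim
  obtain ⟨Ψ, hΨ⟩ := h.exists_extRel Φ
  refine ⟨Ψ, isContinuousCode_extension hΦ hdom hΨ, fun x hx => ?_, fun x hx => ?_,
    fun x hx hx0 => ⟨inDomain_extension_zero hΦ hdom hΨ h hlim hx hx0,
      RatSeq.isReal_const RatRep.zero_den_pos,
      fun a r b s hr hxa => distLe_extension_zero hΨ hx hx0 hr hxa⟩⟩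
  · rcases (RatSeq.le_iff_lt_or_eqv (RatSeq.isReal_const RatRep.zero_den_pos) hx.1).1 hx.2.1
      with h0 | h0
    · exact inDomain_extension hΦ hdom hΨ ⟨hx.1, h0, hx.2.2⟩
    · exact inDomain_extension_zero hΦ hdom hΨ h hlim hx.1
        (h0.symm (RatSeq.isReal_const RatRep.zero_den_pos) hx.1)
  · obtain ⟨y, hy⟩ := h.exists_isValue hΦ hx.1 (hdom x hx)
    exact ⟨y, hy, isValue_extension hΦ hdom hΨ hx hy⟩

end L2Structure

end ReverseMath

namespace ReverseMath

namespace L2Structure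

variable {M : L2Structure.{u, v}} [hM : Fact M.ModelsRCA]

/-! ### Bounded `Σ⁰₁` comprehension -/

/-- The least number principle for `Π⁰₁` formulas. -/
theorem pi_least {Q : M.Num → M.Num → Prop} (hQ : Dfn M true fun y : Ctx2 M => Q y.1.2 y.2)
    {n : M.Num} (hn : ∀ a, Q n a) : ∃ m, (∀ a, Q m a) ∧ ∀ k, k < m → ¬ ∀ a, Q k a := by
  by_contra! h
  have hQ' := hQ.comp2 (fun y : (Ctx2 M × M.Num) × M.Num => y.1.2) fun y => y.2
  -- If there is no least number with the property, induction shows that it fails at all k ≤ n. A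
  -- common bound t on the counterexamples keeps the statement Σ⁰₁, so no separate collection
  -- principle is needed.
  obtain ⟨t, ht⟩ := sigma_ind (P := fun n t => ∀ k, k ≤ n → ∃ a, a ≤ t ∧ ¬ Q k a) inferInstance
    (by
      by_contra! h'
      obtain ⟨k, hk, -⟩ := h 0 fun a => by
        obtain ⟨k, hk, hk'⟩ := h' a
        obtain rfl : k = 0 := le_antisymm hk zero_le
        exact hk' a le_rfl
      exact absurd zero_le hk.not_ge)
    (fun n ⟨t, ht⟩ => by
      obtain ⟨a, ha⟩ : ∃ a, ¬ Q (n + 1) a := by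
        by_contra! h'
        obtain ⟨k, hk, hk'⟩ := h _ h'
        obtain ⟨a, -, ha⟩ := ht k (lt_add_one_iff.1 hk)
        exact ha (hk' a)
      refine ⟨t + a, fun k hk => ?_⟩
      rcases hk.lt_or_eq with hk | rfl
      · obtain ⟨a', h1, h2⟩ := ht k (lt_add_one_iff.1 hk)
        exact ⟨a', h1.trans le_self_add, h2⟩
      · exact ⟨a, le_add_self, ha⟩) n
  obtain ⟨a, -, ha⟩ := ht n le_rfl
  exact ha (hn a)

/-- A bound on the witnesses, for those `n < l` that have one. -/
theorem exists_bound (T : M.Sets) (l : M.Num) : ∃ K : M.Num, ∀ n, n < l →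
    (∃ w, M.mem (pair n w) T) → ∃ w, w < K ∧ M.mem (pair n w) T := by
  obtain ⟨d, hd0, hd⟩ := exists_multiple (M := M) l
  obtain ⟨c₀, hc0, hc₀⟩ := exists_common_multiple (M := M) l d
  -- Being a common multiple of the moduli of those x < l that have a witness is a Π⁰₁ property of
  -- c. The least such c codes exactly these x, which amounts to bounded Σ⁰₁ comprehension.
  obtain ⟨c, hc, hmin⟩ := pi_least
    (Q := fun c m => 0 < c ∧ ∀ x, x < l → (∃ w, w < m ∧ M.mem (pair x w) T) → modulus d x ∣ c)
    inferInstance (n := c₀) fun m => ⟨hc0, fun x hx _ => hc₀ x hx⟩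
  have key : ∀ {x}, x < l → (modulus d x ∣ c ↔ ∃ w, M.mem (pair x w) T) := by
    intro x hx
    refine modulus_dvd_least (P := fun x => ∃ w, M.mem (pair x w) T) hd0 hd
      ⟨(hc 0).1, fun x hx ⟨w, hw⟩ => (hc (w + 1)).2 x hx ⟨w, lt_add_one_iff.2 le_rfl, hw⟩⟩
      (fun c' hc' h => hmin c' hc' fun m => ⟨h.1, fun x hx ⟨w, _, hw⟩ => h.2 x hx ⟨w, hw⟩⟩) hx
  -- Having a witness is now a bounded condition, namely divisibility of c, so the existence of a
  -- common bound is a Σ⁰₁ statement fit for induction.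
  obtain ⟨K, hK⟩ := sigma_ind (P := fun n K => ∀ x, x < n → x < l → modulus d x ∣ c →
      ∃ w, w < K ∧ M.mem (pair x w) T) inferInstance
    ⟨0, fun x hx => absurd hx not_lt_zero⟩ (fun n ⟨K, hK⟩ => by
      by_cases hn : ∃ w, M.mem (pair n w) T
      · obtain ⟨w, hw⟩ := hn
        refine ⟨K + (w + 1), fun x hx hxl hxc => ?_⟩
        rcases (lt_add_one_iff.1 hx).lt_or_eq with hx | rfl
        · obtain ⟨w', h1, h2⟩ := hK x hx hxl hxc
          exact ⟨w', h1.trans_le le_self_add, h2⟩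
        · exact ⟨w, (lt_add_one_iff.2 le_rfl).trans_le le_add_self, hw⟩
      · refine ⟨K, fun x hx hxl hxc => ?_⟩
        rcases (lt_add_one_iff.1 hx).lt_or_eq with hx | rfl
        · exact hK x hx hxl hxc
        · exact absurd ((key hxl).1 hxc) hn) l
  exact ⟨K, fun n hn h => hK n hn hn ((key hn).2 h)⟩

/-! ### Arithmetical comprehension from `Σ⁰₁` comprehension -/

/-- `Σ⁰₁` comprehension. -/
def SigmaComp (M : L2Structure.{u, v}) : Prop :=
  ∀ T : M.Sets, ∃ X : M.Sets, ∀ n, M.mem n X ↔ ∃ w, M.mem (pair n w) T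

variable (M) in
/-- The finite sequences in `α` are coded by numbers. -/
def Collapsible (α : Type u) [Env M α] : Prop :=
  ∃ code : α → M.Num, Tm code ∧ ∀ P : α → M.Num → Prop,
    (Dfn M true fun y : α × M.Num => P y.1 y.2) →
      ∃ P' : M.Num → M.Num → Prop, (Dfn M true fun y : Ctx2 M => P' y.1.2 y.2) ∧
        ∀ x a, P' (code x) a ↔ P x a

theorem collapsible_punit : Collapsible M PUnit :=
  ⟨fun _ => 0, inferInstance, fun P hP => ⟨fun _ a => P PUnit.unit a,
    hP.comp1 (P := fun a => P PUnit.unit a) fun y : Ctx2 M => y.2, fun _ _ => Iff.rfl⟩⟩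

theorem Tm.get {α : Type u} [Env M α] {i : ℕ} (hi : i < Env.size M α) :
    Tm fun x : α => Env.get (M := M) x i :=
  ⟨fun _ => 0, .var (2 * i), fun _ _ hv => hv.1 i hi⟩

/-- The new entry a is paired with the code of the older ones. To use the hypothesis for the smaller
context, a is temporarily attached to the last argument b. -/
theorem Collapsible.prod {α : Type u} [Env M α] (h : Collapsible M α) :
    Collapsible M (α × M.Num) := by
  obtain ⟨code, hcode, h⟩ := h
  refine ⟨fun y => pair (code y.1) y.2, inferInstance, fun P hP => ?_⟩
  have hP' : Dfn M true fun y : ((α × M.Num) × M.Num) × M.Num => P (y.1.1.1, y.1.2) y.2 := by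
    refine hP.comp (g := fun y : ((α × M.Num) × M.Num) × M.Num => ((y.1.1.1, y.1.2), y.2))
      fun i hi => ?_
    have hi : i < Env.size M α + 1 + 1 := hi
    change Tm fun y : ((α × M.Num) × M.Num) × M.Num => if i = Env.size M α + 1 then y.2 else
      if i = Env.size M α then y.1.2 else Env.get (M := M) y.1.1.1 i
    split_ifs with h1 h2
    · infer_instance
    · infer_instance
    · have := Tm.get (M := M) (α := α) (i := i) (by omega)
      exact Tm.proj_comp (fun x : α => Env.get (M := M) x i) _
  obtain ⟨P', hP', hPP'⟩ := h
    (fun x z => ∃ a, a ≤ z ∧ ∃ b, b ≤ z ∧ (z = pair a b ∧ P (x, a) b)) inferInstance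
  have := hP'.comp2 (fun y : (Ctx2 M × M.Num) × M.Num => y.1.2) fun y => pair y.2 y.1.1.2
  refine ⟨fun e b => ∃ c, c ≤ e ∧ ∃ a, a ≤ e ∧ (e = pair c a ∧ P' c (pair a b)),
    inferInstance, fun x b => ?_⟩
  constructor
  · rintro ⟨c, -, a, -, hca, h⟩
    obtain ⟨rfl, rfl⟩ := pair_inj.1 hca
    obtain ⟨a', -, b', -, hab, h⟩ := (hPP' _ _).1 h
    obtain ⟨rfl, rfl⟩ := pair_inj.1 hab
    exact h
  · intro h
    exact ⟨_, le_pair_left _ _, _, le_pair_right _ _, rfl, (hPP' _ _).2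
      ⟨_, le_pair_left _ _, _, le_pair_right _ _, rfl, h⟩⟩

/-- Once the context is coded by one number, the failure of ∀ a, P x a is a Σ⁰₁ property of that
number, hence membership in a set. An unbounded quantifier is thus traded for a set parameter, and
the formula stays bounded. -/
theorem SigmaComp.all (hS : SigmaComp M) {α : Type u} [Env M α] (h : Collapsible M α)
    {P : α → M.Num → Prop} (hP : Dfn M true fun y : α × M.Num => P y.1 y.2) :
    Dfn M true fun x => ∀ a, P x a := by
  obtain ⟨code, hcode, h⟩ := h
  obtain ⟨P', hP', hPP'⟩ := h P hP
  have := hP'.comp2 (fun y : (Ctx1 M × M.Num) × M.Num => y.1.2) fun y => y.2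
  obtain ⟨T, hT⟩ := bdd_comp
    (P := fun m => ∃ c, c ≤ m ∧ ∃ a, a ≤ m ∧ (m = pair c a ∧ ¬ P' c a)) inferInstance
  obtain ⟨X, hX⟩ := hS T
  refine (inferInstance : Dfn M true fun x => ¬ M.mem (code x) X).congr fun x => ?_
  rw [hX, not_exists]
  refine forall_congr' fun a => ?_
  rw [hT, ← hPP']
  constructor
  · rintro h ⟨c, -, a', -, hca, h'⟩
    obtain ⟨rfl, rfl⟩ := pair_inj.1 hca
    exact h' h
  · intro h
    by_contra h'
    exact h ⟨_, le_pair_left _ _, _, le_pair_right _ _, rfl, h'⟩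

/-- By induction on the formula, each unbounded quantifier disappears into a set parameter; so every
arithmetical formula becomes bounded, and bounded comprehension suffices. -/
theorem SigmaComp.holds (hS : SigmaComp M) {V : ℕ → M.Sets} : ∀ (A : ArithFormula)
    {α : Type u} [Env M α] {f : α → ℕ → M.Num}, Collapsible M α → (∀ i, Tm fun x => f x i) →
      Dfn M true fun x => Holds V (f x) A
  | .eq t s, _, _, _, _, hf => Dfn.holds (.eq t s) (fun _ => trivial) hf
  | .lt t s, _, _, _, _, hf => Dfn.holds (.lt t s) (fun _ => trivial) hf
  | .mem t j, _, _, _, _, hf => Dfn.holds (.mem t j) (fun _ => trivial) hf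
  | .not A, _, _, f, hα, hf => by
    have := hS.holds (V := V) A hα hf
    exact Dfn.not fun x => Holds V (f x) A
  | .and A B, _, _, f, hα, hf => by
    have := hS.holds (V := V) A hα hf
    have := hS.holds (V := V) B hα hf
    exact Dfn.and (fun x => Holds V (f x) A) fun x => Holds V (f x) B
  | .ball i t A, α, _, f, hα, hf => by
    have := Tm.eval hf t
    have := hS.holds (V := V) A (f := fun y : α × M.Num => Function.update (f y.1) i y.2)
      hα.prod fun j => by
        by_cases hj : j = i
        · subst hj; simpa using Tm.var0
        · simpa [Function.update_of_ne hj] using @Tm.weaken _ _ _ _ (hf j)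
    exact Dfn.ball (fun x => L2Structure.eval (f x) t)
      fun x a => Holds V (Function.update (f x) i a) A
  | .all i A, α, _, f, hα, hf => by
    refine hS.all (P := fun x a => Holds V (Function.update (f x) i a) A) hα ?_
    refine hS.holds (V := V) A (f := fun y : α × M.Num => Function.update (f y.1) i y.2)
      hα.prod fun j => ?_
    by_cases hj : j = i
    · subst hj; simpa using Tm.var0
    · simpa [Function.update_of_ne hj] using @Tm.weaken _ _ _ _ (hf j)

theorem SigmaComp.aca (hS : SigmaComp M) : M.ACA := by
  intro A V v i
  refine bdd_comp (P := fun n => Holds V (Function.update v i n) A)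
    (hS.holds (f := fun y : Ctx1 M => Function.update v i y.2) A collapsible_punit.prod
      fun j => ?_)
  by_cases hj : j = i
  · subst hj; simpa using Tm.var0
  · simpa [Function.update_of_ne hj] using Tm.const (v j)

end L2Structure

end ReverseMath

/-! ### The supremum of the bumps and its code -/

namespace ReverseMath

namespace RatRep

section

variable {N : Type u} [NumOps N]

/-- The product of a natural number and a signed quotient. -/
def nmul (k : N) (a : RatRep N) : RatRep N := ⟨k * a.pos, k * a.neg, a.den⟩

/-- A natural number as a signed quotient. -/
def ofNum (k : N) : RatRep N := ⟨k, 0, 1⟩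

end

variable {N : Type u} [NumOps N] [ArithLaws N]

theorem val_nmul (k : N) (a : RatRep N) : (nmul k a).val = Frac.cast k * a.val := by
  simp only [nmul, val, map_mul]; ring

theorem val_ofNum (k : N) : (ofNum k).val = Frac.cast k := by
  simp [ofNum, val]

theorem val_quot (i d : N) : (⟨i, 0, d⟩ : RatRep N).val = Frac.cast i / Frac.cast d := by
  simp [val]

/-- Different rationals differ by at least the inverse of the product of the denominators. -/
theorem inv_le_sub {a b : RatRep N} (ha : 0 < a.den) (hb : 0 < b.den) (h : a < b) :
    (Frac.cast (a.den * b.den))⁻¹ ≤ b.val - a.val := by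
  have h1 := Frac.cast_pos.2 ha
  have h2 := Frac.cast_pos.2 hb
  have h : a.pos * b.den + b.neg * a.den < b.pos * a.den + a.neg * b.den := h
  have h := Frac.cast_le.2 (add_one_le_iff.2 h)
  simp only [map_add, map_mul, map_one] at h
  rw [map_mul, val, val, div_sub_div _ _ h2.ne' h1.ne', inv_eq_one_div,
    div_le_div_iff₀ (mul_pos h1 h2) (mul_pos h2 h1), mul_comm (Frac.cast b.den)]
  exact mul_le_mul_of_nonneg_right (by linarith) (mul_pos h1 h2).le

end RatRep

namespace L2Structure

open Filter

set_option synthInstance.maxSize 1000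
set_option synthInstance.maxHeartbeats 100000

variable {M : L2Structure.{u, v}} [hM : Fact M.ModelsRCA] {T Φ : M.Sets}

instance {α : Type u} [Env M α] (k : α → M.Num) (a : α → RatRep M.Num) [Tm k] [RatTm a] :
    RatTm fun x => RatRep.nmul (k x) (a x) := by
  unfold RatRep.nmul; infer_instance

instance {α : Type u} [Env M α] (k : α → M.Num) [Tm k] :
    RatTm fun x => RatRep.ofNum (k x) := by
  unfold RatRep.ofNum; infer_instance

/-- The height of the bumps that indicate membership of `n`. -/
noncomputable def hgt (n : M.Num) : Frac M.Num := (Frac.cast (n + 1 + 1))⁻¹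

/-- A bump of height `hgt n` with its peak at `1 / (m + 1)`. -/
noncomputable def tent (n m : M.Num) (x : Frac M.Num) : Frac M.Num :=
  hgt n - |Frac.cast ((m + 1) * (m + 1)) * x - Frac.cast (m + 1)|

theorem hgt_pos (n : M.Num) : 0 < hgt n :=
  inv_pos.2 (Frac.cast_pos.2 (lt_of_lt_of_le zero_lt_one le_add_self))

theorem hgt_le_half (n : M.Num) : hgt n ≤ 1 / 2 := by
  rw [hgt, inv_eq_one_div]
  refine one_div_le_one_div_of_le two_pos ?_
  have := Frac.cast_nonneg n
  simp only [map_add, map_one]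
  linarith

theorem hgt_anti {n n' : M.Num} (h : n ≤ n') : hgt n' ≤ hgt n := by
  refine inv_anti₀ (Frac.cast_pos.2 (lt_of_lt_of_le zero_lt_one le_add_self)) (Frac.cast_le.2 ?_)
  gcongr

theorem tent_le_hgt (n m : M.Num) (x : Frac M.Num) : tent n m x ≤ hgt n :=
  sub_le_self _ (abs_nonneg _)

/-- To the right of 1 / k only the bumps with index below k are positive: for m ≥ k the argument of
the absolute value is (m + 1)((m + 1) x - 1) ≥ (m + 1) x ≥ 1, which exceeds the height. -/
theorem tent_le_zero {n m k : M.Num} {x : Frac M.Num} (hx : 1 ≤ Frac.cast k * x) (hk : k ≤ m) :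
    tent n m x ≤ 0 := by
  have h1 := hgt_le_half n
  have hk0 := Frac.cast_nonneg k
  have hx0 : 0 < x := by
    by_contra! h
    nlinarith
  have hkm := Frac.cast_le.2 hk
  have h2 := le_abs_self (Frac.cast ((m + 1) * (m + 1)) * x - Frac.cast (m + 1))
  have h3 : 1 ≤ Frac.cast ((m + 1) * (m + 1)) * x - Frac.cast (m + 1) := by
    simp only [map_mul, map_add, map_one]
    have h4 : 1 ≤ Frac.cast m * x := hx.trans (by gcongr)
    nlinarith [Frac.cast_nonneg m]
  rw [tent]
  linarith

theorem tent_le_zero_of_small {n m : M.Num} {x : Frac M.Num}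
    (hx : Frac.cast (m + 1) * x ≤ 1 / 2) : tent n m x ≤ 0 := by
  have h1 := hgt_le_half n
  have h2 := neg_le_abs (Frac.cast ((m + 1) * (m + 1)) * x - Frac.cast (m + 1))
  have hm := Frac.cast_nonneg m
  have h3 : (1 : Frac M.Num) ≤ Frac.cast (m + 1) := by rw [map_add, map_one]; linarith
  rw [tent]
  rw [map_mul] at h2 ⊢
  nlinarith

theorem tent_peak {n m : M.Num} {x : Frac M.Num} (hx : Frac.cast (m + 1) * x = 1) :
    tent n m x = hgt n := by
  rw [tent, map_mul, mul_assoc, hx, mul_one, sub_self, abs_zero, sub_zero]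

/-- The bumps with index below k share the Lipschitz constant k²; this is the origin of the
correction k² r in `BumpVal`. -/
theorem tent_sub_le {n m k : M.Num} (h : m < k) (x y : Frac M.Num) :
    tent n m x ≤ tent n m y + Frac.cast (k * k) * |x - y| := by
  have h1 := abs_sub_abs_le_abs_sub (Frac.cast ((m + 1) * (m + 1)) * y - Frac.cast (m + 1))
    (Frac.cast ((m + 1) * (m + 1)) * x - Frac.cast (m + 1))
  have h2 : Frac.cast ((m + 1) * (m + 1)) * |x - y| ≤ Frac.cast (k * k) * |x - y| := by
    gcongr
    have := add_one_le_iff.2 h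
    exact Frac.cast_le.2 (by gcongr)
  rw [sub_sub_sub_cancel_right, ← mul_sub, abs_mul, abs_of_nonneg (Frac.cast_nonneg _),
    abs_sub_comm y x] at h1
  rw [tent, tent]
  linarith

/-- The supremum of the first `k` bumps has at `x` a value of at most `c`. -/
def Upper (T : M.Sets) (k : M.Num) (x c : Frac M.Num) : Prop :=
  0 ≤ c ∧ ∀ n w, M.mem (pair n w) T → pair n w < k → tent n (pair n w) x ≤ c

/-- The supremum of the first `k` bumps has at `x` a value of at least `c`. -/
def Lower (T : M.Sets) (k : M.Num) (x c : Frac M.Num) : Prop :=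
  c ≤ 0 ∨ ∃ n w, M.mem (pair n w) T ∧ pair n w < k ∧ c ≤ tent n (pair n w) x

/-- The relation `Upper T k a (c - e)` for rationals. -/
def UpperRat (T : M.Sets) (k : M.Num) (a c e : RatRep M.Num) : Prop :=
  e ≤ c ∧ ∀ m, m < k → M.mem m T → ∀ n, n ≤ m → ∀ w, w ≤ m → m = pair n w →
    (⟨1, 0, n + 1 + 1⟩ + RatRep.ofNum (m + 1) + e ≤ c + RatRep.nmul ((m + 1) * (m + 1)) a ∨
      ⟨1, 0, n + 1 + 1⟩ + RatRep.nmul ((m + 1) * (m + 1)) a + e ≤ c + RatRep.ofNum (m + 1))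

/-- The relation `Lower T k a (e - c)` for rationals. -/
def LowerRat (T : M.Sets) (k : M.Num) (a c e : RatRep M.Num) : Prop :=
  e ≤ c ∨ ∃ m, m < k ∧ (M.mem m T ∧ ∃ n, n ≤ m ∧ ∃ w, w ≤ m ∧ (m = pair n w ∧
    (e + RatRep.nmul ((m + 1) * (m + 1)) a ≤ ⟨1, 0, n + 1 + 1⟩ + RatRep.ofNum (m + 1) + c ∧
      e + RatRep.ofNum (m + 1) ≤ ⟨1, 0, n + 1 + 1⟩ + RatRep.nmul ((m + 1) * (m + 1)) a + c)))

theorem dfn_upperRat {α : Type u} [Env M α] (k : α → M.Num) (a c e : α → RatRep M.Num) [Tm k]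
    [RatTm a] [RatTm c] [RatTm e] : Dfn M true fun x => UpperRat T (k x) (a x) (c x) (e x) := by
  unfold UpperRat; infer_instance

theorem dfn_lowerRat {α : Type u} [Env M α] (k : α → M.Num) (a c e : α → RatRep M.Num) [Tm k]
    [RatTm a] [RatTm c] [RatTm e] : Dfn M true fun x => LowerRat T (k x) (a x) (c x) (e x) := by
  unfold LowerRat; infer_instance

section

variable {k : M.Num} {a c e : RatRep M.Num} (ha : 0 < a.den) (hc : 0 < c.den) (he : 0 < e.den)

include ha hc he

omit hc he in
theorem val_bump_add (n m : M.Num) {d : RatRep M.Num} (hd : 0 < d.den) :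
    ((⟨1, 0, n + 1 + 1⟩ + RatRep.ofNum (m + 1) + d).val =
      hgt n + Frac.cast (m + 1) + d.val ∧
    (⟨1, 0, n + 1 + 1⟩ + RatRep.nmul ((m + 1) * (m + 1)) a + d).val =
      hgt n + Frac.cast ((m + 1) * (m + 1)) * a.val + d.val) ∧
    (d + RatRep.nmul ((m + 1) * (m + 1)) a).val =
      d.val + Frac.cast ((m + 1) * (m + 1)) * a.val ∧
    (d + RatRep.ofNum (m + 1)).val = d.val + Frac.cast (m + 1) := by
  have hH : 0 < (⟨1, 0, n + 1 + 1⟩ : RatRep M.Num).den := lt_of_lt_of_le zero_lt_one le_add_self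
  have hJ : 0 < (RatRep.ofNum (m + 1)).den := zero_lt_one' M.Num
  have hA : 0 < (RatRep.nmul ((m + 1) * (m + 1)) a).den := ha
  rw [RatRep.val_add (RatRep.add_den_pos hH hJ) hd, RatRep.val_add hH hJ,
    RatRep.val_add (RatRep.add_den_pos hH hA) hd, RatRep.val_add hH hA, RatRep.val_add hd hA,
    RatRep.val_add hd hJ, RatRep.val_nmul, RatRep.val_ofNum, RatRep.val_unit]
  exact ⟨⟨rfl, rfl⟩, rfl, rfl⟩

theorem tent_le_iff (n m : M.Num) : tent n m a.val ≤ c.val - e.val ↔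
    (⟨1, 0, n + 1 + 1⟩ + RatRep.ofNum (m + 1) + e ≤ c + RatRep.nmul ((m + 1) * (m + 1)) a ∨
      ⟨1, 0, n + 1 + 1⟩ + RatRep.nmul ((m + 1) * (m + 1)) a + e ≤ c + RatRep.ofNum (m + 1)) := by
  have hH : 0 < (⟨1, 0, n + 1 + 1⟩ : RatRep M.Num).den := lt_of_lt_of_le zero_lt_one le_add_self
  have hJ : 0 < (RatRep.ofNum (m + 1)).den := zero_lt_one' M.Num
  have hA : 0 < (RatRep.nmul ((m + 1) * (m + 1)) a).den := ha
  have h1 := val_bump_add ha n m he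
  have h2 := val_bump_add ha n m hc
  rw [← RatRep.val_le (RatRep.add_den_pos (RatRep.add_den_pos hH hJ) he)
    (RatRep.add_den_pos hc hA), ← RatRep.val_le (RatRep.add_den_pos (RatRep.add_den_pos hH hA) he)
    (RatRep.add_den_pos hc hJ), h1.1.1, h1.1.2, h2.2.1, h2.2.2, tent, sub_le_comm, le_abs]
  refine or_congr ?_ ?_ <;> constructor <;> intro h <;> linarith

theorem le_tent_iff (n m : M.Num) : e.val - c.val ≤ tent n m a.val ↔
    (e + RatRep.nmul ((m + 1) * (m + 1)) a ≤ ⟨1, 0, n + 1 + 1⟩ + RatRep.ofNum (m + 1) + c ∧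
      e + RatRep.ofNum (m + 1) ≤ ⟨1, 0, n + 1 + 1⟩ + RatRep.nmul ((m + 1) * (m + 1)) a + c) := by
  have hH : 0 < (⟨1, 0, n + 1 + 1⟩ : RatRep M.Num).den := lt_of_lt_of_le zero_lt_one le_add_self
  have hJ : 0 < (RatRep.ofNum (m + 1)).den := zero_lt_one' M.Num
  have hA : 0 < (RatRep.nmul ((m + 1) * (m + 1)) a).den := ha
  have h1 := val_bump_add ha n m he
  have h2 := val_bump_add ha n m hc
  rw [← RatRep.val_le (RatRep.add_den_pos he hA)
    (RatRep.add_den_pos (RatRep.add_den_pos hH hJ) hc), ← RatRep.val_le (RatRep.add_den_pos he hJ)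
    (RatRep.add_den_pos (RatRep.add_den_pos hH hA) hc), h2.1.1, h2.1.2, h1.2.1, h1.2.2, tent,
    le_sub_comm, abs_le, and_comm]
  refine and_congr ?_ ?_ <;> constructor <;> intro h <;> linarith

theorem upperRat_iff : UpperRat T k a c e ↔ Upper T k a.val (c.val - e.val) := by
  refine and_congr (by rw [← RatRep.val_le he hc, sub_nonneg]) ?_
  simp only [tent_le_iff ha hc he]
  constructor
  · exact fun h n w hT hk => h _ hk hT n (le_pair_left _ _) w (le_pair_right _ _) rfl
  · rintro h m hk hT n - w - rfl
    exact h n w hT hk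

theorem lowerRat_iff : LowerRat T k a c e ↔ Lower T k a.val (e.val - c.val) := by
  refine or_congr (by rw [← RatRep.val_le he hc, sub_nonpos]) ?_
  simp only [le_tent_iff ha hc he]
  constructor
  · rintro ⟨m, hk, hT, n, -, w, -, rfl, h⟩
    exact ⟨n, w, hT, hk, h⟩
  · rintro ⟨n, w, hT, hk, h⟩
    exact ⟨_, hk, hT, n, le_pair_left _ _, w, le_pair_right _ _, rfl, h⟩

end

namespace Upper

variable {k k' : M.Num} {x y c c' : Frac M.Num}

theorem mono (h : Upper T k x c) (hc : c ≤ c') : Upper T k x c' :=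
  ⟨h.1.trans hc, fun n w hT hk => (h.2 n w hT hk).trans hc⟩

/-- Bumps with index at least k are nonpositive at x ≥ 1 / k. An upper bound for the first k bumps
therefore dominates all lower bounds, whatever number of bumps they involve. -/
theorem lower_le (h : Upper T k x c) (hx : 1 ≤ Frac.cast k * x) (h' : Lower T k' x c') :
    c' ≤ c := by
  rcases h' with h' | ⟨n, w, hT, -, h'⟩
  · exact h'.trans h.1
  · by_cases hk : pair n w < k
    · exact h'.trans (h.2 n w hT hk)
    · exact (h'.trans (tent_le_zero hx (not_lt.1 hk))).trans h.1

theorem move (h : Upper T k x c) (y : Frac M.Num) :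
    Upper T k y (c + Frac.cast (k * k) * |x - y|) := by
  have h0 := mul_nonneg (Frac.cast_nonneg (k * k)) (abs_nonneg (x - y))
  refine ⟨add_nonneg h.1 h0, fun n w hT hk => ?_⟩
  have h1 := tent_sub_le (n := n) hk y x
  rw [abs_sub_comm y x] at h1
  have := h.2 n w hT hk
  linarith

end Upper

namespace Lower

variable {k : M.Num} {x y c c' : Frac M.Num}

theorem mono (h : Lower T k x c) (hc : c' ≤ c) : Lower T k x c' :=
  h.imp hc.trans fun ⟨n, w, hT, hk, h⟩ => ⟨n, w, hT, hk, hc.trans h⟩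

theorem move (h : Lower T k x c) (y : Frac M.Num) :
    Lower T k y (c - Frac.cast (k * k) * |x - y|) := by
  have h0 := mul_nonneg (Frac.cast_nonneg (k * k)) (abs_nonneg (x - y))
  rcases h with h | ⟨n, w, hT, hk, h⟩
  · exact Or.inl (by linarith)
  · refine Or.inr ⟨n, w, hT, hk, ?_⟩
    have := tent_sub_le (n := n) hk x y
    linarith

end Lower

/-- Approximations to the supremum of finitely many bumps. -/
theorem exists_upper_lower (T : M.Sets) (k : M.Num) {a : RatRep M.Num} (ha : 0 < a.den) {d : M.Num}
    (hd : 0 < d) : ∃ b : RatRep M.Num, 0 < b.den ∧ Upper T k a.val b.val ∧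
      Lower T k a.val (b.val - (Frac.cast d)⁻¹) := by
  have hd0 := Frac.cast_pos.2 hd
  have key : ∀ i : M.Num, UpperRat T k a ⟨i, 0, d⟩ 0 ↔
      Upper T k a.val (Frac.cast i / Frac.cast d) := fun i => by
    rw [upperRat_iff ha (c := ⟨i, 0, d⟩) hd RatRep.zero_den_pos, RatRep.val_zero, sub_zero,
      RatRep.val_quot]
  -- The least multiple i / d of 1 / d that is an upper bound; it exists because d / d = 1 is one.
  -- If i ≠ 0, some bump exceeds (i - 1) / d.
  obtain ⟨i, hi, hmin⟩ := bdd_least (P := fun i => UpperRat T k a ⟨i, 0, d⟩ 0)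
    (dfn_upperRat (fun _ => k) (fun _ => a) (fun y : Ctx1 M => ⟨y.2, 0, d⟩) fun _ => 0) (n := d)
    ((key d).2 (by
      rw [div_self hd0.ne']
      exact ⟨zero_le_one, fun n w _ _ => (tent_le_hgt _ _ _).trans
        ((hgt_le_half n).trans (by norm_num))⟩))
  refine ⟨⟨i, 0, d⟩, hd, ?_, ?_⟩
  · rw [RatRep.val_quot]; exact (key i).1 hi
  rw [RatRep.val_quot]
  rcases eq_or_ne i 0 with rfl | hi0
  · left
    have := inv_pos.2 hd0
    rw [map_zero, zero_div]
    linarith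
  obtain ⟨j, hj⟩ := exists_add_of_le (show 1 ≤ i by
    rw [← zero_add (1 : M.Num), add_one_le_iff]; exact pos_iff_ne_zero.2 hi0)
  have hj' := hmin j (by rw [hj, add_comm, lt_add_one_iff])
  rw [key] at hj'
  have hji : Frac.cast i / Frac.cast d - (Frac.cast d)⁻¹ = Frac.cast j / Frac.cast d := by
    rw [hj, map_add, map_one]; field_simp; ring
  rw [hji]
  by_contra hlow
  refine hj' ⟨div_nonneg (Frac.cast_nonneg _) hd0.le, fun n w hT hk => ?_⟩
  by_contra! h
  exact hlow (Or.inr ⟨n, w, hT, hk, h.le⟩)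

/-- The relation between rationals that codes the supremum of the bumps. -/
def BumpVal (T : M.Sets) (a r b s : Frac M.Num) : Prop :=
  -- The first condition puts the ball to the right of 1 / k, so that the first k bumps determine
  -- the supremum; the terms k² r allow for their variation across the ball.
  ∃ k : M.Num, 1 ≤ Frac.cast k * (a - r) ∧ Upper T k a (b + s - Frac.cast (k * k) * r) ∧
    Lower T k a (b - s + Frac.cast (k * k) * r)

theorem exists_bumpVal (T : M.Sets) : ∃ Φ : M.Sets, ∀ a r b s, Rel Φ a r b s ↔
    (0 < a.den ∧ 0 < r.den ∧ 0 < b.den ∧ 0 < s.den) ∧ (0 < r.val ∧ 0 < s.val) ∧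
      BumpVal T a.val r.val b.val s.val := by
  obtain ⟨Φ, hΦ⟩ := exists_rel (M := M) (b := true) (fun P hP => bdd_comp hP)
    (fun k a r b s => 1 + RatRep.nmul k r ≤ RatRep.nmul k a ∧
      (UpperRat T k a (b + s) (RatRep.nmul (k * k) r) ∧
        LowerRat T k a s (b + RatRep.nmul (k * k) r))) (by
    intro γ _ k a r b s _ _ _ _ _
    have := dfn_upperRat (T := T) k a (fun x => b x + s x) fun x => RatRep.nmul (k x * k x) (r x)
    have := dfn_lowerRat (T := T) k a s fun x => b x + RatRep.nmul (k x * k x) (r x)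
    infer_instance)
  refine ⟨Φ, fun a r b s => (hΦ a r b s).trans (and_congr_right fun hd => ?_)⟩
  obtain ⟨ha, hr, hb, hs⟩ := hd
  refine and_congr (by rw [RatRep.val_pos hr, RatRep.val_pos hs]) (exists_congr fun k =>
    and_congr ?_ (and_congr ?_ ?_))
  · rw [← RatRep.val_le (RatRep.add_den_pos RatRep.one_den_pos (b := RatRep.nmul k r) hr)
      (b := RatRep.nmul k a) ha, RatRep.val_add RatRep.one_den_pos (b := RatRep.nmul k r) hr,
      RatRep.val_one, RatRep.val_nmul, RatRep.val_nmul, mul_sub, le_sub_iff_add_le]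
  · rw [upperRat_iff ha (RatRep.add_den_pos hb hs) (e := RatRep.nmul (k * k) r) hr,
      RatRep.val_add hb hs, RatRep.val_nmul]
  · rw [lowerRat_iff ha hs (RatRep.add_den_pos hb (b := RatRep.nmul (k * k) r) hr),
      RatRep.val_add hb (b := RatRep.nmul (k * k) r) hr, RatRep.val_nmul, add_sub_right_comm]

section Bumps

variable (hΦ : ∀ a r b s, Rel Φ a r b s ↔
  (0 < a.den ∧ 0 < r.den ∧ 0 < b.den ∧ 0 < s.den) ∧ (0 < r.val ∧ 0 < s.val) ∧
    BumpVal T a.val r.val b.val s.val)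

include hΦ in
-- Consistency compares upper and lower bounds at the common center. Shrinking moves the bounds to
-- the new center, and the margin k² (r - r') pays for the move.
theorem isContinuousCode_bumps : IsContinuousCode Φ := by
  have key : ∀ {a r b s b' s'}, Rel Φ a r b s → Rel Φ a r b' s' →
      b'.val - b.val ≤ s.val + s'.val := by
    intro a r b s b' s' h h'
    obtain ⟨-, ⟨hr, -⟩, k, hk, hU, -⟩ := (hΦ _ _ _ _).1 h
    obtain ⟨-, -, k', -, -, hL⟩ := (hΦ _ _ _ _).1 h'
    have h1 := hU.lower_le (hk.trans (mul_le_mul_of_nonneg_left (by linarith)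
      (Frac.cast_nonneg k))) hL
    have := mul_nonneg (Frac.cast_nonneg (k * k)) hr.le
    have := mul_nonneg (Frac.cast_nonneg (k' * k')) hr.le
    linarith
  refine isContinuousCode_iff.2 ⟨fun a r b s b' s' h h' => ?_,
    fun a r b s a' r' h ha' hr' hr0 hlt => ?_, fun a r b s b' s' h hb' hs' hlt => ?_⟩
  · have := key h h'
    have := key h' h
    rw [abs_le]
    constructor <;> linarith
  · obtain ⟨hd, ⟨-, hs⟩, k, hk, hU, hL⟩ := (hΦ _ _ _ _).1 h
    have h1 := abs_lt.1 (lt_sub_iff_add_lt.2 hlt)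
    have h2 := mul_le_mul_of_nonneg_left hlt.le (Frac.cast_nonneg (k * k))
    rw [mul_add] at h2
    refine (hΦ _ _ _ _).2 ⟨⟨ha', hr', hd.2.2⟩, ⟨hr0, hs⟩, k, hk.trans
      (mul_le_mul_of_nonneg_left (by linarith) (Frac.cast_nonneg k)),
      (hU.move a'.val).mono (by linarith), (hL.move a'.val).mono (by linarith)⟩
  · obtain ⟨hd, ⟨hr, hs⟩, k, hk, hU, hL⟩ := (hΦ _ _ _ _).1 h
    have h1 := abs_lt.1 (lt_sub_iff_add_lt.2 hlt)
    refine (hΦ _ _ _ _).2 ⟨⟨hd.1, hd.2.1, hb', hs'⟩, ⟨hr, by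
      have := abs_nonneg (b.val - b'.val); linarith⟩, k, hk, hU.mono (by linarith),
      hL.mono (by linarith)⟩

include hΦ in
theorem inDomain_bumps {x : RatSeq M.Num} (hx : x.InIoo) : InDomain Φ x := by
  refine InDomain.of_exists_rel fun ε hε => ?_
  obtain ⟨η, hη, h1⟩ := eventually_mem_ball hx
  -- With a - r ≥ η / 2 this k satisfies 1 ≤ k (a - r). Below, 1 / d < ε / 2 and k² r < ε / 2, so s
  -- = 1 / d + k² r stays below ε.
  obtain ⟨k, hk⟩ := exists_cast_gt (2 / η)
  obtain ⟨d, hd⟩ := exists_cast_gt (2 / ε)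
  rw [div_lt_iff₀ hη] at hk
  rw [div_lt_iff₀ hε] at hd
  have hk0 : 0 < Frac.cast k := by
    by_contra! h
    nlinarith
  have hd0 : 0 < Frac.cast d := by
    by_contra! h
    nlinarith
  have hkk : 0 < Frac.cast (k * k) := by rw [map_mul]; exact mul_pos hk0 hk0
  have hε' : 0 < ε / (2 * Frac.cast (k * k)) := div_pos hε (by linarith)
  obtain ⟨a, r, ha, hr, hr0, hrη, ⟨h1, -⟩, hxa⟩ := exists_small_ball hx.1
    (lt_min (half_pos hη) hε') (p := fun z => η ≤ z ∧ z + η ≤ 1) h1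
  have hr1 := hrη.trans_le (min_le_left _ _)
  have hr2 := hrη.trans_le (min_le_right _ _)
  rw [lt_div_iff₀ (by linarith)] at hr2
  obtain ⟨b, hb, hU, hL⟩ := exists_upper_lower T k ha (Frac.cast_pos.1 hd0)
  obtain ⟨s, hs, hsv⟩ := RatRep.exists_val_eq ((Frac.cast d)⁻¹ + Frac.cast (k * k) * r.val)
  have hdε : (Frac.cast d)⁻¹ < ε / 2 := by
    rw [inv_lt_iff_one_lt_mul₀ hd0]; linarith
  have hd1 := inv_pos.2 hd0
  have hkr := mul_pos hkk hr0
  refine ⟨a, r, b, s, (hΦ _ _ _ _).2 ⟨⟨ha, hr, hb, hs⟩, ⟨hr0, by linarith⟩, k, ?_,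
    hU.mono (by linarith), hL.mono (by linarith)⟩, hxa, by linarith⟩
  have : η / 2 ≤ a.val - r.val := by linarith
  have := mul_le_mul_of_nonneg_left this hk0.le
  linarith

end Bumps

end L2Structure

end ReverseMath

/-! ### Limit at 0 and peaks of the bump function -/

namespace ReverseMath

namespace L2Structure

open Filter

set_option synthInstance.maxSize 1000
set_option synthInstance.maxHeartbeats 100000

variable {M : L2Structure.{u, v}} [hM : Fact M.ModelsRCA] {T Φ : M.Sets}

section Bumps

variable (hΦ : ∀ a r b s, Rel Φ a r b s ↔
  (0 < a.den ∧ 0 < r.den ∧ 0 < b.den ∧ 0 < s.den) ∧ (0 < r.val ∧ 0 < s.val) ∧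
    BumpVal T a.val r.val b.val s.val)

theorem Rel.recenter (hcode : IsContinuousCode Φ) {x : RatSeq M.Num} (hx : x.IsReal)
    {a r b s : RatRep M.Num} (h : Rel Φ a r b s) (hxa : x.DistLt (RatSeq.const a) r)
    {p : Frac M.Num → Prop} (hp : ∀ᶠ n in atTop, p (x.val n)) :
    ∃ a' r' : RatRep M.Num, Rel Φ a' r' b s ∧ p a'.val ∧ x.DistLt (RatSeq.const a') r' := by
  obtain ⟨δ, hδ, h1⟩ := (distLt_const_iff hx h.1.1 h.1.2.1).1 hxa
  obtain ⟨a', r', ha', hr', hr0, hrδ, ⟨h1, h2⟩, hxa'⟩ := exists_small_ball hx hδ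
    (p := fun z => |z - a.val| + δ ≤ r.val ∧ p z) (h1.and hp)
  refine ⟨a', r', (isContinuousCode_iff.1 hcode).2.1 _ _ _ _ _ _ h ha' hr' hr0 ?_, h2, hxa'⟩
  rw [abs_sub_comm]
  linarith

/-- Near `0` the supremum of the bumps is small. -/
theorem exists_upper_near_zero (hT : ∀ n w w', M.mem (pair n w) T → M.mem (pair n w') T → w = w')
    (l : M.Num) : ∃ m : M.Num, ∀ x : Frac M.Num, x ≤ tol m →
      ∀ n w, M.mem (pair n w) T → tent n (pair n w) x ≤ hgt l := by
  -- Bumps with n ≥ l are low everywhere. Those with n < l have their unique witness below K, so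
  -- their index is below `pair l K`; they are nonpositive for x ≤ 1 / (2 (pair l K + 1)).
  obtain ⟨K, hK⟩ := exists_bound T l
  obtain ⟨m, hm⟩ := exists_tol_lt (N := M.Num) (δ := (2 * (Frac.cast (pair l K) + 1))⁻¹)
    (inv_pos.2 (by have := Frac.cast_nonneg (pair l K); linarith))
  refine ⟨m, fun x hx n w hnw => ?_⟩
  by_cases hn : n < l
  · obtain ⟨w', hw', hnw'⟩ := hK n hn ⟨w, hnw⟩
    obtain rfl := hT _ _ _ hnw hnw'
    refine (tent_le_zero_of_small ?_).trans (hgt_pos l).le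
    have h1 : Frac.cast (pair n w) ≤ Frac.cast (pair l K) :=
      Frac.cast_le.2 (pair_lt_of_add_lt (add_lt_add hn hw')).le
    have h2 := Frac.cast_nonneg (pair n w)
    rw [inv_eq_one_div, lt_div_iff₀ (by linarith)] at hm
    have h3 := (mul_le_mul_of_nonneg_left hx (by linarith : 0 ≤ Frac.cast (pair n w) + 1)).trans
      (mul_le_mul_of_nonneg_right (add_le_add_left h1 1) (tol_pos m).le)
    rw [map_add, map_one]
    linarith
  · exact (tent_le_hgt _ _ _).trans (hgt_anti (not_lt.1 hn))

include hΦ in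
theorem tendsToZero_bumps
    (hT : ∀ n w w', M.mem (pair n w) T → M.mem (pair n w') T → w = w') :
    TendsToZeroAtZeroRight Φ := by
  intro k e he
  obtain rfl := isTwoPow_iff.1 he
  have hcode := isContinuousCode_bumps hΦ
  have hk := tol_pos k
  obtain ⟨l, hl⟩ : ∃ l : M.Num, hgt l < tol k / 4 := by
    obtain ⟨l, hl⟩ := exists_cast_gt (4 / tol k)
    refine ⟨l, ?_⟩
    have h0 := Frac.cast_nonneg l
    rw [hgt, map_add, map_add, map_one, inv_eq_one_div, div_lt_iff₀ (by linarith)]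
    rw [div_lt_iff₀ hk] at hl
    linarith
  obtain ⟨m, hm⟩ := exists_upper_near_zero hT l
  refine ⟨m, _, isTwoPow_exp2 m, fun x y hx hx0 hxm hy => ?_⟩
  obtain ⟨δ, hδ, hxm⟩ := (lt_const_iff hx (exp2_pos m)).1 hxm
  rw [RatRep.val_unit] at hxm
  obtain ⟨a, r, b, s, h, hxa, hs⟩ := hy.1.exists_rel (by linarith : 0 < tol k / 4)
  obtain ⟨a, r, h, ha, hxa⟩ := h.recenter hcode hx hxa
    (p := fun z => z + δ ≤ tol m) hxm
  obtain ⟨-, ⟨hr, -⟩, i, -, hU, hL⟩ := (hΦ _ _ _ _).1 h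
  have hir := mul_nonneg (Frac.cast_nonneg (i * i)) hr.le
  have h1 : -s.val ≤ b.val := by have := hU.1; linarith
  have h2 : b.val ≤ s.val + hgt l := by
    have := hgt_pos l
    rcases hL with hL | ⟨n, w, hnw, -, hL⟩
    · linarith
    · have := hm a.val (by linarith) n w hnw
      linarith
  have hyb := (distLe_const_iff hy.2.1 h.1.2.2.1 h.1.2.2.2).1 (hy.2.2 _ _ _ _ h hxa) (tol k / 8)
    (by linarith)
  rw [distLt_const_iff hy.2.1 RatRep.zero_den_pos (exp2_pos k), RatRep.val_zero, RatRep.val_unit]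
  -- Here |b| ≤ s + hgt l stays below half of `tol k`, and the distance from y to b below three
  -- eighths of it; one eighth remains as margin.
  refine ⟨tol k / 8, by linarith, ?_⟩
  filter_upwards [hyb] with n hn
  rw [sub_zero]
  change _ ≤ tol k
  rw [abs_le] at hn
  rw [← le_sub_iff_add_le, abs_le]
  constructor <;> linarith

include hΦ in
/-- The value at a peak. -/
theorem hgt_le_of_rel {n w : M.Num} (hT : M.mem (pair n w) T) {a r b s : RatRep M.Num}
    (h : Rel Φ a r b s) (ha : Frac.cast (pair n w + 1) * a.val = 1) :
    hgt n ≤ b.val + s.val := by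
  obtain ⟨-, ⟨hr, -⟩, i, hi, hU, -⟩ := (hΦ _ _ _ _).1 h
  have hir := mul_nonneg (Frac.cast_nonneg (i * i)) hr.le
  have hi0 := Frac.cast_nonneg i
  -- The ball lies to the right of 1 / i and its center is the peak 1 / (pair n w + 1), so the bump
  -- is among the first i.
  have hlt : pair n w < i := by
    by_contra! hle
    have h1 := Frac.cast_le.2 hle
    have ha0 : 0 < a.val := by
      by_contra! h
      have := mul_nonpos_of_nonneg_of_nonpos (Frac.cast_nonneg (pair n w + 1)) h
      linarith
    have := mul_nonneg hi0 hr.le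
    have := mul_le_mul_of_nonneg_right h1 ha0.le
    rw [map_add, map_one, add_mul] at ha
    rw [mul_sub] at hi
    linarith
  have := hU.2 n w hT hlt
  rw [tent_peak ha] at this
  linarith

end Bumps

/-- A `Σ⁰₁` set has unique witnesses for its members. -/
theorem exists_unique_witness (T : M.Sets) : ∃ T' : M.Sets,
    (∀ n w w', M.mem (pair n w) T' → M.mem (pair n w') T' → w = w') ∧
      ∀ n, (∃ w, M.mem (pair n w) T) ↔ ∃ w, M.mem (pair n w) T' := by
  obtain ⟨T', hT'⟩ := bdd_comp (P := fun m => ∃ n, n ≤ m ∧ ∃ w, w ≤ m ∧ (m = pair n w ∧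
    (M.mem (pair n w) T ∧ ∀ w', w' < w → ¬ M.mem (pair n w') T))) inferInstance
  have key : ∀ n w, M.mem (pair n w) T' ↔
      M.mem (pair n w) T ∧ ∀ w', w' < w → ¬ M.mem (pair n w') T := by
    intro n w
    rw [hT']
    constructor
    · rintro ⟨n', -, w', -, h, h'⟩
      obtain ⟨rfl, rfl⟩ := pair_inj.1 h
      exact h'
    · exact fun h => ⟨n, le_pair_left _ _, w, le_pair_right _ _, rfl, h⟩
  refine ⟨T', fun n w w' h h' => ?_, fun n => ⟨fun ⟨w, hw⟩ => ?_,
    fun ⟨w, hw⟩ => ⟨w, ((key n w).1 hw).1⟩⟩⟩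
  · replace h := (key _ _).1 h
    replace h' := (key _ _).1 h'
    rcases lt_trichotomy w w' with hlt | heq | hlt
    · exact (h'.2 w hlt h.1).elim
    · exact heq
    · exact (h.2 w' hlt h'.1).elim
  · obtain ⟨w, h⟩ := bdd_least (P := fun w => M.mem (pair n w) T) inferInstance hw
    exact ⟨w, (key n w).2 h⟩

/-- The number `c` codes a tuple of `Ψ` that restricts the value at `0` to less than `hgt n / 4`. -/
def Restricts (Ψ : M.Sets) (n c : M.Num) : Prop :=
  ∃ i, i ≤ c ∧ ∃ a : RatRep M.Num, a.code ≤ c ∧ ∃ r : RatRep M.Num, r.code ≤ c ∧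
    ∃ b : RatRep M.Num, b.code ≤ c ∧ ∃ s : RatRep M.Num, s.code ≤ c ∧
      (c = pair i (pair a.code (pair r.code (pair b.code s.code))) ∧ (M.mem c Ψ ∧
        ((0 < a.den ∧ 0 < r.den ∧ 0 < b.den ∧ 0 < s.den) ∧ ((0 < r ∧ 0 < s) ∧
          ((a < r ∧ ⟨a.neg, a.pos, a.den⟩ < r) ∧
            RatRep.nmul ((1 + 1 + 1 + 1) * (n + 1 + 1)) s < 1)))))

theorem dfn_restricts (Ψ : M.Sets) : Dfn M true fun y : Ctx2 M => Restricts Ψ y.1.2 y.2 := by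
  unfold Restricts; infer_instance

end L2Structure

end ReverseMath

/-! ### Σ⁰₁ comprehension from a code that is defined at 0 -/

namespace ReverseMath

namespace L2Structure

open Filter

set_option synthInstance.maxSize 1000
set_option synthInstance.maxHeartbeats 100000

variable {M : L2Structure.{u, v}} [hM : Fact M.ModelsRCA] {T Φ Ψ : M.Sets}

theorem val_swap (a : RatRep M.Num) : (⟨a.neg, a.pos, a.den⟩ : RatRep M.Num).val = -a.val := by
  simp only [RatRep.val]; ring

theorem nmul_lt_one_iff {n : M.Num} {s : RatRep M.Num} (hs : 0 < s.den) :
    RatRep.nmul ((1 + 1 + 1 + 1) * (n + 1 + 1)) s < 1 ↔ s.val < hgt n / 4 := by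
  have h : 0 < Frac.cast (n + 1 + 1) :=
    Frac.cast_pos.2 (lt_of_lt_of_le zero_lt_one le_add_self)
  rw [← RatRep.val_lt (a := RatRep.nmul ((1 + 1 + 1 + 1) * (n + 1 + 1)) s) hs RatRep.one_den_pos,
    RatRep.val_one, RatRep.val_nmul, map_mul, hgt, inv_eq_one_div, div_div, lt_div_iff₀ (by linarith)]
  have h4 : Frac.cast (1 + 1 + 1 + 1 : M.Num) = 4 := by simp only [map_add, map_one]; norm_num
  rw [h4]
  constructor <;> intro h <;> linarith

/-- Being defined at 0 means having tuples with arbitrarily small s whose balls contain 0. This is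
the information that the extension adds. -/
theorem exists_restricts (hzero : InDomain Ψ (RatSeq.const 0)) (n : M.Num) :
    ∃ c, Restricts Ψ n c := by
  obtain ⟨a, r, b, s, h, h0, hs⟩ := hzero.exists_rel (ε := hgt n / 4)
    (by have := hgt_pos n; linarith)
  obtain ⟨δ, hδ, h0⟩ := (distLt_const_iff (RatSeq.isReal_const RatRep.zero_den_pos) h.1.1
    h.1.2.1).1 h0
  simp only [RatSeq.val_const, RatRep.val_zero, zero_sub, abs_neg, eventually_const] at h0
  obtain ⟨h1, h2, i, hi⟩ := h
  have e1 := le_pair_right i (pair a.code (pair r.code (pair b.code s.code)))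
  have e2 := (le_pair_right a.code (pair r.code (pair b.code s.code))).trans e1
  have e3 := (le_pair_right r.code (pair b.code s.code)).trans e2
  have := le_abs_self a.val
  have := neg_le_abs a.val
  exact ⟨_, i, le_pair_left _ _, a, (le_pair_left _ _).trans e1, r, (le_pair_left _ _).trans e2, b,
    (le_pair_left _ _).trans e3, s, (le_pair_right _ _).trans e3, rfl, hi, h1, h2,
    ⟨(RatRep.val_lt h1.1 h1.2.1).1 (by linarith),
      (RatRep.val_lt (a := ⟨a.neg, a.pos, a.den⟩) h1.1 h1.2.1).1 (by rw [val_swap]; linarith)⟩,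
    (nmul_lt_one_iff h1.2.2.2).2 hs⟩

/-- Suppose w > c. The gap between r and |a| is at least 1 / (a.den * r.den) ≥ 1 / c, since c codes
the tuple; so the peak 1 / (pair n w + 1) lies in the ball. As 0 lies there too, with value 0, the
value at the peak is at most 2 s, hence less than half of `hgt n`. But it is at least `hgt n`, since
the extension agrees with f at the peak. -/
theorem le_of_restricts (hΦ : ∀ a r b s, Rel Φ a r b s ↔
      (0 < a.den ∧ 0 < r.den ∧ 0 < b.den ∧ 0 < s.den) ∧ (0 < r.val ∧ 0 < s.val) ∧
        BumpVal T a.val r.val b.val s.val)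
    (hval : ∀ x : M.Sets, (seq x).InIoo →
      ∃ y : M.Sets, IsValue Φ (seq x) (seq y) ∧ IsValue Ψ (seq x) (seq y))
    (hzero : IsValue Ψ (RatSeq.const 0) (RatSeq.const 0)) {n c w : M.Num}
    (hc : Restricts Ψ n c) (hw : M.mem (pair n w) T) : w ≤ c := by
  obtain ⟨i, -, a, -, r, -, b, -, s, -, hci, hmem, hd, hpos, ⟨har, har'⟩, hs⟩ := hc
  have hrel : Rel Ψ a r b s := ⟨hd, hpos, i, hci ▸ hmem⟩
  rw [nmul_lt_one_iff hd.2.2.2] at hs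
  by_contra! hcw
  have hle : a.den * r.den ≤ c := by
    rw [hci]
    refine le_trans ?_ (le_pair_right _ _)
    refine le_trans ?_ (mul_le_pair _ _)
    exact mul_le_mul' a.le_code.2.2 (r.le_code.2.2.trans (le_pair_left _ _))
  have hcm : c < pair n w := hcw.trans_le (le_pair_right _ _)
  have hm1 : 0 < pair n w + 1 := lt_of_lt_of_le zero_lt_one le_add_self
  have hm1' := Frac.cast_pos.2 hm1
  have hinv : (Frac.cast (pair n w + 1))⁻¹ < (Frac.cast (a.den * r.den))⁻¹ :=
    inv_strictAnti₀ (Frac.cast_pos.2 (mul_pos hd.1 hd.2.1))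
      (Frac.cast_lt.2 (hle.trans_lt (hcm.trans_le le_self_add)))
  have h1 := RatRep.inv_le_sub hd.1 hd.2.1 har
  have h2 := RatRep.inv_le_sub (a := ⟨a.neg, a.pos, a.den⟩) hd.1 hd.2.1 har'
  rw [val_swap] at h2
  have hp : 0 < (⟨1, 0, pair n w + 1⟩ : RatRep M.Num).den := hm1
  have hpv : (⟨1, 0, pair n w + 1⟩ : RatRep M.Num).val = (Frac.cast (pair n w + 1))⁻¹ :=
    RatRep.val_unit _
  have hpos' := inv_pos.2 hm1'
  obtain ⟨x, hx⟩ := exists_seq_const hp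
  have hx1 : (seq x).InIoo := by
    rw [hx]
    refine inIoo_const hp (by rw [hpv]; exact hpos') ?_
    rw [hpv]
    refine inv_lt_one_of_one_lt₀ ?_
    rw [map_add, map_one]
    have := Frac.cast_pos.2 (lt_of_le_of_lt zero_le hcm)
    linarith
  obtain ⟨y, hyΦ, hyΨ⟩ := hval x hx1
  -- In units of `hgt n`, the final estimates bound the value at the peak from below by 1 - 3/16 and
  -- from above by 2/4 + 2/16.
  have hη : 0 < hgt n / 16 := by have := hgt_pos n; linarith
  have hyb := (distLe_const_iff hyΨ.2.1 hd.2.2.1 hd.2.2.2).1 (hyΨ.2.2 _ _ _ _ hrel (by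
    rw [hx, distLt_const_iff (RatSeq.isReal_const hp) hd.1 hd.2.1]
    refine ⟨r.val - |(Frac.cast (pair n w + 1))⁻¹ - a.val|, sub_pos.2 (abs_lt.2 ?_), ?_⟩
    · constructor <;> linarith
    · simp [RatSeq.val_const, hpv])) _ hη
  have hb := (distLe_const_iff hzero.2.1 hd.2.2.1 hd.2.2.2).1 (hzero.2.2 _ _ _ _ hrel (by
    rw [distLt_const_iff hzero.2.1 hd.1 hd.2.1]
    refine ⟨r.val - |a.val|, sub_pos.2 (abs_lt.2 ?_), ?_⟩
    · constructor <;> linarith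
    · simp [RatSeq.val_const, RatRep.val_zero])) _ hη
  obtain ⟨a', r', b', s', h', hxa', hs'⟩ := hyΦ.1.exists_rel hη
  have hyb' := (distLe_const_iff hyΦ.2.1 h'.1.2.2.1 h'.1.2.2.2).1
    (hyΦ.2.2 _ _ _ _ h' hxa') _ hη
  have hpeak : hgt n ≤ b'.val + s'.val := by
    obtain ⟨δ, hδ, h3⟩ := (distLt_const_iff hx1.1 h'.1.1 h'.1.2.1).1 hxa'
    simp only [hx, RatSeq.val_const, eventually_const] at h3
    -- The tuple of Φ is moved to a smaller ball centered exactly at the peak, where `hgt_le_of_rel`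
    -- applies.
    obtain ⟨ρ, hρ, hρv⟩ := RatRep.exists_val_eq (δ / 2)
    refine hgt_le_of_rel hΦ hw ((isContinuousCode_iff.1 (isContinuousCode_bumps hΦ)).2.1 _ _ _ _
      ⟨1, 0, pair n w + 1⟩ ρ h' hp hρ (by linarith) ?_) ?_
    · rw [abs_sub_comm]; linarith
    · rw [hpv, mul_inv_cancel₀ hm1'.ne']
  obtain ⟨k, h3, h4, h5⟩ := (hyb.and (hb.and hyb')).exists
  rw [RatSeq.val_const, RatRep.val_zero] at h4
  rw [abs_le] at h3 h4 h5
  linarith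

/-- The one-point-extension theorem for codes implies `Σ⁰₁` comprehension. -/
theorem OnePointExtension.sigmaComp (h : M.OnePointExtension) : SigmaComp M := by
  intro T₀
  -- Unique witnesses give each n at most one bump; with several, bumps of one height might
  -- accumulate at 0 and destroy the limit.
  obtain ⟨T, hT, hTT⟩ := exists_unique_witness T₀
  obtain ⟨Φ, hΦ⟩ := exists_bumpVal T
  obtain ⟨Ψ, -, -, hval, hzero⟩ := h Φ (isContinuousCode_bumps hΦ)
    (fun x hx => inDomain_bumps hΦ hx) (tendsToZero_bumps hΦ hT)
  obtain ⟨z, hz⟩ := exists_seq_const (M := M) RatRep.zero_den_pos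
  have hz0 := RatSeq.isReal_const (N := M.Num) RatRep.zero_den_pos
  have hzero' : IsValue Ψ (RatSeq.const 0) (RatSeq.const 0) := by
    have := hzero z (by rwa [hz]) (by rw [hz]; exact RatSeq.eqv_refl hz0)
    rwa [hz] at this
  have hdfn := dfn_restricts Ψ
  -- The Π⁰₁ form: every restricting code c bounds some witness. It implies the Σ⁰₁ form because a
  -- restricting code exists for each n.
  obtain ⟨X, hX⟩ := delta_comp (P := fun n w => M.mem (pair n w) T)
    (Q := fun n c => Restricts Ψ n c → ∃ w, w ≤ c ∧ M.mem (pair n w) T) inferInstance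
    inferInstance fun n => by
      constructor
      · rintro ⟨w, hw⟩ c hc
        exact ⟨w, le_of_restricts hΦ hval hzero' hc hw, hw⟩
      · intro hn
        obtain ⟨c, hc⟩ := exists_restricts hzero'.1 n
        obtain ⟨w, -, hw⟩ := hn c hc
        exact ⟨w, hw⟩
  exact ⟨X, fun n => (hX n).trans (hTT n).symm⟩

end L2Structure

end ReverseMath

/-- The one-point-extension theorem for third-order functions holds in every model of `RCA₀^ω`
(that is, it is provable in `RCA₀^ω`), and over `RCA₀` its version for RM-codes is equivalent
to `ACA₀`. -/
theorem theorem2p5 :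
    (∀ M : ReverseMath.OmegaStructure.{u}, M.ModelsRCAω → M.OnePointExtension) ∧
    (∀ M : ReverseMath.L2Structure.{u, v}, M.ModelsRCA → (M.ACA ↔ M.OnePointExtension)) := by
  refine ⟨fun M hM => ?_, fun M hM => ?_⟩
  · have : Fact M.ModelsRCAω := ⟨hM⟩
    exact M.onePointExtension
  · have : Fact M.ModelsRCA := ⟨hM⟩
    exact ⟨fun h => h.onePointExtension, fun h => h.sigmaComp.aca⟩
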